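/- Let $K$ be a field of characteristic $p \ge 5$, let $K(s,t)$ be the field of rational functions over $K$ in two independent variables $s,t$, and let $E_{s,t}$ be the elliptic curve $y^2 = x^3 + sx + t$ over $K(s,t)$. Fix an algebraic closure $\Omega$ of $K(s,t)$. For an integer $n \ge 1$ let $E_{s,t}[p^n]$ be the group of points $P \in E_{s,t}(\Omega)$ with $p^n P = O$, and let $K(s,t)(E_{s,t}[p^n]) \subseteq \Omega$ be the field generated over $K(s,t)$ by the coordinates $x(P), y(P)$ of all points $P \ne O$ in $E_{s,t}[p^n]$. Then, for every $n \ge 1$, the extension $K(s,t)(E_{s,t}[p^n])/K(s,t)$ is normal, and the group of field automorphisms of $K(s,t)(E_{s,t}[p^n])$ fixing $K(s,t)$ pointwise is isomorphic to $(\mathbb{Z}/p^n\mathbb{Z})^\times$. -/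

import Mathlib

open scoped WeierstrassCurve.Affine

/-- The rational function field `K(s, t)` in two independent variables `s = X 0`, `t = X 1`. -/
abbrev RatFunc2 (K : Type*) [Field K] : Type _ :=
  FractionRing (MvPolynomial (Fin 2) K)

/-- The element `s` of `K(s, t)`. -/
noncomputable def varS (K : Type*) [Field K] : RatFunc2 K :=
  algebraMap (MvPolynomial (Fin 2) K) (RatFunc2 K) (MvPolynomial.X 0)

/-- The element `t` of `K(s, t)`. -/
noncomputable def varT (K : Type*) [Field K] : RatFunc2 K :=
  algebraMap (MvPolynomial (Fin 2) K) (RatFunc2 K) (MvPolynomial.X 1)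

/-- The Weierstrass curve `y² = x³ + s x + t` over `K(s, t)`. -/
noncomputable def curveST (K : Type*) [Field K] : WeierstrassCurve.Affine (RatFunc2 K) where
  a₁ := 0
  a₂ := 0
  a₃ := 0
  a₄ := varS K
  a₆ := varT K

open Classical in
/-- The field `F(E[N])`: the subfield of a fixed algebraic closure of `F` generated over `F` by the
coordinates of all the affine points of `E` over the algebraic closure that are killed by `N`. -/
noncomputable def torsionField {F : Type*} [Field F] (E : WeierstrassCurve.Affine F) (N : ℕ) :
    IntermediateField F (AlgebraicClosure F) :=
  IntermediateField.adjoin F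
    {z | ∃ (x y : AlgebraicClosure F) (h : (E⁄(AlgebraicClosure F)).Nonsingular x y),
      N • (WeierstrassCurve.Affine.Point.some x y h) = 0 ∧ (z = x ∨ z = y)}

/-! In characteristic `p`, multiplication by `p` is Frobenius followed by Verschiebung. On
`x`-coordinates this reads `x(pP) = N(x^p) / D(x^p)^2`, with `N = verNum` monic of degree `p` and `D
= verDen` of degree at most `(p - 1) / 2`. Division polynomials give this explicitly. An invariant
derivation at the universal point shows that the Wronskian of `Φ_p` and `ΨSq_p` is `p` times a
polynomial. Modulo `p` it vanishes, and coprimality then makes both polynomials functions of `X ^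
p`.

Dividing the same Wronskian identity by `p` before reducing relates `N` and `D` to the Hasse
invariant `A`, the coefficient of `X^(p-1)` in `(X^3 + sX + t)^((p-1)/2)`. If `A ≠ 0`, then `D` has
degree `(p - 1) / 2` and leading coefficient `±A`; if `A = 0`, then `D` is a nonzero constant
(`verDen_of_hasse_ne_zero`, `exists_verDen_eq_C`).

Over `K[s, t]` the polynomial `A` is squarefree, by Igusa's argument with a second order
differential equation, and its prime factors do not divide the discriminant
(`not_sq_dvd_generic_hasse`, `not_dvd_disc_of_dvd_hasse`). At a prime `π` dividing `A`, the reversal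
of `D` is therefore Eisenstein. For a valuation above `π` and a point of order `p^n`, climbing the
tower of `p`-division points shows that `w = (x / y)^(p^n)` satisfies `v(w)^φ(p^n) = v(π)`. So `w`
has degree at least `φ(p^n)` over `K(s, t)`. It is also separable, because each step of the tower is
given by a polynomial of degree at most `p` with nonzero derivative.

Finally `E[p^n]` is cyclic, since `D` has too few roots for anything larger. Galois thus acts on a
generator through a character to `(ℤ/p^n)ˣ`. The conjugates of `w` make this character surjective,
and its kernel is the group fixing the torsion field (`nonempty_mulEquiv_units`). -/

/-- The short Weierstrass curve `y² = x³ + s x + t`. -/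
def shortCurve {R : Type*} [CommRing R] (s t : R) : WeierstrassCurve R where
  a₁ := 0
  a₂ := 0
  a₃ := 0
  a₄ := s
  a₆ := t

/-! ### The short Weierstrass curve and its group law in coordinates -/

namespace shortCurve

section CommRing

variable {R S : Type*} [CommRing R] [CommRing S] (s t : R)

@[simp] lemma a₁_eq : (shortCurve s t).a₁ = 0 := rfl
@[simp] lemma a₂_eq : (shortCurve s t).a₂ = 0 := rfl
@[simp] lemma a₃_eq : (shortCurve s t).a₃ = 0 := rfl
@[simp] lemma a₄_eq : (shortCurve s t).a₄ = s := rfl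
@[simp] lemma a₆_eq : (shortCurve s t).a₆ = t := rfl

lemma map_eq (f : R →+* S) : (shortCurve s t).map f = shortCurve (f s) (f t) := by
  simp [WeierstrassCurve.map, shortCurve]

@[simp] lemma negY_eq (x y : R) : (shortCurve s t).toAffine.negY x y = -y := by
  simp [WeierstrassCurve.Affine.negY]

variable {s t}

lemma equation_iff {x y : R} :
    (shortCurve s t).toAffine.Equation x y ↔ y ^ 2 = x ^ 3 + s * x + t := by
  simp [WeierstrassCurve.Affine.equation_iff]

end CommRing

section Field

open WeierstrassCurve.Affine

variable {F : Type*} [Field F] {s t : F}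

lemma nonsingular_iff {x y : F} : (shortCurve s t).toAffine.Nonsingular x y ↔
    y ^ 2 = x ^ 3 + s * x + t ∧ (3 * x ^ 2 + s ≠ 0 ∨ y ≠ -y) := by
  rw [WeierstrassCurve.Affine.nonsingular_iff, equation_iff]
  simp only [a₁_eq, a₂_eq, a₃_eq, a₄_eq]
  simp [eq_comm]

/-- The `x`-coordinate of a point, with value `0` at infinity. -/
def xc {W : WeierstrassCurve.Affine F} : W.Point → F
  | .zero => 0
  | .some x _ _ => x

/-- The `y`-coordinate of a point, with value `0` at infinity. -/
def yc {W : WeierstrassCurve.Affine F} : W.Point → F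
  | .zero => 0
  | .some _ y _ => y

@[simp] lemma xc_some {W : WeierstrassCurve.Affine F} {x y : F} (h : W.Nonsingular x y) :
    xc (Point.some x y h) = x := rfl

@[simp] lemma yc_some {W : WeierstrassCurve.Affine F} {x y : F} (h : W.Nonsingular x y) :
    yc (Point.some x y h) = y := rfl

lemma exists_eq_some {W : WeierstrassCurve.Affine F} {P : W.Point} (hP : P ≠ 0) :
    ∃ h : W.Nonsingular (xc P) (yc P), P = Point.some _ _ h := by
  cases P with
  | zero => exact absurd rfl hP
  | some x y h => exact ⟨h, rfl⟩

lemma xc_neg {W : WeierstrassCurve.Affine F} (P : W.Point) : xc (-P) = xc P := by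
  cases P with
  | zero => rfl
  | some x y h => rfl

lemma nonsingular_of_ne_zero {P : (shortCurve s t).toAffine.Point} (hP : P ≠ 0) :
    yc P ^ 2 = xc P ^ 3 + s * xc P + t ∧ (3 * xc P ^ 2 + s ≠ 0 ∨ yc P ≠ -yc P) := by
  obtain ⟨h, -⟩ := exists_eq_some hP
  exact nonsingular_iff.mp h

lemma yc_neg (P : (shortCurve s t).toAffine.Point) : yc (-P) = -yc P := by
  cases P with
  | zero => exact neg_zero.symm
  | some x y h => simp

lemma eq_or_eq_neg_of_xc_eq {P Q : (shortCurve s t).toAffine.Point} (hP : P ≠ 0) (hQ : Q ≠ 0)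
    (h : xc P = xc Q) : P = Q ∨ P = -Q := by
  obtain ⟨h₁, e₁⟩ := exists_eq_some hP
  obtain ⟨h₂, e₂⟩ := exists_eq_some hQ
  rw [e₁, e₂]
  exact Point.X_eq_iff.mp h

variable [DecidableEq F]

lemma xc_ne {P Q : (shortCurve s t).toAffine.Point} (hP : P ≠ 0) (hQ : Q ≠ 0)
    (h : P + Q ≠ 0) (h' : P - Q ≠ 0) : xc P ≠ xc Q := by
  intro e
  rcases eq_or_eq_neg_of_xc_eq hP hQ e with rfl | rfl
  · simp at h'
  · simp at h

lemma add_ne_zero_of_xc_ne {P Q : (shortCurve s t).toAffine.Point} (h : xc P ≠ xc Q) :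
    P + Q ≠ 0 := by
  intro e
  rw [eq_neg_of_add_eq_zero_left e, xc_neg] at h
  exact h rfl

lemma xc_add {P Q : (shortCurve s t).toAffine.Point} (hP : P ≠ 0) (hQ : Q ≠ 0)
    (h : xc P ≠ xc Q) :
    xc (P + Q) = ((yc P - yc Q) / (xc P - xc Q)) ^ 2 - xc P - xc Q ∧
    yc (P + Q) = (yc P - yc Q) / (xc P - xc Q) * (xc P - xc (P + Q)) - yc P := by
  obtain ⟨h₁, e₁⟩ := exists_eq_some hP
  obtain ⟨h₂, e₂⟩ := exists_eq_some hQ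
  generalize xc P = x₁ at *
  generalize yc P = y₁ at *
  generalize xc Q = x₂ at *
  generalize yc Q = y₂ at *
  subst e₁ e₂
  rw [Point.add_of_X_ne h]
  simp only [xc_some, yc_some]
  constructor
  · rw [slope_of_X_ne h]
    simp [addX]
  · rw [addY, negAddY, negY_eq, slope_of_X_ne h]
    ring

lemma xc_two_nsmul {P : (shortCurve s t).toAffine.Point} (hP : P ≠ 0) (h : yc P ≠ -yc P) :
    xc (2 • P) = ((3 * xc P ^ 2 + s) / (2 * yc P)) ^ 2 - 2 * xc P ∧
    yc (2 • P) = (3 * xc P ^ 2 + s) / (2 * yc P) * (xc P - xc (2 • P)) - yc P := by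
  obtain ⟨h₁, e₁⟩ := exists_eq_some hP
  generalize xc P = x₁ at *
  generalize yc P = y₁ at *
  subst e₁
  have h' : y₁ ≠ (shortCurve s t).toAffine.negY x₁ y₁ := by rwa [negY_eq]
  rw [two_nsmul, Point.add_self_of_Y_ne h']
  have hs : (shortCurve s t).toAffine.slope x₁ x₁ y₁ y₁ = (3 * x₁ ^ 2 + s) / (2 * y₁) := by
    rw [slope_of_Y_ne rfl h', negY_eq]
    simp [two_mul]
  simp only [xc_some, yc_some]
  constructor
  · rw [hs]
    simp [addX]
    ring
  · rw [addY, negAddY, negY_eq, hs]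
    ring

lemma two_nsmul_eq_zero_iff {P : (shortCurve s t).toAffine.Point} :
    2 • P = 0 ↔ yc P = -yc P := by
  cases P with
  -- At infinity `yc` takes the default value `0 = -0`, so the criterion also covers `P = 0`.
  | zero =>
    constructor
    · intro; exact neg_zero.symm
    · intro; exact nsmul_zero 2
  | some x y h =>
    rw [two_nsmul, add_eq_zero_iff_eq_neg, Point.neg_some, Point.some.injEq]
    simp

/-- The sum of the `x`-coordinates of `P + Q` and `P - Q`. -/
lemma xc_add_add_xc_sub {P Q : (shortCurve s t).toAffine.Point} (hP : P ≠ 0) (hQ : Q ≠ 0)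
    (h : xc P ≠ xc Q) :
    (xc P - xc Q) ^ 2 * (xc (P + Q) + xc (P - Q)) =
      2 * ((xc P * xc Q + s) * (xc P + xc Q) + 2 * t) := by
  have e₁ := (xc_add hP hQ h).1
  have e₂ := (xc_add hP (neg_ne_zero.mpr hQ) (by rwa [xc_neg])).1
  rw [← sub_eq_add_neg, xc_neg, yc_neg] at e₂
  have f₁ := (nonsingular_of_ne_zero hP).1
  have f₂ := (nonsingular_of_ne_zero hQ).1
  have := sub_ne_zero.mpr h
  rw [e₁, e₂]
  field_simp
  linear_combination 2 * f₁ + 2 * f₂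

/-- The product of the `x`-coordinates of `P + Q` and `P - Q`. -/
lemma xc_add_mul_xc_sub {P Q : (shortCurve s t).toAffine.Point} (hP : P ≠ 0) (hQ : Q ≠ 0)
    (h : xc P ≠ xc Q) :
    (xc P - xc Q) ^ 2 * (xc (P + Q) * xc (P - Q)) =
      (xc P * xc Q - s) ^ 2 - 4 * t * (xc P + xc Q) := by
  have e₁ := (xc_add hP hQ h).1
  have e₂ := (xc_add hP (neg_ne_zero.mpr hQ) (by rwa [xc_neg])).1
  rw [← sub_eq_add_neg, xc_neg, yc_neg] at e₂
  have f₁ := (nonsingular_of_ne_zero hP).1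
  have f₂ := (nonsingular_of_ne_zero hQ).1
  have := sub_ne_zero.mpr h
  rw [e₁, e₂]
  field_simp
  generalize xc P = a at *
  generalize yc P = b at *
  generalize xc Q = c at *
  generalize yc Q = d at *
  have hb : b ^ 4 = (a ^ 3 + s * a + t) ^ 2 := by rw [← f₁]; ring
  have hd : d ^ 4 = (c ^ 3 + s * c + t) ^ 2 := by rw [← f₂]; ring
  ring_nf
  rw [hb, hd, f₁, f₂]
  ring

/-- The difference of the `x`-coordinates of `P - Q` and `P + Q`. -/
lemma xc_sub_sub_xc_add {P Q : (shortCurve s t).toAffine.Point} (hP : P ≠ 0) (hQ : Q ≠ 0)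
    (h : xc P ≠ xc Q) :
    (xc P - xc Q) ^ 2 * (xc (P - Q) - xc (P + Q)) = 4 * yc P * yc Q := by
  have e₁ := (xc_add hP hQ h).1
  have e₂ := (xc_add hP (neg_ne_zero.mpr hQ) (by rwa [xc_neg])).1
  rw [← sub_eq_add_neg, xc_neg, yc_neg] at e₂
  have := sub_ne_zero.mpr h
  rw [e₁, e₂]
  field_simp
  ring

lemma xc_two_nsmul_mul {P : (shortCurve s t).toAffine.Point} (hP : P ≠ 0) (h : 2 • P ≠ 0) :
    4 * yc P ^ 2 * xc (2 • P) = (xc P ^ 2 - s) ^ 2 - 8 * t * xc P := by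
  have h' : yc P ≠ -yc P := fun e ↦ h (two_nsmul_eq_zero_iff.mpr e)
  have h2 : 2 * yc P ≠ 0 := fun e ↦ h' (by linear_combination e)
  have f₁ := (nonsingular_of_ne_zero hP).1
  rw [(xc_two_nsmul hP h').1, div_pow, mul_sub, show 4 * yc P ^ 2 = (2 * yc P) ^ 2 by ring,
    mul_div_cancel₀ _ (pow_ne_zero 2 h2)]
  linear_combination -8 * xc P * f₁

end Field

end shortCurve

/-! ### Division polynomials at a point of infinite order -/

namespace shortCurve

section CommRing

variable {R S : Type*} [CommRing R] [CommRing S]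

/-- The value of the `3`-division polynomial of `y² = x³ + s x + t` at `x`. -/
def psi₃ (s t x : R) : R := 3 * x ^ 4 + 6 * s * x ^ 2 + 12 * t * x - s ^ 2

/-- The value of `ψ₄ / ψ₂` for `y² = x³ + s x + t` at `x`. -/
def prePsi₄ (s t x : R) : R :=
  2 * x ^ 6 + 10 * s * x ^ 4 + 40 * t * x ^ 3 - 10 * s ^ 2 * x ^ 2 - 8 * s * t * x
    - 16 * t ^ 2 - 2 * s ^ 3

/-- The values of the division polynomials of `y² = x³ + s x + t` at the point `(x, y)`. -/
def eds (s t x y : R) (n : ℤ) : R := normEDS (2 * y) (psi₃ s t x) (prePsi₄ s t x) n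

/-- The numerators of the multiples of the point `(x, y)` on `y² = x³ + s x + t`. -/
def phi (s t x y : R) (n : ℤ) : R :=
  x * eds s t x y n ^ 2 - eds s t x y (n + 1) * eds s t x y (n - 1)

variable (s t x y : R)

@[simp] lemma eds_zero : eds s t x y 0 = 0 := normEDS_zero ..
@[simp] lemma eds_one : eds s t x y 1 = 1 := normEDS_one ..
@[simp] lemma eds_two : eds s t x y 2 = 2 * y := normEDS_two ..
@[simp] lemma eds_three : eds s t x y 3 = psi₃ s t x := normEDS_three ..
@[simp] lemma eds_four : eds s t x y 4 = prePsi₄ s t x * (2 * y) := normEDS_four ..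

lemma map_eds (f : R →+* S) (n : ℤ) : f (eds s t x y n) = eds (f s) (f t) (f x) (f y) n := by
  simp [eds, map_normEDS, psi₃, prePsi₄, map_ofNat]

lemma map_phi (f : R →+* S) (n : ℤ) : f (phi s t x y n) = phi (f s) (f t) (f x) (f y) n := by
  simp [phi, map_eds]

end CommRing

section InfiniteOrder

variable {F : Type*} [Field F] [DecidableEq F] {s t : F} {P : (shortCurve s t).toAffine.Point}

/-- The sequence defined by the recursion which the division polynomials satisfy at a point of
infinite order. -/
noncomputable def mulSeq (P : (shortCurve s t).toAffine.Point) : ℕ → F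
  | 0 => 0
  | 1 => 1
  | 2 => 2 * yc P
  | n + 3 => mulSeq P (n + 2) ^ 2 * (xc P - xc ((n + 2) • P)) / mulSeq P (n + 1)

variable (hP : ∀ n : ℕ, 1 ≤ n → n • P ≠ 0)

include hP

lemma xc_nsmul_ne {m n : ℕ} (hn : 1 ≤ n) (hm : n < m) : xc (m • P) ≠ xc (n • P) := by
  refine xc_ne (hP m (by omega)) (hP n hn) ?_ ?_
  · rw [← add_nsmul]; exact hP _ (by omega)
  · rw [sub_eq_add_neg, ← sub_nsmul P hm.le]; exact hP _ (by omega)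

lemma two_mul_yc_ne_zero : 2 * yc P ≠ 0 := by
  intro e
  exact hP 2 (by norm_num) (two_nsmul_eq_zero_iff.mpr (by linear_combination e))

lemma mulSeq_ne_zero : ∀ n : ℕ, 1 ≤ n → mulSeq P n ≠ 0
  | 0, h => absurd h (by norm_num)
  | 1, _ => by simp [mulSeq]
  | 2, _ => by simpa [mulSeq] using two_mul_yc_ne_zero hP
  | n + 3, _ => by
    rw [mulSeq]
    have := xc_nsmul_ne hP le_rfl (show 1 < n + 2 by omega)
    rw [one_nsmul] at this
    exact div_ne_zero (mul_ne_zero (pow_ne_zero _ (mulSeq_ne_zero _ (by omega)))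
      (sub_ne_zero.mpr this.symm)) (mulSeq_ne_zero _ (by omega))

lemma mulSeq_step (n : ℕ) :
    mulSeq P (n + 2) * mulSeq P n = mulSeq P (n + 1) ^ 2 * (xc P - xc ((n + 1) • P)) := by
  cases n with
  | zero => simp [mulSeq]
  | succ n => rw [mulSeq, div_mul_cancel₀ _ (mulSeq_ne_zero hP _ (by omega))]

lemma mulSeq_mul_two (m : ℕ) (hm : 2 < m) : mulSeq P (m + 2) * mulSeq P (m - 2) =
    mulSeq P m ^ 2 * mulSeq P 2 ^ 2 * (xc (2 • P) - xc (m • P)) := by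
  obtain ⟨k, rfl⟩ := Nat.exists_eq_add_of_lt hm
  rw [show 2 + k + 1 = k + 3 by ring, show k + 3 - 2 = k + 1 by omega]
  have h₀ := hP 1 le_rfl
  rw [one_nsmul] at h₀
  have h₁ := mulSeq_step hP (k + 3)
  have h₂ := mulSeq_step hP (k + 2)
  have h₃ := mulSeq_step hP (k + 1)
  have h₄ := mulSeq_ne_zero hP (k + 3) (by omega)
  have h₅ := xc_nsmul_ne hP le_rfl (show 1 < k + 3 by omega)
  rw [one_nsmul] at h₅
  have h₆ := xc_add_add_xc_sub (hP (k + 3) (by omega)) h₀ h₅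
  have h₇ := xc_add_mul_xc_sub (hP (k + 3) (by omega)) h₀ h₅
  rw [show (k + 3) • P - P = (k + 2) • P by rw [succ_nsmul]; abel,
    show (k + 3) • P + P = (k + 4) • P by rw [succ_nsmul _ (k + 3)]] at h₆ h₇
  have h₈ := xc_two_nsmul_mul h₀ (hP 2 (by norm_num))
  have h₉ := (nonsingular_of_ne_zero h₀).1
  have e2 : mulSeq P 2 = 2 * yc P := rfl
  rw [e2]
  refine mul_left_cancel₀ (pow_ne_zero 2 h₄) ?_
  have key : (xc ((k + 3) • P) - xc P) ^ 2 *
      ((xc P - xc ((k + 4) • P)) * (xc P - xc ((k + 2) • P))) =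
      4 * yc P ^ 2 * (xc (2 • P) - xc ((k + 3) • P)) := by
    linear_combination (-xc P) * h₆ + h₇ - h₈ + 4 * xc ((k + 3) • P) * h₉
  calc _ = mulSeq P (k + 5) * mulSeq P (k + 3) * (mulSeq P (k + 3) * mulSeq P (k + 1)) := by ring
    _ = (mulSeq P (k + 4) * mulSeq P (k + 2)) ^ 2 *
        ((xc P - xc ((k + 4) • P)) * (xc P - xc ((k + 2) • P))) := by rw [h₁, h₃]; ring
    _ = mulSeq P (k + 3) ^ 4 * ((xc ((k + 3) • P) - xc P) ^ 2 *
        ((xc P - xc ((k + 4) • P)) * (xc P - xc ((k + 2) • P)))) := by rw [h₂]; ring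
    _ = _ := by rw [key]; ring

/-- This is the elliptic relation. The induction carries two consecutive values of `n`, because the
step to `n + 2` uses both `n` and `n + 1`. -/
lemma mulSeq_mul (n : ℕ) (hn : 1 ≤ n) : (∀ m : ℕ, n < m → mulSeq P (m + n) * mulSeq P (m - n) =
    mulSeq P m ^ 2 * mulSeq P n ^ 2 * (xc (n • P) - xc (m • P))) ∧
    (∀ m : ℕ, n + 1 < m → mulSeq P (m + (n + 1)) * mulSeq P (m - (n + 1)) =
    mulSeq P m ^ 2 * mulSeq P (n + 1) ^ 2 * (xc ((n + 1) • P) - xc (m • P))) := by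
  induction n, hn using Nat.le_induction with
  | base =>
    refine ⟨fun m hm ↦ ?_, mulSeq_mul_two hP⟩
    obtain ⟨k, rfl⟩ := Nat.exists_eq_add_of_lt hm
    have := mulSeq_step hP (k + 1)
    rw [show 1 + k + 1 = k + 2 by ring, show k + 2 - 1 = k + 1 by omega, this]
    simp [mulSeq]
  | succ n hn ih =>
    refine ⟨ih.2, fun m hm ↦ ?_⟩
    obtain ⟨k, rfl⟩ := Nat.exists_eq_add_of_lt hm
    have h₀ := hP 1 le_rfl
    rw [one_nsmul] at h₀
    have f₁ := ih.1 (n + 1 + 1 + k + 1) (by omega)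
    have f₂ := ih.2 (n + 1 + 1 + k + 1) (by omega)
    rw [show n + 1 + 1 + k + 1 + n = 2 * n + k + 3 by ring,
      show n + 1 + 1 + k + 1 - n = k + 3 by omega, show n + 1 + 1 + k + 1 = n + k + 3 by ring] at f₁
    rw [show n + 1 + 1 + k + 1 + (n + 1) = 2 * n + k + 4 by ring,
      show n + 1 + 1 + k + 1 - (n + 1) = k + 2 by omega,
      show n + 1 + 1 + k + 1 = n + k + 3 by ring] at f₂
    rw [show n + 1 + 1 + k + 1 + (n + 1 + 1) = 2 * n + k + 5 by ring,
      show n + 1 + 1 + k + 1 - (n + 1 + 1) = k + 1 by omega,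
      show n + 1 + 1 + k + 1 = n + k + 3 by ring, show n + 1 + 1 = n + 2 by ring]
    have a₁ := mulSeq_step hP (2 * n + k + 3)
    have a₂ := mulSeq_step hP (k + 1)
    have a₃ := mulSeq_step hP n
    have d₁ := xc_nsmul_ne hP (show 1 ≤ n + 1 by omega) (show n + 1 < n + k + 3 by omega)
    have s₁ := xc_add_add_xc_sub (hP (n + k + 3) (by omega)) (hP (n + 1) (by omega)) d₁
    have p₁ := xc_add_mul_xc_sub (hP (n + k + 3) (by omega)) (hP (n + 1) (by omega)) d₁
    rw [← add_nsmul, sub_eq_add_neg ((n + k + 3) • P), ← sub_nsmul P (by omega),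
      show n + k + 3 + (n + 1) = 2 * n + k + 4 by ring,
      show n + k + 3 - (n + 1) = k + 2 by omega] at s₁ p₁
    have d₂ := xc_nsmul_ne hP le_rfl (show 1 < n + 1 by omega)
    rw [one_nsmul] at d₂
    have s₂ := xc_add_add_xc_sub (hP (n + 1) (by omega)) h₀ d₂
    have p₂ := xc_add_mul_xc_sub (hP (n + 1) (by omega)) h₀ d₂
    rw [show (n + 1) • P - P = n • P by rw [succ_nsmul]; abel,
      show (n + 1) • P + P = (n + 2) • P by rw [succ_nsmul _ (n + 1)]] at s₂ p₂
    -- For points `A, B, C` with abscissas `a, b, c`, the expression `(a - b)^2 (c - x(A + B)) (c -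
    -- x(A - B))` is symmetric in `a, b, c`. Here `A = (n + k + 3) • P`, `B = (n + 1) • P`, `C = P`.
    have key : (xc ((n + k + 3) • P) - xc ((n + 1) • P)) ^ 2 *
        ((xc P - xc ((2 * n + k + 4) • P)) * (xc P - xc ((k + 2) • P))) =
        (xc ((n + 1) • P) - xc P) ^ 2 * ((xc ((n + 2) • P) - xc ((n + k + 3) • P)) *
          (xc (n • P) - xc ((n + k + 3) • P))) := by
      linear_combination (-xc P) * s₁ + p₁ + xc ((n + k + 3) • P) * s₂ - p₂
    refine mul_left_cancel₀ (mul_ne_zero (mulSeq_ne_zero hP (2 * n + k + 3) (by omega))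
      (mulSeq_ne_zero hP (k + 3) (by omega))) ?_
    calc _ = mulSeq P (2 * n + k + 5) * mulSeq P (2 * n + k + 3) *
          (mulSeq P (k + 3) * mulSeq P (k + 1)) := by ring
      _ = (mulSeq P (2 * n + k + 4) * mulSeq P (k + 2)) ^ 2 *
          ((xc P - xc ((2 * n + k + 4) • P)) * (xc P - xc ((k + 2) • P))) := by rw [a₁, a₂]; ring
      _ = mulSeq P (n + k + 3) ^ 4 * mulSeq P (n + 1) ^ 4 *
          ((xc ((n + k + 3) • P) - xc ((n + 1) • P)) ^ 2 *
          ((xc P - xc ((2 * n + k + 4) • P)) * (xc P - xc ((k + 2) • P)))) := by rw [f₂]; ring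
      _ = mulSeq P (n + k + 3) ^ 4 * (mulSeq P (n + 1) ^ 2 * (xc P - xc ((n + 1) • P))) ^ 2 *
          ((xc ((n + 2) • P) - xc ((n + k + 3) • P)) *
          (xc (n • P) - xc ((n + k + 3) • P))) := by rw [key]; ring
      _ = mulSeq P (n + k + 3) ^ 2 * mulSeq P (n + 2) ^ 2 *
          (xc ((n + 2) • P) - xc ((n + k + 3) • P)) * (mulSeq P (n + k + 3) ^ 2 * mulSeq P n ^ 2 *
          (xc (n • P) - xc ((n + k + 3) • P))) := by rw [← a₃]; ring
      _ = _ := by rw [← f₁]; ring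

lemma mulSeq_three : mulSeq P 3 = psi₃ s t (xc P) := by
  have h₀ := hP 1 le_rfl
  rw [one_nsmul] at h₀
  have h := mulSeq_step hP 1
  have h₈ := xc_two_nsmul_mul h₀ (hP 2 (by norm_num))
  have h₉ := (nonsingular_of_ne_zero h₀).1
  simp only [mulSeq, mul_one, Nat.reduceAdd] at h
  rw [psi₃]
  have : mulSeq P 3 = (2 * yc P) ^ 2 * (xc P - xc (2 • P)) := by simp [mulSeq]
  rw [this]
  linear_combination 4 * xc P * h₉ - h₈

lemma mulSeq_four : mulSeq P 4 = prePsi₄ s t (xc P) * (2 * yc P) := by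
  have h₀ := hP 1 le_rfl
  rw [one_nsmul] at h₀
  have h := mulSeq_step hP 2
  have h₃ : mulSeq P 3 = (2 * yc P) ^ 2 * (xc P - xc (2 • P)) := by simp [mulSeq]
  have h₈ := xc_two_nsmul_mul h₀ (hP 2 (by norm_num))
  have h₉ := (nonsingular_of_ne_zero h₀).1
  have h₅ := xc_nsmul_ne hP le_rfl (show 1 < 2 by omega)
  rw [one_nsmul] at h₅
  have h₆ := xc_add_add_xc_sub (hP 2 (by omega)) h₀ h₅
  rw [show (2 : ℕ) • P - P = P by rw [two_nsmul]; abel,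
    show (2 : ℕ) • P + P = 3 • P by rw [succ_nsmul _ 2]] at h₆
  refine mul_right_cancel₀ (two_mul_yc_ne_zero hP) ?_
  change mulSeq P 4 * (2 * yc P) = mulSeq P 3 ^ 2 * (xc P - xc (3 • P)) at h
  rw [h, h₃, prePsi₄]
  have e : ((2 * yc P) ^ 2 * (xc P - xc (2 • P))) ^ 2 * (xc P - xc (3 • P)) =
      (4 * yc P ^ 2 * xc P - 4 * yc P ^ 2 * xc (2 • P)) ^ 2 * (2 * xc P) -
      2 * ((4 * yc P ^ 2 * xc (2 • P) * xc P + 4 * yc P ^ 2 * s) *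
        (4 * yc P ^ 2 * xc (2 • P) + 4 * yc P ^ 2 * xc P) + 2 * (4 * yc P ^ 2) ^ 2 * t) := by
    linear_combination (-16 * yc P ^ 4) * h₆
  rw [e, h₈, mul_assoc _ (2 * yc P),
    show 2 * yc P * (2 * yc P) = 4 * yc P ^ 2 by ring, h₉]
  ring

/-- Both sequences obey the same doubling recursions. For `mulSeq` these are the elliptic relation
at index pairs with difference `2` (even index) or `1` (odd index), and the values below index `5`
are compared directly. -/
lemma eds_eq_mulSeq (n : ℕ) : eds s t (xc P) (yc P) n = mulSeq P n := by
  induction n using Nat.strong_induction_on with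
  | _ n ih =>
    rcases lt_or_ge n 5 with h | h
    · interval_cases n
      · simp [mulSeq]
      · simp [mulSeq]
      · simp [mulSeq]
      · rw [mulSeq_three hP]; exact eds_three ..
      · rw [mulSeq_four hP]; exact eds_four ..
    · rcases Nat.even_or_odd' n with ⟨m, rfl | rfl⟩
      · obtain ⟨k, rfl⟩ := Nat.exists_eq_add_of_le (show 3 ≤ m by omega)
        have h := normEDS_even (2 * yc P) (psi₃ s t (xc P)) (prePsi₄ s t (xc P)) (k + 3)
        simp only [← eds.eq_1 s t (xc P) (yc P)] at h
        rw [show ((k : ℤ) + 3 - 1) = (k + 2 : ℕ) by push_cast; ring,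
          show ((k : ℤ) + 3 - 2) = (k + 1 : ℕ) by push_cast; ring,
          show ((k : ℤ) + 3 + 1) = (k + 4 : ℕ) by push_cast; ring,
          show ((k : ℤ) + 3 + 2) = (k + 5 : ℕ) by push_cast; ring,
          show ((k : ℤ) + 3) = (k + 3 : ℕ) by push_cast; ring,
          ih (k + 2) (by omega), ih (k + 1) (by omega), ih (k + 4) (by omega),
          ih (k + 5) (by omega), ih (k + 3) (by omega)] at h
        have f := (mulSeq_mul hP (k + 2) (by omega)).1 (k + 4) (by omega)
        have a₁ := mulSeq_step hP (k + 3)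
        have a₂ := mulSeq_step hP (k + 1)
        rw [show k + 4 + (k + 2) = 2 * (3 + k) by ring, show k + 4 - (k + 2) = 2 by omega] at f
        have e2 : mulSeq P 2 = 2 * yc P := rfl
        refine mul_right_cancel₀ (two_mul_yc_ne_zero hP) ?_
        rw [← e2, f, e2]
        rw [show ((2 * (3 + k) : ℕ) : ℤ) = 2 * ((k + 3 : ℕ) : ℤ) by push_cast; ring, h]
        linear_combination mulSeq P (k + 2) ^ 2 * a₁ - mulSeq P (k + 4) ^ 2 * a₂
      · obtain ⟨k, rfl⟩ := Nat.exists_eq_add_of_le (show 2 ≤ m by omega)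
        have h := normEDS_odd (2 * yc P) (psi₃ s t (xc P)) (prePsi₄ s t (xc P)) (k + 2)
        simp only [← eds.eq_1 s t (xc P) (yc P)] at h
        rw [show ((k : ℤ) + 2 - 1) = (k + 1 : ℕ) by push_cast; ring,
          show ((k : ℤ) + 2 + 1) = (k + 3 : ℕ) by push_cast; ring,
          show ((k : ℤ) + 2 + 2) = (k + 4 : ℕ) by push_cast; ring,
          show ((k : ℤ) + 2) = (k + 2 : ℕ) by push_cast; ring,
          ih (k + 2) (by omega), ih (k + 1) (by omega), ih (k + 4) (by omega),
          ih (k + 3) (by omega)] at h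
        have f := (mulSeq_mul hP (k + 2) (by omega)).1 (k + 3) (by omega)
        have a₁ := mulSeq_step hP (k + 2)
        have a₂ := mulSeq_step hP (k + 1)
        rw [show k + 3 + (k + 2) = 2 * (2 + k) + 1 by ring, show k + 3 - (k + 2) = 1 by omega,
          show mulSeq P 1 = 1 from rfl, mul_one] at f
        rw [f, show ((2 * (2 + k) + 1 : ℕ) : ℤ) = 2 * ((k + 2 : ℕ) : ℤ) + 1 by push_cast; ring, h]
        linear_combination mulSeq P (k + 2) ^ 2 * a₁ - mulSeq P (k + 3) ^ 2 * a₂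

lemma phi_eq_xc_mul {n : ℕ} (hn : 1 ≤ n) :
    phi s t (xc P) (yc P) n = xc (n • P) * eds s t (xc P) (yc P) n ^ 2 := by
  obtain ⟨k, rfl⟩ := Nat.exists_eq_add_of_le hn
  have := mulSeq_step hP k
  rw [phi, show ((1 + k : ℕ) : ℤ) + 1 = (k + 2 : ℕ) by push_cast; ring,
    show ((1 + k : ℕ) : ℤ) - 1 = k by push_cast; ring, eds_eq_mulSeq hP, eds_eq_mulSeq hP,
    eds_eq_mulSeq hP, add_comm 1 k]
  linear_combination -this

lemma eds_add_mul_eds_sub_of_infinite {m n : ℕ} (hn : 1 ≤ n) (hm : n < m) :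
    eds s t (xc P) (yc P) (m + n) * eds s t (xc P) (yc P) (m - n) =
      phi s t (xc P) (yc P) n * eds s t (xc P) (yc P) m ^ 2 -
      phi s t (xc P) (yc P) m * eds s t (xc P) (yc P) n ^ 2 := by
  rw [phi_eq_xc_mul hP hn, phi_eq_xc_mul hP (by omega),
    show (m : ℤ) + n = (m + n : ℕ) by push_cast; ring,
    show (m : ℤ) - n = (m - n : ℕ) by omega]
  simp only [eds_eq_mulSeq hP]
  rw [(mulSeq_mul hP n hn).1 m hm]
  ring

lemma phi_step_of_infinite {n : ℕ} (hn : 2 ≤ n) :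
    phi s t (xc P) (yc P) (n + 1) * eds s t (xc P) (yc P) (n - 1) ^ 2 +
      phi s t (xc P) (yc P) (n - 1) * eds s t (xc P) (yc P) (n + 1) ^ 2 =
      2 * ((phi s t (xc P) (yc P) n * xc P + s * eds s t (xc P) (yc P) n ^ 2) *
        (phi s t (xc P) (yc P) n + xc P * eds s t (xc P) (yc P) n ^ 2) +
        2 * t * eds s t (xc P) (yc P) n ^ 4) := by
  obtain ⟨k, rfl⟩ := Nat.exists_eq_add_of_le hn
  rw [show ((2 + k : ℕ) : ℤ) + 1 = (k + 3 : ℕ) by push_cast; ring,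
    show ((2 + k : ℕ) : ℤ) - 1 = (k + 1 : ℕ) by push_cast; ring, add_comm 2 k,
    phi_eq_xc_mul hP (by omega), phi_eq_xc_mul hP (by omega), phi_eq_xc_mul hP (by omega)]
  simp only [eds_eq_mulSeq hP]
  have a := mulSeq_step hP (k + 1)
  have h₀ := hP 1 le_rfl
  rw [one_nsmul] at h₀
  have h₅ := xc_nsmul_ne hP le_rfl (show 1 < k + 2 by omega)
  rw [one_nsmul] at h₅
  have h₆ := xc_add_add_xc_sub (hP (k + 2) (by omega)) h₀ h₅
  rw [show (k + 2) • P - P = (k + 1) • P by rw [succ_nsmul]; abel,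
    show (k + 2) • P + P = (k + 3) • P by rw [succ_nsmul _ (k + 2)]] at h₆
  calc _ = (mulSeq P (k + 3) * mulSeq P (k + 1)) ^ 2 *
        (xc ((k + 3) • P) + xc ((k + 1) • P)) := by ring
    _ = mulSeq P (k + 2) ^ 4 * ((xc ((k + 2) • P) - xc P) ^ 2 *
        (xc ((k + 3) • P) + xc ((k + 1) • P))) := by rw [a]; ring
    _ = _ := by rw [h₆]; ring

/-- The `y`-coordinate of a multiple of a point of infinite order. -/
lemma yc_nsmul_mul {n : ℕ} (hn : 1 ≤ n) :
    2 * yc (n • P) * eds s t (xc P) (yc P) n ^ 4 = eds s t (xc P) (yc P) (2 * n) := by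
  have h₀ := hP 1 le_rfl
  rw [one_nsmul] at h₀
  rcases hn.eq_or_lt with rfl | hn
  · simp
  obtain ⟨k, rfl⟩ := Nat.exists_eq_add_of_lt hn
  rw [show (2 : ℤ) * (1 + k + 1 : ℕ) = (2 * k + 4 : ℕ) by push_cast; ring,
    show 1 + k + 1 = k + 2 by ring, eds_eq_mulSeq hP, eds_eq_mulSeq hP]
  refine mul_left_cancel₀ (two_mul_yc_ne_zero hP) ?_
  have a := mulSeq_step hP (k + 1)
  have f := (mulSeq_mul hP (k + 1) (by omega)).1 (k + 3) (by omega)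
  rw [show k + 3 + (k + 1) = 2 * k + 4 by ring, show k + 3 - (k + 1) = 2 by omega,
    show mulSeq P 2 = 2 * yc P from rfl] at f
  have h₅ := xc_nsmul_ne hP le_rfl (show 1 < k + 2 by omega)
  rw [one_nsmul] at h₅
  have h₆ := xc_sub_sub_xc_add (hP (k + 2) (by omega)) h₀ h₅
  rw [show (k + 2) • P - P = (k + 1) • P by rw [succ_nsmul]; abel,
    show (k + 2) • P + P = (k + 3) • P by rw [succ_nsmul _ (k + 2)]] at h₆
  calc _ = mulSeq P (k + 2) ^ 4 * (4 * yc ((k + 2) • P) * yc P) := by ring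
    _ = (mulSeq P (k + 3) * mulSeq P (k + 1)) ^ 2 *
      (xc ((k + 1) • P) - xc ((k + 3) • P)) := by rw [← h₆, a]; ring
    _ = 2 * yc P * mulSeq P (2 * k + 4) := by rw [mul_comm (2 * yc P), f]; ring

end InfiniteOrder

end shortCurve

/-! ### The invariant derivation and its effect on multiples of a point -/

namespace shortCurve

section Derivation

variable {F : Type*} [Field F] {s t : F}

/-- The vector field `x' = 2y`, `y' = 3x^2 + s` is translation invariant: if two points move along
it with speeds `c₁` and `c₂`, their sum moves with speed `c₁ + c₂`. The equation for `s` is the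
difference of the two curve equations divided by `d`. It lets everything be expressed by independent
quantities, so that only a rational identity remains. -/
lemma deriv_chord {x₁ y₁ l d c₁ c₂ l' x₂ y₂ x₃ y₃ x₃' : F} (hd : d ≠ 0)
    (hx₂ : x₂ = x₁ - d) (hy₂ : y₂ = y₁ - l * d)
    (hs : s = l * (2 * y₁ - l * d) - 3 * x₁ ^ 2 + 3 * x₁ * d - d ^ 2)
    (hx₃ : x₃ = l ^ 2 - x₁ - x₂) (hy₃ : y₃ = l * (x₁ - x₃) - y₁)
    (hl' : l' * d + l * (2 * c₁ * y₁ - 2 * c₂ * y₂) =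
      c₁ * (3 * x₁ ^ 2 + s) - c₂ * (3 * x₂ ^ 2 + s))
    (hx₃' : x₃' = 2 * l * l' - 2 * c₁ * y₁ - 2 * c₂ * y₂) :
    x₃' = 2 * (c₁ + c₂) * y₃ ∧
    l' * (x₁ - x₃) + l * (2 * c₁ * y₁ - x₃') - c₁ * (3 * x₁ ^ 2 + s) =
      (c₁ + c₂) * (3 * x₃ ^ 2 + s) := by
  have hl : l' = (c₁ * (3 * x₁ ^ 2 + s) - c₂ * (3 * x₂ ^ 2 + s) -
      l * (2 * c₁ * y₁ - 2 * c₂ * y₂)) / d := by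
    rw [eq_div_iff hd]; linear_combination hl'
  subst hx₃' hl hy₃ hx₃ hs hy₂ hx₂
  constructor
  · field_simp
    ring
  · field_simp
    ring

variable [DecidableEq F] [CharZero F]

/-- This is the dual form of `[n]^* ω = n ω` for the invariant differential. The same induction
yields infinite order: if `(n + 1) • P = 0`, then `n • P = -P`, and comparing derivatives gives `n =
-1`, impossible in characteristic zero. -/
lemma deriv_nsmul (D : Derivation ℤ F F) (hDs : D s = 0) {P : (shortCurve s t).toAffine.Point}
    (hP : P ≠ 0) (hy : yc P ≠ 0) (hDx : D (xc P) = 2 * yc P)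
    (hDy : D (yc P) = 3 * xc P ^ 2 + s) {n : ℕ} (hn : 1 ≤ n) :
    n • P ≠ 0 ∧ D (xc (n • P)) = 2 * n * yc (n • P) ∧
      D (yc (n • P)) = n * (3 * xc (n • P) ^ 2 + s) := by
  have hy' : yc P ≠ -yc P := fun e ↦
    hy (mul_left_cancel₀ (two_ne_zero (α := F)) (by linear_combination e))
  have hD2 : D 2 = 0 := by exact_mod_cast D.map_natCast 2
  have hD3 : D 3 = 0 := by exact_mod_cast D.map_natCast 3
  induction n, hn using Nat.le_induction with
  | base => simp [hP, hDx, hDy]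
  | succ n hn ih =>
    obtain ⟨h₁, h₂, h₃⟩ := ih
    rcases hn.eq_or_lt with rfl | hn
    · have h2 : (2 : ℕ) • P ≠ 0 := mt two_nsmul_eq_zero_iff.mp hy'
      obtain ⟨e₁, e₂⟩ := xc_two_nsmul hP hy'
      set l := (3 * xc P ^ 2 + s) / (2 * yc P) with hl
      have hl₁ : l * (2 * yc P) = 3 * xc P ^ 2 + s := by
        rw [hl]; field_simp
      clear_value l
      have hl₂ := congrArg D hl₁
      simp only [Derivation.leibniz, map_add, smul_eq_mul, hDy, hDx, hDs,
        Derivation.leibniz_pow, hD2, hD3] at hl₂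
      have hl₃ : D l = 6 * xc P - 2 * l ^ 2 := by
        refine mul_left_cancel₀ (mul_ne_zero two_ne_zero hy) ?_
        rw [← hl₁] at hl₂
        simp at hl₂
        linear_combination hl₂
      have hDx₂ : D (xc (2 • P)) = 4 * yc (2 • P) := by
        rw [e₂, e₁]
        simp only [Derivation.leibniz, map_sub, smul_eq_mul, hDx,
          Derivation.leibniz_pow, hl₃, hD2]
        simp
        ring
      refine ⟨h2, ?_, ?_⟩
      · norm_num [hDx₂]
      · conv_lhs => rw [e₂]
        simp only [Derivation.leibniz, map_sub, smul_eq_mul, hDx, hDy, hl₃, hDx₂, e₂]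
        simp only [Nat.reduceAdd, Nat.cast_ofNat]
        rw [e₁]
        linear_combination 3 * hl₁
    -- Equal abscissas mean `n • P = ±P`, and then `D` gives `n = ±1`.
    · have hne : xc (n • P) ≠ xc P := by
        intro e
        have h2 : (2 * yc P) ≠ 0 := mul_ne_zero two_ne_zero hy
        rcases eq_or_eq_neg_of_xc_eq h₁ hP e with h | h
        · rw [h, hDx] at h₂
          have : (n : F) = 1 := mul_left_cancel₀ h2 (by linear_combination -h₂)
          have : n = 1 := by exact_mod_cast this
          omega
        · rw [h, xc_neg, yc_neg, hDx] at h₂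
          have : ((n + 1 : ℕ) : F) = 0 := by
            push_cast
            exact mul_left_cancel₀ h2 (by linear_combination h₂)
          have : n + 1 = 0 := by exact_mod_cast this
          omega
      obtain ⟨e₁, e₂⟩ := xc_add h₁ hP hne
      rw [← succ_nsmul] at e₁ e₂
      set l := (yc (n • P) - yc P) / (xc (n • P) - xc P) with hl
      have hd := sub_ne_zero.mpr hne
      have hl₁ : l * (xc (n • P) - xc P) = yc (n • P) - yc P := by rw [hl]; field_simp
      have hl₂ := congrArg D hl₁
      simp only [Derivation.leibniz, map_sub, smul_eq_mul, hDy, hDx, h₂, h₃] at hl₂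
      have f₁ := (nonsingular_of_ne_zero h₁).1
      have f₂ := (nonsingular_of_ne_zero hP).1
      have key := deriv_chord (s := s) (x₁ := xc (n • P)) (y₁ := yc (n • P)) (l := l)
        (d := xc (n • P) - xc P) (c₁ := n) (c₂ := 1) (l' := D l) (x₂ := xc P) (y₂ := yc P)
        (x₃ := xc ((n + 1) • P)) (y₃ := yc ((n + 1) • P)) (x₃' := D (xc ((n + 1) • P))) hd
        (by ring) (by linear_combination hl₁)
        (by
          refine mul_left_cancel₀ hd ?_
          have : yc P = yc (n • P) - l * (xc (n • P) - xc P) := by linear_combination hl₁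
          rw [this] at f₂
          linear_combination f₂ - f₁) e₁ e₂ (by linear_combination hl₂)
        (by
          rw [e₁]
          simp only [Derivation.leibniz_pow, map_sub, smul_eq_mul, hDx, h₂]
          simp
          ring)
      refine ⟨?_, ?_, ?_⟩
      · rw [succ_nsmul]; exact add_ne_zero_of_xc_ne hne
      · rw [key.1]; push_cast; ring
      · push_cast
        rw [← key.2]
        conv_lhs => rw [e₂]
        simp only [Derivation.leibniz, map_sub, smul_eq_mul, h₂, h₃]
        ring

end Derivation

end shortCurve

/-! ### Derivations of a field of rational functions -/

section FractionRing

open TrivSqZeroExt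

variable {σ L : Type*} [Field L] [Algebra (MvPolynomial σ ℤ) L]
  [IsFractionRing (MvPolynomial σ ℤ) L]

/-- The derivation of the field of rational functions with prescribed values on the variables. -/
lemma exists_derivation_fractionRing_mvPolynomial (v : σ → L) :
    ∃ D : Derivation ℤ L L, ∀ i, D (algebraMap (MvPolynomial σ ℤ) L (MvPolynomial.X i)) = v i := by
  set A := MvPolynomial σ ℤ
  -- A derivation is the same as a ring homomorphism to the dual numbers lifting the identity. Such
  -- a homomorphism extends to the fraction field, because units of the dual numbers are detected on
  -- the first component.
  let g : A →+* TrivSqZeroExt L L := MvPolynomial.eval₂Hom (Int.castRingHom _)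
    fun i ↦ inl (algebraMap A L (MvPolynomial.X i)) + inr (v i)
  have hg : ∀ a, (g a).fst = algebraMap A L a := by
    intro a
    have : (fstHom L L L).toRingHom.comp g = algebraMap A L := by
      refine MvPolynomial.ringHom_ext (fun r ↦ ?_) fun i ↦ ?_
      · simp [g]
      · simp [g]
    exact DFunLike.congr_fun this a
  have hu : ∀ a : nonZeroDivisors A, IsUnit (g a) := fun a ↦ by
    rw [isUnit_iff_isUnit_fst, hg]
    exact IsLocalization.map_units L a
  let h : L →+* TrivSqZeroExt L L := IsLocalization.lift hu
  have hh : ∀ z, (h z).fst = z := by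
    intro z
    have : (fstHom L L L).toRingHom.comp h = RingHom.id L := by
      refine IsLocalization.ringHom_ext (nonZeroDivisors A) (RingHom.ext fun a ↦ ?_)
      simp [h, hg]
    exact DFunLike.congr_fun this z
  let D₀ : L →+ L :=
    { toFun := fun z ↦ (h z).snd
      map_zero' := by simp
      map_add' := by simp }
  refine ⟨Derivation.mk' D₀.toIntLinearMap fun a b ↦ ?_, fun i ↦ ?_⟩
  · change (h (a * b)).snd = a • (h b).snd + b • (h a).snd
    rw [map_mul, snd_mul, hh, hh]
    simp [mul_comm]
  · change (h (algebraMap A L (MvPolynomial.X i))).snd = v i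
    simp only [h, g, IsLocalization.lift_eq]
    rw [MvPolynomial.coe_eval₂Hom, MvPolynomial.eval₂_X]
    simp

end FractionRing

/-! ### The universal point and identities valid over every ring -/

namespace shortCurve

section Generic

variable (L : Type*) [Field L] [DecidableEq L] [Algebra (MvPolynomial (Fin 3) ℤ) L]
  [IsFractionRing (MvPolynomial (Fin 3) ℤ) L]

/-- The coordinate `x` of the universal point. -/
noncomputable def genX : MvPolynomial (Fin 3) ℤ := MvPolynomial.X 0
/-- The coordinate `y` of the universal point. -/
noncomputable def genY : MvPolynomial (Fin 3) ℤ := MvPolynomial.X 1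
/-- The coefficient `s` of the universal pointed curve. -/
noncomputable def genS : MvPolynomial (Fin 3) ℤ := MvPolynomial.X 2
/-- The coefficient `t` of the universal pointed curve. -/
noncomputable def genT : MvPolynomial (Fin 3) ℤ := genY ^ 2 - genX ^ 3 - genS * genX

/-- The universal pointed curve has `x, y, s` as free parameters and `t` determined by them. It
carries the invariant derivation, which forces the universal point to have infinite order. -/
lemma exists_generic_point :
    ∃ (P : (shortCurve (algebraMap _ L genS) (algebraMap _ L genT)).toAffine.Point)
      (D : Derivation ℤ L L), xc P = algebraMap _ L genX ∧ yc P = algebraMap _ L genY ∧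
      D (algebraMap _ L genX) = 2 * algebraMap _ L genY ∧ D (algebraMap _ L genS) = 0 ∧
      D (algebraMap _ L genT) = 0 ∧
      ∀ n : ℕ, 1 ≤ n → n • P ≠ 0 ∧ D (xc (n • P)) = 2 * n * yc (n • P) := by
  have hinj : Function.Injective (algebraMap (MvPolynomial (Fin 3) ℤ) L) :=
    IsFractionRing.injective _ _
  have : CharZero L := charZero_of_injective_algebraMap hinj
  set x := algebraMap _ L genX with hx
  set y := algebraMap _ L genY with hy
  set s := algebraMap _ L genS with hs
  have hy0 : y ≠ 0 := by
    rw [hy, Ne, map_eq_zero_iff _ hinj]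
    exact MvPolynomial.X_ne_zero _
  have ht : algebraMap _ L genT = y ^ 2 - x ^ 3 - s * x := by simp [genT, hx, hy, hs]
  have hns : (shortCurve s (algebraMap _ L genT)).toAffine.Nonsingular x y := by
    rw [nonsingular_iff]
    refine ⟨by rw [ht]; ring, Or.inr fun e ↦ hy0 ?_⟩
    exact mul_left_cancel₀ (two_ne_zero (α := L)) (by linear_combination e)
  -- With these values on `x, y, s`, the derivation also kills `t = y^2 - x^3 - s x`.
  obtain ⟨D, hD⟩ := exists_derivation_fractionRing_mvPolynomial (L := L)
    ![2 * y, 3 * x ^ 2 + s, 0]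
  have hDx : D x = 2 * y := hD 0
  have hDy : D y = 3 * x ^ 2 + s := hD 1
  have hDs : D s = 0 := hD 2
  refine ⟨.some x y hns, D, rfl, rfl, hDx, hDs, ?_, fun n hn ↦ ?_⟩
  · rw [ht]
    simp only [Derivation.leibniz, map_sub, smul_eq_mul, hDx, hDy, hDs, Derivation.leibniz_pow]
    simp
    ring
  · have := deriv_nsmul D hDs (P := .some x y hns)
      (WeierstrassCurve.Affine.Point.some_ne_zero _) hy0 hDx hDy hn
    exact ⟨this.1, this.2.1⟩

/-- The specialization of the universal point. -/
lemma exists_specialization {R : Type*} [CommRing R] {s t x y : R}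
    (h : y ^ 2 = x ^ 3 + s * x + t) : ∃ f : MvPolynomial (Fin 3) ℤ →+* R,
      f genX = x ∧ f genY = y ∧ f genS = s ∧ f genT = t := by
  refine ⟨MvPolynomial.eval₂Hom (Int.castRingHom R) ![x, y, s], ?_⟩
  refine ⟨by simp [genX], by simp [genY], by simp [genS], ?_⟩
  simp only [genT, genX, genY, genS, map_sub, map_mul, map_pow, MvPolynomial.coe_eval₂Hom,
    MvPolynomial.eval₂_X]
  simp only [Matrix.cons_val]
  linear_combination h

/-- The identity is polynomial, so it may be checked in the fraction field, where the universal
point has infinite order and no denominator vanishes. Specialization then carries it to every ring.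
-/
lemma eds_add_mul_eds_sub_gen {m n : ℕ} (hn : 1 ≤ n) (hm : n < m) :
    eds genS genT genX genY (m + n) * eds genS genT genX genY (m - n) =
      phi genS genT genX genY n * eds genS genT genX genY m ^ 2 -
      phi genS genT genX genY m * eds genS genT genX genY n ^ 2 := by
  classical
  obtain ⟨P, D, hx, hy, -, -, -, hinf⟩ :=
    exists_generic_point (FractionRing (MvPolynomial (Fin 3) ℤ))
  apply IsFractionRing.injective (MvPolynomial (Fin 3) ℤ) (FractionRing (MvPolynomial (Fin 3) ℤ))
  simp only [map_mul, map_sub, map_pow, map_eds, map_phi, ← hx, ← hy]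
  exact eds_add_mul_eds_sub_of_infinite (fun n hn ↦ (hinf n hn).1) hn hm

lemma phi_step_gen {n : ℕ} (hn : 2 ≤ n) :
    phi genS genT genX genY (n + 1) * eds genS genT genX genY (n - 1) ^ 2 +
      phi genS genT genX genY (n - 1) * eds genS genT genX genY (n + 1) ^ 2 =
      2 * ((phi genS genT genX genY n * genX + genS * eds genS genT genX genY n ^ 2) *
        (phi genS genT genX genY n + genX * eds genS genT genX genY n ^ 2) +
        2 * genT * eds genS genT genX genY n ^ 4) := by
  classical
  obtain ⟨P, D, hx, hy, -, -, -, hinf⟩ :=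
    exists_generic_point (FractionRing (MvPolynomial (Fin 3) ℤ))
  apply IsFractionRing.injective (MvPolynomial (Fin 3) ℤ) (FractionRing (MvPolynomial (Fin 3) ℤ))
  simp only [map_mul, map_add, map_pow, map_eds, map_phi, ← hx, ← hy, map_ofNat]
  exact phi_step_of_infinite (fun n hn ↦ (hinf n hn).1) hn

end Generic

section CommRing

variable {R : Type*} [CommRing R] {s t x y : R}

/-- The elliptic relation for the values of division polynomials. -/
lemma eds_add_mul_eds_sub (h : y ^ 2 = x ^ 3 + s * x + t) {m n : ℕ} (hn : 1 ≤ n) (hm : n ≤ m) :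
    eds s t x y (m + n) * eds s t x y (m - n) =
      phi s t x y n * eds s t x y m ^ 2 - phi s t x y m * eds s t x y n ^ 2 := by
  rcases hm.eq_or_lt with rfl | hm
  · simp
  obtain ⟨f, rfl, rfl, rfl, rfl⟩ := exists_specialization h
  simpa only [map_mul, map_sub, map_pow, map_eds, map_phi] using
    congrArg f (eds_add_mul_eds_sub_gen hn hm)

lemma phi_step (h : y ^ 2 = x ^ 3 + s * x + t) {n : ℕ} (hn : 2 ≤ n) :
    phi s t x y (n + 1) * eds s t x y (n - 1) ^ 2 +
      phi s t x y (n - 1) * eds s t x y (n + 1) ^ 2 =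
      2 * ((phi s t x y n * x + s * eds s t x y n ^ 2) *
        (phi s t x y n + x * eds s t x y n ^ 2) + 2 * t * eds s t x y n ^ 4) := by
  obtain ⟨f, rfl, rfl, rfl, rfl⟩ := exists_specialization h
  simpa only [map_mul, map_add, map_pow, map_eds, map_phi, map_ofNat] using
    congrArg f (phi_step_gen hn)

open Polynomial WeierstrassCurve

lemma eval_Ψ₂Sq (h : y ^ 2 = x ^ 3 + s * x + t) : (shortCurve s t).Ψ₂Sq.eval x = (2 * y) ^ 2 := by
  simp [Ψ₂Sq, b₂, b₄, b₆, mul_pow, h]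
  ring

lemma eval_Ψ₃ : (shortCurve s t).Ψ₃.eval x = psi₃ s t x := by
  simp [Ψ₃, b₂, b₄, b₆, b₈, psi₃]
  ring

lemma eval_preΨ₄ : (shortCurve s t).preΨ₄.eval x = prePsi₄ s t x := by
  simp [preΨ₄, b₂, b₄, b₆, b₈, prePsi₄]
  ring

lemma eds_eq (h : y ^ 2 = x ^ 3 + s * x + t) (n : ℤ) :
    eds s t x y n = ((shortCurve s t).preΨ n).eval x * if Even n then 2 * y else 1 := by
  rw [eds, normEDS, preΨ, ← coe_evalRingHom, map_preNormEDS, map_pow]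
  simp only [coe_evalRingHom, eval_Ψ₂Sq h, eval_Ψ₃, eval_preΨ₄]
  rw [← pow_mul]

lemma eval_ΨSq (h : y ^ 2 = x ^ 3 + s * x + t) (n : ℤ) :
    ((shortCurve s t).ΨSq n).eval x = eds s t x y n ^ 2 := by
  rw [eds_eq h, ΨSq]
  split_ifs
  · simp [eval_Ψ₂Sq h, mul_pow]
  · simp

lemma eval_Φ (h : y ^ 2 = x ^ 3 + s * x + t) (n : ℤ) :
    ((shortCurve s t).Φ n).eval x = phi s t x y n := by
  rw [phi, ← eval_ΨSq h, eds_eq h, eds_eq h, WeierstrassCurve.Φ]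
  by_cases hn : Even n
  · simp [hn, Int.not_odd_iff_even.mpr hn]
  · simp [hn, Int.not_even_iff_odd.mp hn, eval_Ψ₂Sq h]
    ring

end CommRing

section Universal

open Polynomial WeierstrassCurve

/-- The specialization of the coordinate `x` to the generic point is injective. -/
lemma exists_injective_eval : ∃ θ : MvPolynomial (Fin 2) ℤ →+* MvPolynomial (Fin 3) ℤ,
    θ (MvPolynomial.X 0) = genS ∧ θ (MvPolynomial.X 1) = genT ∧
    Function.Injective (eval₂RingHom θ genX) := by
  let θ : MvPolynomial (Fin 2) ℤ →+* MvPolynomial (Fin 3) ℤ :=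
    MvPolynomial.eval₂Hom (Int.castRingHom _) ![genS, genT]
  refine ⟨θ, by simp [θ], by simp [θ], ?_⟩
  let R₀ := (MvPolynomial (Fin 2) ℤ)[X]
  let Ω := AlgebraicClosure (FractionRing R₀)
  let ι : R₀ →+* Ω := (algebraMap (FractionRing R₀) Ω).comp (algebraMap R₀ (FractionRing R₀))
  have hι : Function.Injective ι :=
    (algebraMap (FractionRing R₀) Ω).injective.comp (IsFractionRing.injective R₀ _)
  -- Over an algebraic closure of the fraction field of `ℤ[s, t][X]` the point with abscissa `X`
  -- exists. Evaluating the universal point there recovers the inclusion of `ℤ[s, t][X]`, whence the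
  -- injectivity.
  obtain ⟨y, hy⟩ := IsAlgClosed.exists_pow_nat_eq
    (ι (X ^ 3 + C (MvPolynomial.X 0) * X + C (MvPolynomial.X 1))) (show 0 < 2 by norm_num)
  let κ : MvPolynomial (Fin 3) ℤ →+* Ω :=
    MvPolynomial.eval₂Hom (Int.castRingHom _) ![ι X, y, ι (C (MvPolynomial.X 0))]
  have hκ : κ.comp (eval₂RingHom θ genX) = ι := by
    refine Polynomial.ringHom_ext' ?_ ?_
    · refine MvPolynomial.ringHom_ext (fun r ↦ by simp) fun i ↦ ?_
      fin_cases i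
      · simp [θ, κ, genS]
      · simp [θ, κ, genT, genX, genY, genS, hy]
        ring
    · simp [κ, genX]
  exact Function.Injective.of_comp (f := κ) (by rw [← RingHom.coe_comp, hκ]; exact hι)

/-- Both identities express facts about `n • P` for the universal point. The first is `D (x(nP)) =
2n y(nP)` for the invariant derivation, written with `x(nP) = Φ / ΨSq`. The second says that `n • P`
lies on the curve. The factor `n` in the first is what vanishes in characteristic `p`. -/
lemma exists_generic_identities {n : ℕ} (hn : 1 ≤ n) (hodd : Odd n) :
    let W := shortCurve (MvPolynomial.X 0 : MvPolynomial (Fin 2) ℤ) (MvPolynomial.X 1)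
    derivative (W.Φ n) * W.ΨSq n - W.Φ n * derivative (W.ΨSq n) =
      (n : (MvPolynomial (Fin 2) ℤ)[X]) * W.preΨ (2 * n) ∧
    (X ^ 3 + C W.a₄ * X + C W.a₆) * W.preΨ (2 * n) ^ 2 =
      W.ΨSq n * (W.Φ n ^ 3 + C W.a₄ * W.Φ n * W.ΨSq n ^ 2 + C W.a₆ * W.ΨSq n ^ 3) := by
  classical
  intro W
  obtain ⟨L, _, _, _⟩ : ∃ (L : Type) (_ : Field L) (_ : Algebra (MvPolynomial (Fin 3) ℤ) L),
      IsFractionRing (MvPolynomial (Fin 3) ℤ) L :=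
    ⟨FractionRing (MvPolynomial (Fin 3) ℤ), inferInstance, inferInstance, inferInstance⟩
  have hinj := IsFractionRing.injective (MvPolynomial (Fin 3) ℤ) L
  have : CharZero L := charZero_of_injective_algebraMap hinj
  obtain ⟨P, D, hx, hy, hDx, hDs, hDt, h⟩ := exists_generic_point L
  obtain ⟨θ₀, hs, ht, hθ₀⟩ := exists_injective_eval
  let θ : (MvPolynomial (Fin 2) ℤ)[X] →+* L :=
    (algebraMap _ L).comp (eval₂RingHom θ₀ genX)
  have hθ : Function.Injective θ := hinj.comp hθ₀
  have h₀ := (h 1 le_rfl).1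
  rw [one_nsmul] at h₀
  have hinf : ∀ n : ℕ, 1 ≤ n → n • P ≠ 0 := fun n hn ↦ (h n hn).1
  have hW : W.map ((algebraMap _ L).comp θ₀) =
      shortCurve (algebraMap _ L genS) (algebraMap _ L genT) := by
    rw [map_eq]; simp [hs, ht]
  have heval : ∀ g, θ g = (g.map ((algebraMap _ L).comp θ₀)).eval (xc P) := by
    intro g
    rw [eval_map, hx]
    simp [θ, hom_eval₂]
  have hcurve := (nonsingular_of_ne_zero h₀).1
  have hΦ : θ (W.Φ n) = phi (algebraMap _ L genS) (algebraMap _ L genT) (xc P) (yc P) n := by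
    rw [heval, ← map_Φ, hW, eval_Φ hcurve]
  have hΨ : θ (W.preΨ n) = eds (algebraMap _ L genS) (algebraMap _ L genT) (xc P) (yc P) n := by
    rw [heval, ← map_preΨ, hW, eds_eq hcurve, if_neg (by simpa using hodd), mul_one]
  have hΨ₂ : θ (W.preΨ (2 * n)) * (2 * yc P) =
      eds (algebraMap _ L genS) (algebraMap _ L genT) (xc P) (yc P) (2 * n) := by
    rw [heval, ← map_preΨ, hW, eds_eq hcurve, if_pos (by simp)]
  have hSq : W.ΨSq n = W.preΨ n ^ 2 := by
    rw [ΨSq, if_neg (by simpa using hodd), mul_one]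
  have hXY : yc P ≠ 0 := right_ne_zero_of_mul (two_mul_yc_ne_zero hinf)
  -- Since `D` kills `s` and `t` and sends `x` to `2y`, it acts on polynomials in `x` as `2y ·
  -- d/dx`.
  have hDθ : ∀ g, D (θ g) = θ (derivative g) * (2 * yc P) := by
    have hC : ∀ a, D (θ (C a)) = 0 := by
      intro a
      induction a using MvPolynomial.induction_on with
      | C a => simp
      | add p q hp hq => simp [hp, hq]
      | mul_X p i hp =>
        rw [C_mul, map_mul, Derivation.leibniz, hp]
        have : D (θ (C (MvPolynomial.X i))) = 0 := by
          fin_cases i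
          · simp [θ, hs, hDs]
          · simp [θ, ht, hDt]
        simp [this]
    have hX : D (θ X) = 2 * yc P := by
      simp [θ, hDx, hy]
    intro g
    induction g using Polynomial.induction_on' with
    | add p q hp hq => simp [hp, hq, add_mul]
    | monomial k a =>
      rw [← C_mul_X_pow_eq_monomial, map_mul, Derivation.leibniz, hC, map_pow,
        Derivation.leibniz_pow, hX, derivative_C_mul_X_pow, map_mul, map_mul, map_mul, map_pow]
      simp
      ring
  have hφ := phi_eq_xc_mul hinf hn
  have hY := yc_nsmul_mul hinf hn
  rw [← hΦ, ← hΨ] at hφ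
  rw [← hΨ, ← hΨ₂] at hY
  have hDn := (h n hn).2
  have hcn := (nonsingular_of_ne_zero (hinf n hn)).1
  have hY' : yc (n • P) * θ (W.preΨ n) ^ 4 = θ (W.preΨ (2 * n)) * yc P :=
    mul_left_cancel₀ (two_ne_zero (α := L)) (by linear_combination hY)
  constructor
  · apply hθ
    refine mul_right_cancel₀ (two_mul_yc_ne_zero hinf) ?_
    have h₁ := hDθ (W.Φ n)
    have h₂ := hDθ (W.preΨ n)
    rw [hφ, Derivation.leibniz, Derivation.leibniz_pow, hDn, h₂] at h₁
    simp only [smul_eq_mul, nsmul_eq_mul, Nat.cast_ofNat, Nat.add_one_sub_one, pow_one] at h₁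
    rw [hSq, pow_two, derivative_mul]
    simp only [map_sub, map_mul, map_add, map_natCast]
    rw [hφ]
    linear_combination -θ (W.preΨ n) ^ 2 * h₁ + 2 * n * hY'
  · apply hθ
    rw [hSq]
    have e : θ (X ^ 3 + C W.a₄ * X + C W.a₆) = yc P ^ 2 := by
      rw [hcurve, heval]
      simp [W, hs, ht]
    have e₄ : θ (C W.a₄) = algebraMap _ L genS := by simp [θ, W, hs]
    have e₆ : θ (C W.a₆) = algebraMap _ L genT := by simp [θ, W, ht]
    simp only [map_mul (f := θ), map_add (f := θ) (W.Φ n ^ 3 + _), map_add (f := θ) (W.Φ n ^ 3),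
      map_pow (f := θ), e, e₄, e₆]
    rw [hφ]
    calc _ = (θ (W.preΨ (2 * n)) * yc P) ^ 2 := by ring
      _ = yc (n • P) ^ 2 * θ (W.preΨ n) ^ 8 := by rw [← hY']; ring
      _ = _ := by rw [hcn]; ring

end Universal

end shortCurve

/-! ### Division polynomials and multiples of an arbitrary point -/

namespace shortCurve

section Multiples

variable {F : Type*} [Field F] [DecidableEq F] {s t : F}

/-- The division polynomials describe the multiple `n • P` of the affine point `P`. -/
def DescribesMul (P : (shortCurve s t).toAffine.Point) (n : ℕ) : Prop :=
  (n • P = 0 ∧ eds s t (xc P) (yc P) n = 0 ∧ phi s t (xc P) (yc P) n ≠ 0) ∨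
  (n • P ≠ 0 ∧ eds s t (xc P) (yc P) n ≠ 0 ∧
    xc (n • P) * eds s t (xc P) (yc P) n ^ 2 = phi s t (xc P) (yc P) n)

variable {P : (shortCurve s t).toAffine.Point}

lemma describesMul_one (hP : P ≠ 0) : DescribesMul P 1 :=
  Or.inr ⟨by simpa using hP, by simp, by simp [phi]⟩

lemma describesMul_two (h2 : (2 : F) ≠ 0) (hP : P ≠ 0) : DescribesMul P 2 := by
  obtain ⟨hc, hns⟩ := nonsingular_of_ne_zero hP
  have h4 : (4 : F) ≠ 0 := by
    rw [show (4 : F) = 2 * 2 by norm_num]; exact mul_ne_zero h2 h2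
  by_cases hy : yc P = -yc P
  · have hy0 : yc P = 0 := mul_left_cancel₀ h2 (by linear_combination hy)
    refine Or.inl ⟨two_nsmul_eq_zero_iff.mpr hy, by simp [hy0], ?_⟩
    have h3 : 3 * xc P ^ 2 + s ≠ 0 := hns.resolve_right (by simp [hy0])
    rw [hy0] at hc
    have : phi s t (xc P) (yc P) (2 : ℕ) = (3 * xc P ^ 2 + s) ^ 2 := by
      simp [phi, hy0, psi₃]
      linear_combination 12 * xc P * hc
    rw [this]
    exact pow_ne_zero 2 h3
  · have hy0 : yc P ≠ 0 := fun e ↦ hy (by simp [e])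
    have h2P : (2 : ℕ) • P ≠ 0 := mt two_nsmul_eq_zero_iff.mp hy
    refine Or.inr ⟨h2P, by simp [hy0, h2], ?_⟩
    have := xc_two_nsmul_mul hP h2P
    simp [phi, psi₃]
    linear_combination this - 4 * xc P * hc

/-- Projectively, `n • P` has abscissa `(φ_n : E_n^2)`, and the cross product vanishes only if the
two abscissas agree, that is, if `a • P = ±b • P`. -/
lemma DescribesMul.cross_ne_zero {a b : ℕ} (ha : DescribesMul P a) (hb : DescribesMul P b)
    (h : a • P + b • P ≠ 0) (h' : a • P - b • P ≠ 0) :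
    phi s t (xc P) (yc P) a * eds s t (xc P) (yc P) b ^ 2 -
      phi s t (xc P) (yc P) b * eds s t (xc P) (yc P) a ^ 2 ≠ 0 := by
  rcases ha with ⟨a₁, a₂, a₃⟩ | ⟨a₁, a₂, a₃⟩ <;> rcases hb with ⟨b₁, b₂, b₃⟩ | ⟨b₁, b₂, b₃⟩
  · simp [a₁, b₁] at h
  · simp [a₂, a₃, b₂]
  · simp [a₂, b₂, b₃]
  · rw [← a₃, ← b₃]
    have : (xc (a • P) - xc (b • P)) *
        (eds s t (xc P) (yc P) a * eds s t (xc P) (yc P) b) ^ 2 ≠ 0 :=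
      mul_ne_zero (sub_ne_zero.mpr (xc_ne a₁ b₁ h h')) (pow_ne_zero 2 (mul_ne_zero a₂ b₂))
    convert this using 1
    ring

/-- When `n • P` is affine with `x(nP) ≠ x(P)`, the addition formula matches `phi_step`. If `n • P =
0`, the nonvanishing of `φ_n` suffices. The degenerate cases are `n • P = P` and `n • P = -P`, where
`E_(n+1) E_(n-1) = 0` and the elliptic relation at other index pairs must decide which factor
vanishes. -/
lemma describesMul_succ (h2 : (2 : F) ≠ 0) (hP : P ≠ 0) {n : ℕ} (hn : 2 ≤ n)
    (ih : ∀ k, 1 ≤ k → k ≤ n → DescribesMul P k) : DescribesMul P (n + 1) := by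
  obtain ⟨hc, hns⟩ := nonsingular_of_ne_zero hP
  have ihn := ih n (by omega) le_rfl
  have ihn' := ih (n - 1) (by omega) (by omega)
  have ih₂ := ih 2 (by omega) hn
  have hcross := fun a b ha han hb hbn ↦
    (ih a ha han).cross_ne_zero (b := b) (ih b hb hbn)
  unfold DescribesMul at ihn ihn' ih₂ ⊢
  obtain ⟨E, hE⟩ : ∃ E : ℕ → F, ∀ k : ℕ, eds s t (xc P) (yc P) k = E k := ⟨_, fun _ ↦ rfl⟩
  obtain ⟨f, hf⟩ : ∃ f : ℕ → F, ∀ k : ℕ, phi s t (xc P) (yc P) k = f k := ⟨_, fun _ ↦ rfl⟩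
  have E₁ : E 1 = 1 := by rw [← hE]; simp
  have E₂ : E 2 = 2 * yc P := by rw [← hE]; simp
  have E₃ : E 3 = psi₃ s t (xc P) := by rw [← hE]; exact eds_three ..
  have E₄ : E 4 = prePsi₄ s t (xc P) * (2 * yc P) := by rw [← hE]; exact eds_four ..
  have hf' : ∀ k : ℕ, f (k + 1) = xc P * E (k + 1) ^ 2 - E (k + 2) * E k := by
    intro k
    rw [← hf, phi, hE, show ((k + 1 : ℕ) : ℤ) + 1 = (k + 2 : ℕ) by push_cast; ring,
      show ((k + 1 : ℕ) : ℤ) - 1 = k by push_cast; ring, hE, hE]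
  have hF : ∀ m k : ℕ, 1 ≤ k → k ≤ m → E (m + k) * E (m - k) = f k * E m ^ 2 - f m * E k ^ 2 := by
    intro m k hk hkm
    rw [← hf, ← hf, ← hE, ← hE, ← hE, ← hE, ← eds_add_mul_eds_sub hc hk hkm]
    congr 2
    omega
  have hS : ∀ k : ℕ, 1 ≤ k → f (k + 2) * E k ^ 2 + f k * E (k + 2) ^ 2 =
      2 * ((f (k + 1) * xc P + s * E (k + 1) ^ 2) * (f (k + 1) + xc P * E (k + 1) ^ 2) +
        2 * t * E (k + 1) ^ 4) := by
    intro k hk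
    have := phi_step hc (show 2 ≤ k + 1 by omega)
    rw [show ((k + 1 : ℕ) : ℤ) + 1 = (k + 2 : ℕ) by push_cast; ring,
      show ((k + 1 : ℕ) : ℤ) - 1 = k by push_cast; ring] at this
    simpa only [hE, hf] using this
  simp only [hE, hf] at *
  clear hE hf
  obtain ⟨k, rfl⟩ := Nat.exists_eq_add_of_le' hn
  rw [show k + 2 - 1 = k + 1 by omega] at ihn'
  rw [show k + 2 + 1 = k + 3 by ring]
  have hf₂ := hf' (k + 1)
  have hf₃ := hf' (k + 2)
  have hadd : (k + 3) • P = (k + 2) • P + P := succ_nsmul P (k + 2)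
  have hsub : (k + 1) • P = (k + 2) • P - P := by rw [succ_nsmul P (k + 1)]; abel
  rcases ihn with ⟨n₁, n₂, n₃⟩ | ⟨n₁, n₂, n₃⟩
  · right
    rw [n₁, zero_add] at hadd
    rw [n₂] at hf₂ hf₃
    refine ⟨by rwa [hadd], ?_, ?_⟩
    · intro e
      exact n₃ (by rw [hf₂]; simp [e])
    · rw [hadd, hf₃]; ring
  · have hprod : E (k + 3) * E (k + 1) = E (k + 2) ^ 2 * (xc P - xc ((k + 2) • P)) := by
      linear_combination n₃ + hf₂
    by_cases hx : xc ((k + 2) • P) = xc P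
    · have hprod' : E (k + 3) * E (k + 1) = 0 := by rw [hprod, hx]; ring
      rcases eq_or_eq_neg_of_xc_eq n₁ hP hx with hpos | hneg
      -- Here `(n - 1) • P = 0` and `(n + 1) • P = 2 • P`, so the relations with second index `2`
      -- determine `E_(n+1)` and `φ_(n+1)`.
      · rw [hpos, sub_self] at hsub
        rw [hpos, ← two_nsmul] at hadd
        have hk : 1 ≤ k := by
          rcases Nat.eq_zero_or_pos k with rfl | hk
          · simp at hsub; exact absurd hsub hP
          · exact hk
        rcases ihn' with ⟨m₁, m₂, m₃⟩ | ⟨m₁, -, -⟩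
        swap
        · exact absurd hsub m₁
        have g₁ := hF (k + 1) 2 (by omega) (by omega)
        have g₂ := hF (k + 3) 2 (by omega) (by omega)
        have g₃ := hF (k + 2) 2 (by omega) (by omega)
        rw [show k + 3 - 2 = k + 1 by omega, m₂] at g₂
        rw [m₂, show k + 1 + 2 = k + 3 by ring] at g₁
        rcases ih₂ with ⟨p₁, p₂, p₃⟩ | ⟨p₁, p₂, p₃⟩
        · left
          rw [p₂] at g₂ g₃
          have h₃ : E (k + 3) = 0 := by
            have : f 2 * E (k + 3) ^ 2 = 0 := by linear_combination -g₂
            simpa [p₃] using this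
          refine ⟨by rw [hadd, p₁], h₃, ?_⟩
          rw [hf₃, h₃]
          have : E (k + 4) ≠ 0 := by
            intro e
            rw [show k + 2 + 2 = k + 4 by ring, e] at g₃
            have : f 2 * E (k + 2) ^ 2 = 0 := by linear_combination -g₃
            simp [p₃, n₂] at this
          simp [this, n₂]
        · right
          have h₃ : E (k + 3) ≠ 0 := by
            intro e
            rw [e] at g₁
            have : f (k + 1) * E 2 ^ 2 = 0 := by linear_combination g₁
            simp [m₃, p₂] at this
          refine ⟨by rwa [hadd], h₃, ?_⟩
          rw [hadd]
          refine mul_right_cancel₀ (pow_ne_zero 2 p₂) ?_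
          linear_combination E (k + 3) ^ 2 * p₃ - g₂
      · by_cases h2P : (2 : ℕ) • P = 0
        · have hPn : -P = P := by
            rw [neg_eq_iff_add_eq_zero, ← two_nsmul, h2P]
          rw [hneg, hPn, sub_self] at hsub
          rcases ih₂ with ⟨p₁, p₂, p₃⟩ | ⟨p₁, p₂, p₃⟩
          swap
          · exact absurd h2P p₁
          have hk : 1 ≤ k := by
            rcases Nat.eq_zero_or_pos k with rfl | hk
            · simp at hsub; exact absurd hsub hP
            · exact hk
          rcases ihn' with ⟨m₁, m₂, m₃⟩ | ⟨m₁, -, -⟩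
          swap
          · exact absurd hsub m₁
          have g₂ := hF (k + 3) 2 (by omega) (by omega)
          have g₃ := hF (k + 2) 2 (by omega) (by omega)
          rw [show k + 3 - 2 = k + 1 by omega, m₂] at g₂
          left
          rw [p₂] at g₂ g₃
          have h₃ : E (k + 3) = 0 := by
            have : f 2 * E (k + 3) ^ 2 = 0 := by linear_combination -g₂
            simpa [p₃] using this
          refine ⟨by rw [hadd, hneg]; simp, h₃, ?_⟩
          rw [hf₃, h₃]
          have : E (k + 4) ≠ 0 := by
            intro e
            rw [show k + 2 + 2 = k + 4 by ring, e] at g₃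
            have : f 2 * E (k + 2) ^ 2 = 0 := by linear_combination -g₃
            simp [p₃, n₂] at this
          simp [this, n₂]
        · left
          have hm : (k + 1) • P ≠ 0 := by
            rw [hsub, hneg]
            intro e
            apply h2P
            rw [two_nsmul]
            have : -(P + P) = 0 := by rw [← e]; abel
            exact neg_eq_zero.mp this
          rcases ihn' with ⟨m₁, m₂, m₃⟩ | ⟨m₁, m₂, m₃⟩
          · exact absurd m₁ hm
          have h₃ : E (k + 3) = 0 := (mul_eq_zero.mp hprod').resolve_right m₂
          refine ⟨by rw [hadd, hneg]; simp, h₃, ?_⟩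
          rw [hf₃, h₃]
          have hk4 : (k + 4) • P = P := by
            rw [succ_nsmul P (k + 3), hadd, hneg]; simp
          -- To see that `φ_(k+3)` does not vanish along with `E_(k+3)`, one needs `E_(k+4) ≠ 0`.
          -- The index `k + 4` is split into two indices at most `n` that differ by `1` or `2`, and
          -- the elliptic relation turns `E_(k+4)` into a nonzero cross product.
          have : E (k + 4) ≠ 0 := by
            rcases Nat.even_or_odd' k with ⟨m, rfl | rfl⟩
            · rcases Nat.eq_zero_or_pos m with rfl | hm0
              -- For `k = 0` the splitting `3 + 1` uses an index not yet treated. Instead `prePsi₄ +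
              -- 16 y^4 = 2 (3x^2 + s) psi₃` on the curve, and `psi₃` vanishes here.
              · simp only [mul_zero, zero_add] at *
                have hy0 : yc P ≠ 0 := by
                  intro e
                  exact h2P (two_nsmul_eq_zero_iff.mpr (by simp [e]))
                have h4 : (16 : F) ≠ 0 := by
                  rw [show (16 : F) = 2 ^ 4 by norm_num]; exact pow_ne_zero 4 h2
                rw [E₃] at h₃
                have : prePsi₄ s t (xc P) = -16 * yc P ^ 4 := by
                  have e : yc P ^ 4 = (xc P ^ 3 + s * xc P + t) ^ 2 := by rw [← hc]; ring
                  rw [e]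
                  simp only [psi₃, prePsi₄] at h₃ ⊢
                  linear_combination 2 * (3 * xc P ^ 2 + s) * h₃
                rw [E₄, this]
                simp [hy0, h2, h4]
              · have g := hF (m + 3) (m + 1) (by omega) (by omega)
                rw [show m + 3 + (m + 1) = 2 * m + 4 by ring,
                  show m + 3 - (m + 1) = 2 by omega] at g
                have := hcross (m + 1) (m + 3) (by omega) (by omega) (by omega) (by omega)
                  (by rw [← add_nsmul, show m + 1 + (m + 3) = 2 * m + 4 by ring, hk4]; exact hP)
                  (by
                    rw [show m + 3 = m + 1 + 2 by ring, add_nsmul P (m + 1) 2]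
                    intro e
                    apply h2P
                    have : -((2 : ℕ) • P) = 0 := by rw [← e]; abel
                    simpa using this)
                rw [← g] at this
                exact left_ne_zero_of_mul this
            · have g := hF (m + 3) (m + 2) (by omega) (by omega)
              rw [show m + 3 + (m + 2) = 2 * m + 1 + 4 by ring,
                  show m + 3 - (m + 2) = 1 by omega] at g
              have := hcross (m + 2) (m + 3) (by omega) (by omega) (by omega) (by omega)
                (by rw [← add_nsmul, show m + 2 + (m + 3) = 2 * m + 1 + 4 by ring, hk4]; exact hP)
                (by
                  rw [show m + 3 = m + 2 + 1 by ring, add_nsmul P (m + 2) 1, one_nsmul]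
                  intro e
                  apply hP
                  have : -P = 0 := by rw [← e]; abel
                  simpa using this)
              rw [← g] at this
              exact left_ne_zero_of_mul this
          simp [this, n₂]
    · right
      have h₁₃ : E (k + 3) * E (k + 1) ≠ 0 := by
        rw [hprod]
        exact mul_ne_zero (pow_ne_zero 2 n₂) (sub_ne_zero.mpr (Ne.symm hx))
      have h₃ := left_ne_zero_of_mul h₁₃
      have h₁ := right_ne_zero_of_mul h₁₃
      rcases ihn' with ⟨-, m₂, -⟩ | ⟨m₁, m₂, m₃⟩
      · exact absurd m₂ h₁
      refine ⟨by rw [hadd]; exact add_ne_zero_of_xc_ne hx, h₃, ?_⟩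
      have hs := xc_add_add_xc_sub n₁ hP hx
      rw [← hadd, ← hsub] at hs
      have hS' := hS (k + 1) (by omega)
      rw [show k + 1 + 2 = k + 3 by ring, show k + 1 + 1 = k + 2 by ring, ← n₃, ← m₃] at hS'
      refine mul_right_cancel₀ (pow_ne_zero 2 h₁) ?_
      have hsq : (E (k + 3) * E (k + 1)) ^ 2 =
          E (k + 2) ^ 4 * (xc ((k + 2) • P) - xc P) ^ 2 := by rw [hprod]; ring
      linear_combination E (k + 2) ^ 4 * hs - hS' +
        (xc ((k + 3) • P) + xc ((k + 1) • P)) * hsq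

/-- The multiplication formula on `y² = x³ + s x + t` in terms of division polynomials. -/
theorem describesMul (h2 : (2 : F) ≠ 0) (hP : P ≠ 0) {n : ℕ} (hn : 1 ≤ n) : DescribesMul P n := by
  induction n using Nat.strong_induction_on with
  | _ n ih =>
    rcases hn.eq_or_lt with rfl | hn
    · exact describesMul_one hP
    rcases (show 2 ≤ n from hn).eq_or_lt with rfl | hn
    · exact describesMul_two h2 hP
    obtain ⟨k, rfl⟩ := Nat.exists_eq_add_of_lt hn
    exact describesMul_succ h2 hP (by omega) fun j hj hjk ↦ ih j (by omega) hj

end Multiples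

section Consequences

open Polynomial WeierstrassCurve

variable {F : Type*} [Field F] [DecidableEq F] {s t : F} {P : (shortCurve s t).toAffine.Point}

lemma nsmul_eq_zero_iff_eval (h2 : (2 : F) ≠ 0) (hP : P ≠ 0) {n : ℕ} (hn : Odd n) :
    n • P = 0 ↔ ((shortCurve s t).preΨ n).eval (xc P) = 0 := by
  have hc := (nonsingular_of_ne_zero hP).1
  have e := eds_eq hc n
  rw [if_neg (by simpa using hn), mul_one] at e
  rw [← e]
  rcases describesMul h2 hP hn.pos with ⟨h₁, h₂, -⟩ | ⟨h₁, h₂, -⟩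
  · simp [h₁, h₂]
  · simp [h₁, h₂]

lemma xc_nsmul_mul_eval (h2 : (2 : F) ≠ 0) (hP : P ≠ 0) {n : ℕ} (hn : 1 ≤ n) (hnP : n • P ≠ 0) :
    xc (n • P) * ((shortCurve s t).ΨSq n).eval (xc P) = ((shortCurve s t).Φ n).eval (xc P) := by
  have hc := (nonsingular_of_ne_zero hP).1
  rw [eval_ΨSq hc, eval_Φ hc]
  rcases describesMul h2 hP hn with ⟨h₁, -, -⟩ | ⟨-, -, h₃⟩
  · exact absurd h₁ hnP
  · exact h₃

lemma eval_Φ_ne_zero_or (h2 : (2 : F) ≠ 0) (hP : P ≠ 0) {n : ℕ} (hn : 1 ≤ n) :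
    ((shortCurve s t).Φ n).eval (xc P) ≠ 0 ∨ ((shortCurve s t).ΨSq n).eval (xc P) ≠ 0 := by
  have hc := (nonsingular_of_ne_zero hP).1
  rw [eval_ΨSq hc, eval_Φ hc]
  rcases describesMul h2 hP hn with ⟨-, -, h₃⟩ | ⟨-, h₂, -⟩
  · exact Or.inl h₃
  · exact Or.inr (pow_ne_zero 2 h₂)

end Consequences

section Coprime

open Polynomial WeierstrassCurve

variable {F : Type*} [Field F] {s t : F}

lemma Δ_eq : (shortCurve s t).Δ = -16 * (4 * s ^ 3 + 27 * t ^ 2) := by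
  simp [Δ, b₂, b₄, b₆, b₈]
  ring

lemma nonsingular_of_disc_ne_zero (h2 : (2 : F) ≠ 0) (hd : 4 * s ^ 3 + 27 * t ^ 2 ≠ 0) {x y : F}
    (h : y ^ 2 = x ^ 3 + s * x + t) : (shortCurve s t).toAffine.Nonsingular x y := by
  refine (WeierstrassCurve.Affine.equation_iff_nonsingular_of_Δ_ne_zero ?_).mp (equation_iff.mpr h)
  rw [show (shortCurve s t).toAffine.Δ = (shortCurve s t).Δ from rfl, Δ_eq]
  refine mul_ne_zero ?_ hd
  rw [show (-16 : F) = -2 ^ 4 by norm_num]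
  exact neg_ne_zero.mpr (pow_ne_zero 4 h2)

lemma exists_point_of_isAlgClosed [IsAlgClosed F] (h2 : (2 : F) ≠ 0)
    (hd : 4 * s ^ 3 + 27 * t ^ 2 ≠ 0) (x : F) :
    ∃ P : (shortCurve s t).toAffine.Point, P ≠ 0 ∧ xc P = x := by
  obtain ⟨y, hy⟩ := IsAlgClosed.exists_pow_nat_eq (x ^ 3 + s * x + t) (show 0 < 2 by norm_num)
  exact ⟨.some x y (nonsingular_of_disc_ne_zero h2 hd hy),
    WeierstrassCurve.Affine.Point.some_ne_zero _, rfl⟩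

/-- The numerator and the denominator of multiplication by `n` on an elliptic curve are coprime. -/
lemma isCoprime_Φ_ΨSq (h2 : (2 : F) ≠ 0) (hd : 4 * s ^ 3 + 27 * t ^ 2 ≠ 0) {n : ℕ} (hn : 1 ≤ n) :
    IsCoprime ((shortCurve s t).Φ n) ((shortCurve s t).ΨSq n) := by
  classical
  set φ := algebraMap F (AlgebraicClosure F)
  rw [← isCoprime_map φ, ← map_Φ, ← map_ΨSq, map_eq]
  have h2' : (2 : AlgebraicClosure F) ≠ 0 := by
    rw [← map_ofNat φ 2]; exact (map_ne_zero φ).mpr h2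
  have hd' : 4 * φ s ^ 3 + 27 * φ t ^ 2 ≠ 0 := by
    have := (map_ne_zero φ).mpr hd
    simpa [map_ofNat] using this
  -- Every element of the algebraic closure is the abscissa of a point, and `φ_n` and `E_n` never
  -- vanish together at a point.
  rw [isCoprime_iff_aeval_ne_zero_of_isAlgClosed (AlgebraicClosure F) (AlgebraicClosure F)]
  intro x
  obtain ⟨P, hP, rfl⟩ := exists_point_of_isAlgClosed h2' hd' x
  simpa using eval_Φ_ne_zero_or h2' hP hn

end Coprime

end shortCurve

/-! ### Verschiebung on abscissas and the Hasse invariant -/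

namespace shortCurve

open Polynomial WeierstrassCurve

section Identities

variable {R : Type*} [CommRing R] (s t : R)

lemma exists_map_eq : ∃ f : MvPolynomial (Fin 2) ℤ →+* R,
    (shortCurve (MvPolynomial.X 0) (MvPolynomial.X 1)).map f = shortCurve s t := by
  refine ⟨MvPolynomial.eval₂Hom (Int.castRingHom R) ![s, t], ?_⟩
  rw [map_eq]
  simp

lemma wronskian_Φ_ΨSq {n : ℕ} (hodd : Odd n) :
    derivative ((shortCurve s t).Φ n) * (shortCurve s t).ΨSq n -
      (shortCurve s t).Φ n * derivative ((shortCurve s t).ΨSq n) =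
      (n : R[X]) * (shortCurve s t).preΨ (2 * n) := by
  obtain ⟨f, hf⟩ := exists_map_eq s t
  have := congrArg (map f) (exists_generic_identities hodd.pos hodd).1
  simp only [Polynomial.map_sub, Polynomial.map_mul, ← derivative_map, ← map_Φ, ← map_ΨSq,
    ← map_preΨ, hf, Polynomial.map_natCast] at this
  exact this

lemma cubic_mul_preΨ_sq {n : ℕ} (hodd : Odd n) :
    (X ^ 3 + C s * X + C t) * (shortCurve s t).preΨ (2 * n) ^ 2 = (shortCurve s t).ΨSq n *
      ((shortCurve s t).Φ n ^ 3 + C s * (shortCurve s t).Φ n * (shortCurve s t).ΨSq n ^ 2 +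
        C t * (shortCurve s t).ΨSq n ^ 3) := by
  obtain ⟨f, hf⟩ := exists_map_eq s t
  have h₄ : f (shortCurve (MvPolynomial.X 0) (MvPolynomial.X 1)).a₄ = s :=
    congrArg WeierstrassCurve.a₄ hf
  have h₆ : f (shortCurve (MvPolynomial.X 0) (MvPolynomial.X 1)).a₆ = t :=
    congrArg WeierstrassCurve.a₆ hf
  have := congrArg (map f) (exists_generic_identities hodd.pos hodd).2
  simp only [Polynomial.map_add, Polynomial.map_mul, Polynomial.map_pow, Polynomial.map_X,
    Polynomial.map_C, h₄, h₆, ← map_Φ, ← map_ΨSq, ← map_preΨ, hf] at this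
  exact this

lemma ΨSq_eq_preΨ_sq {n : ℕ} (hodd : Odd n) :
    (shortCurve s t).ΨSq n = (shortCurve s t).preΨ n ^ 2 := by
  rw [ΨSq, if_neg (by simpa using hodd), mul_one]

/-- The numerator of the Verschiebung isogeny on `x`-coordinates. -/
noncomputable def verNum (p : ℕ) : R[X] := contract p ((shortCurve s t).Φ p)

/-- The square root of the denominator of the Verschiebung isogeny on `x`-coordinates. -/
noncomputable def verDen (p : ℕ) : R[X] := contract p ((shortCurve s t).preΨ p)

/-- The Hasse invariant of `y² = x³ + s x + t`. -/
noncomputable def hasse (p : ℕ) : R := ((X ^ 3 + C s * X + C t) ^ ((p - 1) / 2)).coeff (p - 1)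

variable {S : Type*} [CommRing S] (f : R →+* S)

lemma map_verNum {p : ℕ} (hp : p ≠ 0) : (verNum s t p).map f = verNum (f s) (f t) p := by
  rw [verNum, verNum, map_contract hp, ← map_Φ, map_eq]

lemma map_verDen {p : ℕ} (hp : p ≠ 0) : (verDen s t p).map f = verDen (f s) (f t) p := by
  rw [verDen, verDen, map_contract hp, ← map_preΨ, map_eq]

lemma map_hasse (p : ℕ) : f (hasse s t p) = hasse (f s) (f t) p := by
  rw [hasse, hasse, ← coeff_map]
  simp

end Identities

section CharP

variable {F : Type*} [Field F] {p : ℕ} [hpp : Fact p.Prime] [CharP F p] {s t : F}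

lemma two_ne_zero_of_charP (F : Type*) [Field F] {p : ℕ} [hpp : Fact p.Prime] [CharP F p]
    (hp : p ≠ 2) : (2 : F) ≠ 0 := by
  intro h
  have : ((2 : ℕ) : F) = 0 := by exact_mod_cast h
  rw [CharP.cast_eq_zero_iff F p, Nat.prime_dvd_prime_iff_eq hpp.out Nat.prime_two] at this
  exact hp this

/-- Multiplication by `p` is inseparable: the Wronskian is a multiple of `p`, hence `Φ' ΨSq = Φ
ΨSq'`. By coprimality `ΨSq` divides its own derivative, which must then be zero for reasons of
degree. -/
lemma derivative_Φ_ΨSq_eq_zero (hp : p ≠ 2) (hd : 4 * s ^ 3 + 27 * t ^ 2 ≠ 0) :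
    derivative ((shortCurve s t).Φ p) = 0 ∧ derivative ((shortCurve s t).ΨSq p) = 0 := by
  have hodd : Odd p := hpp.out.odd_of_ne_two hp
  have hcop := isCoprime_Φ_ΨSq (two_ne_zero_of_charP F hp) hd hpp.out.one_le
  have hw := wronskian_Φ_ΨSq s t hodd
  rw [CharP.cast_eq_zero F[X] p, zero_mul, sub_eq_zero] at hw
  have hΨ : derivative ((shortCurve s t).ΨSq p) = 0 := by
    have hdvd : (shortCurve s t).ΨSq p ∣ derivative ((shortCurve s t).ΨSq p) :=
      hcop.symm.dvd_of_dvd_mul_left ⟨derivative ((shortCurve s t).Φ p), by rw [← hw]; ring⟩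
    by_contra h
    have h0 : (shortCurve s t).ΨSq p ≠ 0 := fun e ↦ h (by rw [e, derivative_zero])
    exact absurd (degree_le_of_dvd hdvd h) (not_le.mpr (degree_derivative_lt h0))
  refine ⟨?_, hΨ⟩
  rw [hΨ, mul_zero] at hw
  refine (mul_eq_zero.mp hw).resolve_right fun h0 ↦ ?_
  rw [h0, isCoprime_zero_right] at hcop
  have h₁ := natDegree_eq_zero_of_isUnit hcop
  rw [natDegree_Φ] at h₁
  simp [hpp.out.ne_zero] at h₁

lemma derivative_preΨ_eq_zero (hp : p ≠ 2) (hd : 4 * s ^ 3 + 27 * t ^ 2 ≠ 0) :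
    derivative ((shortCurve s t).preΨ p) = 0 := by
  have h := (derivative_Φ_ΨSq_eq_zero hp hd).2
  rw [ΨSq_eq_preΨ_sq s t (hpp.out.odd_of_ne_two hp), derivative_pow] at h
  have h2 : (C ((2 : ℕ) : F)) ≠ 0 := by
    rw [Ne, C_eq_zero]; exact_mod_cast two_ne_zero_of_charP F hp
  rcases mul_eq_zero.mp h with h | h
  · rcases mul_eq_zero.mp h with h | h
    · exact absurd h h2
    · rw [Nat.add_one_sub_one, pow_one] at h
      rw [h, derivative_zero]
  · exact h

lemma expand_verNum (hp : p ≠ 2) (hd : 4 * s ^ 3 + 27 * t ^ 2 ≠ 0) :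
    expand F p (verNum s t p) = (shortCurve s t).Φ p :=
  expand_contract p (derivative_Φ_ΨSq_eq_zero hp hd).1 hpp.out.ne_zero

lemma expand_verDen (hp : p ≠ 2) (hd : 4 * s ^ 3 + 27 * t ^ 2 ≠ 0) :
    expand F p (verDen s t p) = (shortCurve s t).preΨ p :=
  expand_contract p (derivative_preΨ_eq_zero hp hd) hpp.out.ne_zero

lemma expand_verDen_sq (hp : p ≠ 2) (hd : 4 * s ^ 3 + 27 * t ^ 2 ≠ 0) :
    expand F p (verDen s t p ^ 2) = (shortCurve s t).ΨSq p := by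
  rw [map_pow, expand_verDen hp hd, ΨSq_eq_preΨ_sq s t (hpp.out.odd_of_ne_two hp)]

lemma natDegree_verNum (hp : p ≠ 2) (hd : 4 * s ^ 3 + 27 * t ^ 2 ≠ 0) :
    (verNum s t p).natDegree = p := by
  have := natDegree_expand p (verNum s t p)
  rw [expand_verNum hp hd, natDegree_Φ, Int.natAbs_natCast, pow_two] at this
  exact (Nat.eq_of_mul_eq_mul_right hpp.out.pos this).symm

lemma monic_verNum (hp : p ≠ 2) (hd : 4 * s ^ 3 + 27 * t ^ 2 ≠ 0) : (verNum s t p).Monic := by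
  rw [← monic_expand_iff hpp.out.pos, expand_verNum hp hd]
  exact leadingCoeff_Φ _ _

lemma natDegree_verDen_le (hp : p ≠ 2) (hd : 4 * s ^ 3 + 27 * t ^ 2 ≠ 0) :
    (verDen s t p).natDegree ≤ (p - 1) / 2 := by
  have h := natDegree_expand p (verDen s t p)
  have hle := natDegree_preΨ_le (shortCurve s t) p
  have hodd : Odd p := hpp.out.odd_of_ne_two hp
  rw [if_neg (by simpa using hodd), Int.natAbs_natCast] at hle
  rw [expand_verDen hp hd] at h
  rw [h] at hle
  obtain ⟨m, hm⟩ := hodd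
  rw [show (p - 1) / 2 = m by omega]
  -- With `p = 2m + 1` the bound for `preΨ p` is `2m^2 + 2m = mp + m`, which is less than `(m +
  -- 1)p`.
  have : (p ^ 2 - 1) / 2 = 2 * m ^ 2 + 2 * m := by
    rw [hm, show (2 * m + 1) ^ 2 - 1 = 2 * (2 * m ^ 2 + 2 * m) by ring_nf; omega]
    omega
  rw [this] at hle
  by_contra! hlt
  have : (m + 1) * p ≤ (verDen s t p).natDegree * p := Nat.mul_le_mul_right p hlt
  rw [hm] at this hle
  nlinarith

lemma isCoprime_verNum_verDen_sq (hp : p ≠ 2) (hd : 4 * s ^ 3 + 27 * t ^ 2 ≠ 0) :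
    IsCoprime (verNum s t p) (verDen s t p ^ 2) := by
  rw [← isCoprime_expand hpp.out.ne_zero, expand_verNum hp hd, expand_verDen_sq hp hd]
  exact isCoprime_Φ_ΨSq (two_ne_zero_of_charP F hp) hd hpp.out.one_le

end CharP

section Lift

variable (p : ℕ) [hpp : Fact p.Prime]

/-- Over `𝔽_p(s, t)` these polynomials have zero derivative. Over `ℤ[s, t]` they are therefore
polynomials in `X ^ p` up to multiples of `p`, and this allows the Wronskian identity to be divided
by `p`. -/
lemma exists_lift_expand (hp : p ≠ 2) :
    let W := shortCurve (MvPolynomial.X 0 : MvPolynomial (Fin 2) ℤ) (MvPolynomial.X 1)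
    (∃ g, W.Φ p = expand _ p (contract p (W.Φ p)) + (p : (MvPolynomial (Fin 2) ℤ)[X]) * g) ∧
    (∃ g, W.ΨSq p = expand _ p (contract p (W.ΨSq p)) + (p : (MvPolynomial (Fin 2) ℤ)[X]) * g) := by
  intro W
  let k := FractionRing (MvPolynomial (Fin 2) (ZMod p))
  let ι : MvPolynomial (Fin 2) (ZMod p) →+* k := algebraMap _ _
  have hι : Function.Injective ι := IsFractionRing.injective _ _
  have : CharP k p := charP_of_injective_algebraMap hι p
  let r : MvPolynomial (Fin 2) ℤ →+* MvPolynomial (Fin 2) (ZMod p) :=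
    MvPolynomial.map (Int.castRingHom (ZMod p))
  have hd : 4 * ι (MvPolynomial.X 0) ^ 3 + 27 * ι (MvPolynomial.X 1) ^ 2 ≠ 0 := by
    have h₄ : (4 : ZMod p) ≠ 0 := by
      rw [show (4 : ZMod p) = 2 ^ 2 by norm_num]
      exact pow_ne_zero 2 (two_ne_zero_of_charP (ZMod p) hp)
    intro h
    have h' : (4 * MvPolynomial.X 0 ^ 3 + 27 * MvPolynomial.X 1 ^ 2 :
        MvPolynomial (Fin 2) (ZMod p)) = 0 := by
      apply hι
      rw [map_zero, ← h]
      simp only [map_add, map_mul, map_pow, map_ofNat]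
    have := congrArg (MvPolynomial.eval ![1, 0]) h'
    simp at this
    exact h₄ this
  have key : ∀ G : (MvPolynomial (Fin 2) ℤ)[X], derivative (G.map (ι.comp r)) = 0 →
      ∃ g, G = expand _ p (contract p G) + (p : (MvPolynomial (Fin 2) ℤ)[X]) * g := by
    intro G hG
    have hG' := expand_contract p hG hpp.out.ne_zero
    have hdvd : C (p : MvPolynomial (Fin 2) ℤ) ∣ G - expand _ p (contract p G) := by
      rw [C_dvd_iff_dvd_coeff]
      intro i
      rw [show (p : MvPolynomial (Fin 2) ℤ) = MvPolynomial.C (p : ℤ) by simp,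
        MvPolynomial.C_dvd_iff_zmod]
      apply hι
      change ι (r _) = ι 0
      rw [← RingHom.comp_apply, ← coeff_map, Polynomial.map_sub, map_expand,
        map_contract hpp.out.ne_zero, hG', sub_self, coeff_zero, map_zero]
    obtain ⟨g, hg⟩ := hdvd
    refine ⟨g, ?_⟩
    rw [← C_eq_natCast, ← hg]
    ring
  have hW : W.map (ι.comp r) = shortCurve (ι (MvPolynomial.X 0)) (ι (MvPolynomial.X 1)) := by
    rw [map_eq]; simp [r]
  constructor
  · exact key _ (by rw [← map_Φ, hW]; exact (derivative_Φ_ΨSq_eq_zero hp hd).1)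
  · exact key _ (by rw [← map_ΨSq, hW]; exact (derivative_Φ_ΨSq_eq_zero hp hd).2)

/-- Put `Φ = N(X^p) + p g` and `ΨSq = D(X^p) + p h` into the Wronskian identity. As `(N(X^p))' = p
X^(p-1) N'(X^p)`, both sides are divisible by `p`; cancel it over `ℤ[s, t]` and then reduce. The
terms in `g'` and `h'` will be removed by the Cartier operator. -/
lemma exists_preΨ_two_mul_eq (hp : p ≠ 2) {R : Type*} [CommRing R] [CharP R p] (s t : R) :
    ∃ g h : R[X], (shortCurve s t).preΨ (2 * p) =
      X ^ (p - 1) * expand R p (derivative (verNum s t p) * contract p ((shortCurve s t).ΨSq p) -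
        verNum s t p * derivative (contract p ((shortCurve s t).ΨSq p))) +
      derivative g * expand R p (contract p ((shortCurve s t).ΨSq p)) -
      derivative h * expand R p (verNum s t p) := by
  obtain ⟨f, hf⟩ := exists_map_eq s t
  set W := shortCurve (MvPolynomial.X 0 : MvPolynomial (Fin 2) ℤ) (MvPolynomial.X 1) with hWdef
  obtain ⟨⟨g, hg⟩, ⟨h, hh⟩⟩ := exists_lift_expand p hp
  have hw := wronskian_Φ_ΨSq (MvPolynomial.X 0 : MvPolynomial (Fin 2) ℤ) (MvPolynomial.X 1)
    (hpp.out.odd_of_ne_two hp)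
  simp only [← hWdef] at hg hh hw
  set N := contract p (W.Φ p) with hN
  set D := contract p (W.ΨSq p) with hD
  rw [hg, hh] at hw
  simp only [map_add, derivative_expand, derivative_mul, derivative_natCast, zero_mul,
    zero_add] at hw
  have hp0 : (p : (MvPolynomial (Fin 2) ℤ)[X]) ≠ 0 := by exact_mod_cast hpp.out.ne_zero
  have hw' : W.preΨ (2 * p) = X ^ (p - 1) * (expand _ p (derivative N) * expand _ p D -
      expand _ p N * expand _ p (derivative D)) + derivative g * expand _ p D -
      derivative h * expand _ p N + (p : (MvPolynomial (Fin 2) ℤ)[X]) * (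
        X ^ (p - 1) * expand _ p (derivative N) * h - X ^ (p - 1) * expand _ p (derivative D) * g +
        derivative g * h - derivative h * g) := by
    refine mul_left_cancel₀ hp0 ?_
    rw [← hw]
    ring
  refine ⟨g.map f, h.map f, ?_⟩
  have := congrArg (map f) hw'
  have hNf : N.map f = verNum s t p := by
    rw [verNum, hN, map_contract hpp.out.ne_zero, ← map_Φ, hf]
  have hDf : D.map f = contract p ((shortCurve s t).ΨSq p) := by
    rw [hD, map_contract hpp.out.ne_zero, ← map_ΨSq, hf]
  simp only [Polynomial.map_add, Polynomial.map_sub, Polynomial.map_mul, Polynomial.map_pow,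
    Polynomial.map_X, map_expand, Polynomial.map_natCast, ← derivative_map, hNf, hDf, ← map_preΨ,
    hf, CharP.cast_eq_zero, zero_mul, add_zero] at this
  rw [this]
  simp only [map_sub, map_mul]

lemma natDegree_cubic {F : Type*} [Field F] (s t : F) : (X ^ 3 + C s * X + C t).natDegree = 3 := by
  compute_degree!

lemma monic_cubic {F : Type*} [Field F] (s t : F) : (X ^ 3 + C s * X + C t).Monic := by
  monicity!

/-- `q ↦ contract p (X * q)` plays the role of the Cartier operator. The polynomial `X f^((p-1)/2)`
has degree below `2p` and no constant term, so only its coefficient at `X ^ p` survives, and that is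
the Hasse invariant. -/
lemma contract_X_mul_cubic_pow {F : Type*} [Field F] (s t : F) (hp : p ≠ 2) :
    contract p (X * (X ^ 3 + C s * X + C t) ^ ((p - 1) / 2)) = X * C (hasse s t p) := by
  ext n
  rw [coeff_contract hpp.out.ne_zero]
  obtain ⟨m, hm⟩ := hpp.out.odd_of_ne_two hp
  rcases n with - | n
  · simp
  · rw [coeff_X_mul, show (n + 1) * p = n * p + (p - 1) + 1 by rw [add_mul]; omega, coeff_X_mul]
    rcases n with - | n
    · simp [hasse]
    · rw [coeff_C_succ]
      apply coeff_eq_zero_of_natDegree_lt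
      refine natDegree_pow_le.trans_lt ?_
      rw [natDegree_cubic, add_mul]
      omega

end Lift

section Hasse

variable {F : Type*} [Field F] {p : ℕ} [hpp : Fact p.Prime] [CharP F p] {s t : F}

/-- The Cartier operator kills exact forms: the coefficient of `X^(np)` in `X g'` carries the factor
`np = 0`. -/
lemma contract_X_mul_derivative (g : F[X]) : contract p (X * derivative g) = 0 := by
  ext n
  rw [coeff_contract hpp.out.ne_zero, coeff_zero]
  rcases Nat.eq_zero_or_pos (n * p) with h | h
  · rw [h, coeff_X_mul_zero]
  · obtain ⟨k, hk⟩ := Nat.exists_eq_succ_of_ne_zero h.ne'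
    rw [hk, Nat.succ_eq_add_one, coeff_X_mul, coeff_derivative]
    have : ((k : F) + 1) = 0 := by
      have : ((k + 1 : ℕ) : F) = ((n * p : ℕ) : F) := by rw [hk]
      push_cast at this
      rw [this, CharP.cast_eq_zero F p, mul_zero]
    rw [this, mul_zero]

/-- The relation between the Verschiebung isogeny and the Hasse invariant. -/
lemma exists_verschiebung_relation (hp : p ≠ 2) (hd : 4 * s ^ 3 + 27 * t ^ 2 ≠ 0) :
    ∃ h c : F[X], c.Monic ∧ c.natDegree = 3 ∧
      (derivative (verNum s t p) * verDen s t p ^ 2 -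
        verNum s t p * derivative (verDen s t p ^ 2)) * c = C (hasse s t p) * h ∧
      h ^ 2 = c * (verDen s t p ^ 2 * (verNum s t p ^ 3 + C s * verNum s t p *
        (verDen s t p ^ 2) ^ 2 + C t * (verDen s t p ^ 2) ^ 3)) := by
  have hodd := hpp.out.odd_of_ne_two hp
  have hp0 := hpp.out.ne_zero
  have h2 : (2 : F[X]) ≠ 0 := by
    rw [← C_ofNat, Ne, C_eq_zero]; exact two_ne_zero_of_charP F hp
  set N := verNum s t p with hN
  set D := verDen s t p ^ 2 with hD
  have eN : expand F p N = (shortCurve s t).Φ p := expand_verNum hp hd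
  have eD : expand F p D = (shortCurve s t).ΨSq p := expand_verDen_sq hp hd
  have cD : contract p ((shortCurve s t).ΨSq p) = D := by rw [← eD, contract_expand p hp0]
  set f : F[X] := X ^ 3 + C s * X + C t with hf
  set c := f.map (frobenius F p) with hc
  have hfc : expand F p c = f ^ p := by rw [hc, ← map_expand, map_frobenius_expand]
  set M := (shortCurve s t).preΨ (2 * p) with hM
  set m := (p - 1) / 2 with hm
  have hpm : p = 2 * m + 1 := by obtain ⟨k, hk⟩ := hodd; omega
  set G := D * (N ^ 3 + C s * N * D ^ 2 + C t * D ^ 3) with hG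
  have hfM : f * M ^ 2 = expand F p G := by
    rw [hM, cubic_mul_preΨ_sq s t hodd, hG, ← eN, ← eD]
    simp only [map_mul, map_add, map_pow, expand_C]
  -- Since `2(m + 1) = p + 1`, the square `H^2 = f^p · f M^2` is a polynomial in `X ^ p`. Hence `H
  -- H' = 0`, and `H` itself is a polynomial in `X ^ p`.
  set H := f ^ (m + 1) * M with hH
  have hH2 : H ^ 2 = expand F p (c * G) := by
    rw [map_mul, hfc, ← hfM, hH, hpm]
    ring
  have hH' : derivative H = 0 := by
    have h₁ : derivative (H ^ 2) = 0 := by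
      rw [hH2, derivative_expand, CharP.cast_eq_zero, zero_mul, mul_zero]
    rw [pow_two, derivative_mul] at h₁
    have h₃ : 2 * (H * derivative H) = 0 := by rw [← h₁]; ring
    rcases mul_eq_zero.mp ((mul_eq_zero.mp h₃).resolve_left h2) with h | h
    · rw [h, derivative_zero]
    · exact h
  have hHe := expand_contract p hH' hp0
  set h := contract p H with hh
  refine ⟨h, c, (monic_cubic s t).map _, ?_, ?_, ?_⟩
  · rw [hc, natDegree_map, natDegree_cubic]
  · obtain ⟨g₁, g₂, hg⟩ := exists_preΨ_two_mul_eq p hp s t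
    rw [← hM, cD, ← hN] at hg
    -- Contracting this equation applies the Cartier operator, under which polynomials in `X ^ p`
    -- pass through. The left side gives `hasse · h`, the right side gives the Wronskian of `N` and
    -- `D` times `c`.
    have e₁ : X * f ^ m * expand F p h = X * M * expand F p c := by
      rw [hHe, hfc, hH, hpm]
      ring
    have e₂ := congrArg (contract p) e₁
    have e₃ : contract p (X * M) = X * (derivative N * D - N * derivative D) := by
      have e : X * M = expand F p (X * (derivative N * D - N * derivative D)) +
          (X * derivative g₁) * expand F p D + (X * derivative g₂) * expand F p (-N) := by
        rw [hg, map_mul (expand F p) X, expand_X, map_neg]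
        nth_rewrite 5 [← Nat.sub_add_cancel hpp.out.one_le]
        rw [pow_succ]
        ring
      rw [e, contract_add hp0, contract_add hp0, contract_mul_expand hp0, contract_mul_expand hp0,
        contract_X_mul_derivative, contract_X_mul_derivative, contract_expand p hp0]
      ring
    rw [contract_mul_expand hp0, contract_mul_expand hp0, contract_X_mul_cubic_pow p s t hp,
      e₃] at e₂
    refine mul_left_cancel₀ X_ne_zero (?_ : X * _ = X * _)
    linear_combination -e₂
  · apply expand_injective hpp.out.pos
    rw [map_pow, hHe, hH2]

/-- If the Hasse invariant vanishes, there is no nontrivial `p`-torsion. -/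
lemma exists_verDen_eq_C (hp : p ≠ 2) (hd : 4 * s ^ 3 + 27 * t ^ 2 ≠ 0) (hA : hasse s t p = 0) :
    ∃ c : F, c ≠ 0 ∧ verDen s t p = C c := by
  obtain ⟨h, c, hc, -, e, -⟩ := exists_verschiebung_relation (s := s) (t := t) hp hd
  have hcop := isCoprime_verNum_verDen_sq (s := s) (t := t) hp hd
  rw [hA, C_0, zero_mul] at e
  have e' := sub_eq_zero.mp ((mul_eq_zero.mp e).resolve_right hc.ne_zero)
  have hdeg := natDegree_verDen_le (s := s) (t := t) hp hd
  have hN := natDegree_verNum (s := s) (t := t) hp hd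
  set D := verDen s t p with hD
  have hD0 : D ≠ 0 := by
    intro h0
    rw [h0, zero_pow two_ne_zero, isCoprime_zero_right] at hcop
    have := natDegree_eq_zero_of_isUnit hcop
    rw [hN] at this
    exact hpp.out.ne_zero this
  have hdvd : D ^ 2 ∣ derivative (D ^ 2) :=
    hcop.symm.dvd_of_dvd_mul_left ⟨derivative (verNum s t p), by rw [← e']; ring⟩
  have hder : derivative (D ^ 2) = 0 := by
    by_contra h
    exact absurd (degree_le_of_dvd hdvd h)
      (not_le.mpr (degree_derivative_lt (pow_ne_zero 2 hD0)))
  -- The derivative of `D^2` is zero, so its degree is a multiple of `p`; but it is at most `p - 1`.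
  have hnat : (D ^ 2).natDegree = 0 := by
    have h₁ := expand_contract p hder hpp.out.ne_zero
    have h₂ := natDegree_expand p (contract p (D ^ 2))
    rw [h₁, natDegree_pow] at h₂
    rw [natDegree_pow]
    rcases Nat.eq_zero_or_pos (contract p (D ^ 2)).natDegree with h | h
    · rw [h₂, h, zero_mul]
    · have h₃ : 1 * p ≤ (contract p (D ^ 2)).natDegree * p := Nat.mul_le_mul_right p h
      have := hpp.out.two_le
      omega
  rw [natDegree_pow] at hnat
  have hnat' : D.natDegree = 0 := by omega
  refine ⟨D.coeff 0, ?_, eq_C_of_natDegree_eq_zero hnat'⟩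
  intro h
  rw [eq_C_of_natDegree_eq_zero hnat', h, C_0] at hD0
  exact hD0 rfl

/-- Let `D = verDen^2` and let `w` be the Wronskian of `verNum` and `D`. Degrees in `w c = A h` and
`h^2 = c D J`, with `J` monic of degree `3p`, force `deg D ≥ p - 1`, which is also the upper bound.
The top coefficients then give `lc(D) = A lc(h)` and `lc(h)^2 = lc(D)`, so `A = lc(h)`. -/
lemma verDen_of_hasse_ne_zero (hp : p ≠ 2) (hd : 4 * s ^ 3 + 27 * t ^ 2 ≠ 0)
    (hA : hasse s t p ≠ 0) : (verDen s t p).natDegree = (p - 1) / 2 ∧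
      (verDen s t p).coeff ((p - 1) / 2) ^ 2 = hasse s t p ^ 2 := by
  obtain ⟨h, c, hc, hc3, e, hsq⟩ := exists_verschiebung_relation (s := s) (t := t) hp hd
  have hcop := isCoprime_verNum_verDen_sq (s := s) (t := t) hp hd
  have hdeg := natDegree_verDen_le (s := s) (t := t) hp hd
  have hN := natDegree_verNum (s := s) (t := t) hp hd
  have hNm := monic_verNum (s := s) (t := t) hp hd
  set δ := verDen s t p with hδ
  set N := verNum s t p with hNdef
  set A := hasse s t p
  obtain ⟨m, hm⟩ := hpp.out.odd_of_ne_two hp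
  have hp1 := hpp.out.two_le
  rw [show (p - 1) / 2 = m by omega] at hdeg ⊢
  have hδ0 : δ ≠ 0 := by
    intro h0
    rw [h0, zero_pow two_ne_zero, isCoprime_zero_right] at hcop
    have := natDegree_eq_zero_of_isUnit hcop
    rw [hN] at this
    exact hpp.out.ne_zero this
  set D := δ ^ 2 with hD
  have hD0 : D ≠ 0 := pow_ne_zero 2 hδ0
  have hDdeg : D.natDegree = 2 * δ.natDegree := natDegree_pow _ _
  have hK : (C s * N * D ^ 2 + C t * D ^ 3).natDegree < (N ^ 3).natDegree := by
    rw [natDegree_pow, hN]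
    have h₁ : (C s * N * D ^ 2).natDegree ≤ 0 + p + 2 * D.natDegree :=
      natDegree_mul_le.trans (add_le_add (natDegree_mul_le.trans (by simp [hN])) natDegree_pow_le)
    have h₂ : (C t * D ^ 3).natDegree ≤ 0 + 3 * D.natDegree :=
      natDegree_mul_le.trans (add_le_add (by simp) natDegree_pow_le)
    refine (natDegree_add_le _ _).trans_lt (max_lt ?_ ?_) <;> omega
  have hJm : (N ^ 3 + C s * N * D ^ 2 + C t * D ^ 3).Monic := by
    rw [add_assoc]
    exact (hNm.pow 3).add_of_left (degree_lt_degree hK)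
  have hJd : (N ^ 3 + C s * N * D ^ 2 + C t * D ^ 3).natDegree = 3 * p := by
    rw [add_assoc, natDegree_add_eq_left_of_natDegree_lt hK, natDegree_pow, hN]
  have hh0 : h ≠ 0 := by
    intro h0
    rw [h0, zero_pow two_ne_zero] at hsq
    exact mul_ne_zero hc.ne_zero (mul_ne_zero hD0 hJm.ne_zero) hsq.symm
  have hhd : 2 * h.natDegree = 3 + (D.natDegree + 3 * p) := by
    have := congrArg natDegree hsq
    rwa [natDegree_pow, natDegree_mul hc.ne_zero (mul_ne_zero hD0 hJm.ne_zero),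
      natDegree_mul hD0 hJm.ne_zero, hJd, hc3] at this
  have hhl : h.leadingCoeff ^ 2 = D.leadingCoeff := by
    have := congrArg leadingCoeff hsq
    rwa [leadingCoeff_pow, leadingCoeff_mul, leadingCoeff_mul, hc.leadingCoeff, hJm.leadingCoeff,
      one_mul, mul_one] at this
  set w := derivative N * D - N * derivative D with hw
  have hwd : w.natDegree ≤ p + D.natDegree - 1 := by
    refine (natDegree_sub_le _ _).trans (max_le ?_ ?_)
    · refine natDegree_mul_le.trans ?_
      have := natDegree_derivative_le N
      omega
    · rcases Nat.eq_zero_or_pos D.natDegree with h0 | h0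
      · rw [eq_C_of_natDegree_eq_zero h0]; simp
      · refine natDegree_mul_le.trans ?_
        have := natDegree_derivative_le D
        omega
  have hCA : (C A * h).natDegree = h.natDegree := natDegree_C_mul hA
  have hle : h.natDegree ≤ (p + D.natDegree - 1) + 3 := by
    rw [← hCA, ← e]
    exact natDegree_mul_le.trans (by omega)
  have hDp : D.natDegree = 2 * m := by omega
  have hδm : δ.natDegree = m := by omega
  refine ⟨hδm, ?_⟩
  have hh : h.natDegree = 2 * p - 2 + 3 := by omega
  have hcoef := congrArg (fun q ↦ q.coeff (2 * p - 2 + 3)) e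
  simp only [coeff_C_mul] at hcoef
  rw [coeff_mul_add_eq_of_natDegree_le (by omega) hc3.le, ← hc3, hc.coeff_natDegree, mul_one,
    hc3, ← hh,
    coeff_natDegree, hw, coeff_sub, show 2 * p - 2 = (p - 1) + 2 * m by omega,
    coeff_mul_add_eq_of_natDegree_le ((natDegree_derivative_le N).trans (by omega)) hDp.le,
    coeff_derivative, show p - 1 + 2 * m = p + (2 * m - 1) by omega,
    coeff_mul_add_eq_of_natDegree_le hN.le ((natDegree_derivative_le D).trans (by omega)),
    coeff_derivative, show 2 * m - 1 + 1 = 2 * m by omega] at hcoef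
  -- In characteristic `p` the leading factor of `N'` is `p = 0` and that of `D'` is `p - 1 = -1`,
  -- so only the second term of the Wronskian contributes.
  have hcast₁ : ((p - 1 : ℕ) : F) + 1 = 0 := by
    rw [← Nat.cast_succ, Nat.succ_eq_add_one, Nat.sub_add_cancel hpp.out.one_le,
      CharP.cast_eq_zero]
  have hcast₂ : ((2 * m - 1 : ℕ) : F) + 1 = -1 := by
    have h₁ : ((2 * m - 1 + 1 + 1 : ℕ) : F) = 0 := by
      rw [show 2 * m - 1 + 1 + 1 = p by omega, CharP.cast_eq_zero]
    push_cast at h₁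
    linear_combination h₁
  have hNp : N.coeff p = 1 := by
    have := hNm.coeff_natDegree
    rwa [hN] at this
  rw [hcast₁, hcast₂, hNp] at hcoef
  have hDl : D.coeff (2 * m) = D.leadingCoeff := by rw [leadingCoeff, hDp]
  have hDδ : D.leadingCoeff = δ.coeff m ^ 2 := by
    rw [hD, leadingCoeff_pow, leadingCoeff, hδm]
  have hη : h.leadingCoeff ≠ 0 := leadingCoeff_ne_zero.mpr hh0
  rw [hDl, ← hhl] at hcoef
  have hAη : A = h.leadingCoeff := mul_right_cancel₀ hη (by linear_combination -hcoef)
  rw [← hDδ, ← hhl, hAη]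

end Hasse

end shortCurve

/-! ### The zeros of the Hasse invariant are simple -/

namespace shortCurve

open Polynomial

section Nodal

variable {F : Type*} [Field F] {p : ℕ} [hpp : Fact p.Prime] [CharP F p]

/-- In characteristic `p` one has `(X - r)^(p-1) = ∑ r^(p-1-i) X^i`, because `(X - r)^p = X^p -
r^p`. -/
lemma coeff_X_sub_C_pow_mul (r : F) {h : F[X]} (hh : h.natDegree < p) :
    ((X - C r) ^ (p - 1) * h).coeff (p - 1) = h.eval r := by
  have hgeom : (X - C r) ^ (p - 1) = ∑ i ∈ Finset.range p, X ^ i * (C r) ^ (p - 1 - i) := by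
    refine mul_right_cancel₀ (X_sub_C_ne_zero r) ?_
    rw [(Commute.all X (C r)).geom_sum₂_mul, ← sub_pow_char, ← pow_succ,
      Nat.sub_add_cancel hpp.out.one_le]
  have hcoeff : ∀ i < p, ((X - C r) ^ (p - 1)).coeff i = r ^ (p - 1 - i) := by
    intro i hi
    simp_rw [hgeom, finsetSum_coeff, ← C_pow, mul_comm (X ^ _), coeff_C_mul_X_pow]
    rw [Finset.sum_ite_eq, if_pos (Finset.mem_range.mpr hi)]
  rw [mul_comm, coeff_mul, Finset.Nat.sum_antidiagonal_eq_sum_range_succ_mk,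
    Nat.succ_eq_add_one, Nat.sub_add_cancel hpp.out.one_le, eval_eq_sum_range' hh]
  refine Finset.sum_congr rfl fun i hi ↦ ?_
  have hi := Finset.mem_range.mp hi
  rw [hcoeff _ (by omega), show p - 1 - (p - 1 - i) = i by omega]

/-- On a nodal cubic `f = (X - r)^2 (X + 2r)` with `r ≠ 0`, so `f^((p-1)/2)` contains the factor `(X
- r)^(p-1)` and the Hasse invariant is `(3r)^((p-1)/2)`. -/
lemma hasse_ne_zero_of_node (hp : 5 ≤ p) {s t : F} (hd : 4 * s ^ 3 + 27 * t ^ 2 = 0)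
    (h0 : ¬ (s = 0 ∧ t = 0)) : hasse s t p ≠ 0 := by
  have h2 : (2 : F) ≠ 0 := two_ne_zero_of_charP F (p := p) (by omega)
  have h3 : (3 : F) ≠ 0 := by
    intro h
    have : ((3 : ℕ) : F) = 0 := by exact_mod_cast h
    rw [CharP.cast_eq_zero_iff F p] at this
    exact absurd (Nat.le_of_dvd (by norm_num) this) (by omega)
  have hs : s ≠ 0 := by
    rintro rfl
    refine h0 ⟨rfl, ?_⟩
    have : (3 : F) ^ 3 * t ^ 2 = 0 := by linear_combination hd
    exact pow_eq_zero_iff two_ne_zero |>.mp ((mul_eq_zero.mp this).resolve_left (pow_ne_zero 3 h3))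
  obtain ⟨r, hr⟩ : ∃ r : F, 2 * s * r = -3 * t :=
    ⟨-3 * t / (2 * s), mul_div_cancel₀ _ (mul_ne_zero h2 hs)⟩
  have hs' : s = -3 * r ^ 2 := by
    have : (2 * s) ^ 2 * (s + 3 * r ^ 2) = 0 := by
      linear_combination s ^ 0 * hd + 3 * (2 * s * r - 3 * t) * hr
    have := (mul_eq_zero.mp this).resolve_left (pow_ne_zero 2 (mul_ne_zero h2 hs))
    linear_combination this
  have ht' : t = 2 * r ^ 3 := by
    have : 3 * (t - 2 * r ^ 3) = 0 := by linear_combination hr - 2 * r * hs'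
    have := (mul_eq_zero.mp this).resolve_left h3
    linear_combination this
  have hr0 : r ≠ 0 := by
    rintro rfl
    exact hs (by rw [hs']; ring)
  obtain ⟨m, hm⟩ := hpp.out.odd_of_ne_two (by omega)
  have hm' : (p - 1) / 2 = m := by omega
  have hfac : X ^ 3 + C s * X + C t = (X - C r) ^ 2 * (X + C (2 * r)) := by
    rw [hs', ht']
    simp only [map_mul, map_neg, map_pow, C_ofNat]
    ring
  have hdeg : ((X + C (2 * r)) ^ m).natDegree < p := by
    rw [natDegree_pow, natDegree_X_add_C]
    omega
  rw [hasse, hm', hfac, mul_pow, ← pow_mul, show 2 * m = p - 1 by omega,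
    coeff_X_sub_C_pow_mul r hdeg, eval_pow, eval_add, eval_X, eval_C]
  refine pow_ne_zero _ ?_
  rw [show r + 2 * r = 3 * r by ring]
  exact mul_ne_zero h3 hr0

end Nodal

section Derivation

variable {k A : Type*} [CommRing k] [CommRing A] [Algebra k A]

lemma exists_derivation_coeff (d : Derivation k A A) :
    ∃ D : Derivation k A[X] A[X], (∀ q i, (D q).coeff i = d (q.coeff i)) ∧ D X = 0 ∧
      ∀ a, D (C a) = C (d a) := by
  refine ⟨(PolynomialModule.equivPolynomialSelf (R := A)).toLinearMap.compDer d.mapCoeffs,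
    ?_, ?_, ?_⟩
  · intro q i
    rfl
  · ext i
    change d ((X : A[X]).coeff i) = 0
    rw [coeff_X]
    split_ifs <;> simp
  · intro a
    ext i
    change d ((C a : A[X]).coeff i) = _
    rw [coeff_C, coeff_C]
    split_ifs <;> simp

variable {p : ℕ} [hpp : Fact p.Prime] (s t : A)

/-- The second order differential equation of the Hasse invariant. -/
lemma hasse_differential_eq [CharP A p] (hp : 5 ≤ p) (δ : Derivation k A A) (hs : δ s = 9 * t)
    (ht : δ t = -2 * s ^ 2) : 8 * δ (δ (hasse s t p)) = 6 * s * hasse s t p := by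
  obtain ⟨D, hD, hX, hC⟩ := exists_derivation_coeff δ
  obtain ⟨m, hm⟩ : ∃ m, p = 2 * (m + 2) + 1 := by
    obtain ⟨m, hm⟩ := hpp.out.odd_of_ne_two (by omega)
    exact ⟨m - 2, by omega⟩
  -- The exponent `m + 2` is `(p - 1) / 2`; in characteristic `p` this is the relation that makes
  -- the differential equation hold.
  have hm0 : (2 : A[X]) * m + 5 = 0 := by
    have : ((2 * (m + 2) + 1 : ℕ) : A[X]) = 0 := by rw [← hm, CharP.cast_eq_zero]
    push_cast at this
    linear_combination this
  set f : A[X] := X ^ 3 + C s * X + C t with hf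
  have hfd : D f = 9 * C t * X - 2 * C s ^ 2 := by
    simp only [hf, map_add, Derivation.leibniz, Derivation.leibniz_pow, hX, hC, hs, ht, smul_eq_mul,
      map_mul, map_neg, map_pow, C_ofNat, nsmul_eq_mul]
    ring
  have hfdd : D (D f) = -18 * C s ^ 2 * X - 36 * C s * C t := by
    have h9 : D 9 = 0 := by exact_mod_cast D.map_natCast 9
    have h2 : D 2 = 0 := by exact_mod_cast D.map_natCast 2
    rw [hfd]
    simp only [map_sub, Derivation.leibniz, Derivation.leibniz_pow, hX, hC, hs, ht, smul_eq_mul,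
      map_mul, map_neg, map_pow, C_ofNat, nsmul_eq_mul, h9, h2]
    push_cast
    ring
  have hf' : derivative f = 3 * X ^ 2 + C s := by
    simp only [hf, derivative_add, derivative_mul, derivative_C, derivative_X_pow, derivative_X]
    push_cast
    simp only [map_ofNat]
    ring
  -- `g` is chosen to make `8 D²(f^(m+2)) - 6 s f^(m+2)` the exact derivative of `2 g f^(m+1)`. An
  -- exact derivative has no term in `X^(p-1)`, and that is where the Hasse invariant is read off.
  set g : A[X] := 6 * C s * X ^ 4 - 6 * C s ^ 2 * X ^ 2 - 12 * C s * C t * X -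
    (54 * C t ^ 2 + 8 * C s ^ 3) with hg
  have hg' : derivative g = 24 * C s * X ^ 3 - 12 * C s ^ 2 * X - 12 * C s * C t := by
    simp only [hg, derivative_sub, derivative_add, derivative_mul, derivative_C, derivative_ofNat,
      derivative_X, derivative_pow]
    push_cast
    simp only [C_ofNat]
    ring
  have key : 8 * D (D (f ^ (m + 2))) - 6 * C s * f ^ (m + 2) =
      2 * derivative (g * f ^ (m + 1)) := by
    have e₁ : D (f ^ (m + 2)) = (m + 2) * f ^ (m + 1) * D f := by
      rw [Derivation.leibniz_pow]
      simp only [smul_eq_mul, nsmul_eq_mul]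
      push_cast
      ring
    have hc : D ((m : A[X]) + 2) = 0 := by exact_mod_cast D.map_natCast (m + 2)
    have e₂ : D (D (f ^ (m + 2))) = (m + 2) * ((m + 1) * f ^ m * D f ^ 2 +
        f ^ (m + 1) * D (D f)) := by
      rw [e₁, Derivation.leibniz, Derivation.leibniz, Derivation.leibniz_pow, hc]
      simp only [smul_eq_mul, nsmul_eq_mul, Nat.add_sub_cancel]
      push_cast
      ring
    have e₃ : derivative (g * f ^ (m + 1)) = derivative g * f ^ (m + 1) +
        g * ((m + 1) * f ^ m * derivative f) := by
      rw [derivative_mul, derivative_pow]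
      simp
    rw [e₂, e₃, hfdd, hfd, hf', hg', hg]
    have hff : f ^ (m + 2) = f ^ m * f ^ 2 := pow_add _ _ _
    have hf1 : f ^ (m + 1) = f ^ m * f := pow_succ _ _
    rw [hff, hf1]
    generalize f ^ m = Φ at *
    generalize (m : A[X]) = M at *
    rw [hf]
    linear_combination Φ * ((4 * M + 2) * (9 * C t * X - 2 * C s ^ 2) ^ 2 +
      4 * f * (-18 * C s ^ 2 * X - 36 * C s * C t) - g * (3 * X ^ 2 + C s)) * hm0
  have := congrArg (fun q ↦ q.coeff (p - 1)) key
  simp only [coeff_sub, show (8 : A[X]) = C 8 from rfl,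
    show (6 : A[X]) * C s = C (6 * s) by rw [map_mul]; rfl,
    show (2 : A[X]) = C 2 from rfl, coeff_C_mul, hD, coeff_derivative] at this
  rw [← Nat.cast_succ, Nat.succ_eq_add_one, Nat.sub_add_cancel hpp.out.one_le, CharP.cast_eq_zero,
    mul_zero, mul_zero, sub_eq_zero] at this
  rwa [hasse, show (p - 1) / 2 = m + 2 by omega]

/-- Give `X, s, t` the weights `1, 2, 3`. The cubic is homogeneous of weight `3`, so the coefficient
of `X^(2m)` in its `m`-th power has weight `3m - 2m = m`, and `ε` is the Euler derivation. -/
lemma hasse_euler_eq (hp : p ≠ 2) (ε : Derivation k A A) (hs : ε s = 2 * s)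
    (ht : ε t = 3 * t) : ε (hasse s t p) = ((p - 1) / 2 : ℕ) * hasse s t p := by
  obtain ⟨D, hD, hX, hC⟩ := exists_derivation_coeff ε
  obtain ⟨m, hm⟩ := hpp.out.odd_of_ne_two hp
  rw [hasse, show (p - 1) / 2 = m by omega]
  set f : A[X] := X ^ 3 + C s * X + C t with hf
  have hfd : D f + X * derivative f = 3 * f := by
    simp only [hf, map_add, Derivation.leibniz, Derivation.leibniz_pow, hX, hC, hs, ht, smul_eq_mul,
      map_mul, C_ofNat, derivative_mul, derivative_C, derivative_X_pow,
      derivative_X]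
    push_cast
    simp only [map_ofNat]
    ring
  have key : D (f ^ m) + X * derivative (f ^ m) = ((3 * m : ℕ) : A[X]) * f ^ m := by
    rcases m with - | m
    · simp
    · rw [Derivation.leibniz_pow, derivative_pow]
      simp only [smul_eq_mul, nsmul_eq_mul, Nat.add_sub_cancel]
      simp only [map_natCast]
      push_cast
      linear_combination ((m : A[X]) + 1) * f ^ m * hfd
  have := congrArg (fun q ↦ q.coeff (p - 1)) key
  have h₂ : p - 1 = (p - 2) + 1 := by have := hpp.out.two_le; omega
  simp only [coeff_add] at this
  rw [← C_eq_natCast, coeff_C_mul, h₂, coeff_X_mul, coeff_derivative, ← Nat.cast_succ,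
    Nat.succ_eq_add_one, ← h₂, hD, show p - 1 = 2 * m by omega] at this
  push_cast at this
  rw [show p - 1 = 2 * m by omega]
  linear_combination this

end Derivation


section Generic

variable (K : Type*) [Field K] {p : ℕ}

open MvPolynomial in
lemma totalDegree_coeff_cubic_pow_le (m i : ℕ) :
    (((Polynomial.X ^ 3 + Polynomial.C (X 0) * Polynomial.X + Polynomial.C (X 1) :
      (MvPolynomial (Fin 2) K)[X]) ^ m).coeff i).totalDegree ≤ m := by
  induction m generalizing i with
  | zero =>
    rw [pow_zero, Polynomial.coeff_one]
    split_ifs <;> simp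
  | succ m ih =>
    rw [pow_succ, Polynomial.coeff_mul]
    refine totalDegree_finsetSum_le fun x _ ↦ (totalDegree_mul _ _).trans (add_le_add (ih _) ?_)
    simp only [Polynomial.coeff_add, Polynomial.coeff_X_pow, Polynomial.coeff_C_mul,
      Polynomial.coeff_X, Polynomial.coeff_C]
    refine (totalDegree_add _ _).trans (max_le ((totalDegree_add _ _).trans (max_le ?_ ?_)) ?_) <;>
    split_ifs <;> simp

open MvPolynomial in
lemma totalDegree_pderiv_lt {σ : Type*} {f : MvPolynomial σ K} {i : σ} (h : pderiv i f ≠ 0) :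
    (pderiv i f).totalDegree < f.totalDegree := by
  classical
  obtain ⟨m, hm, he⟩ := Finset.exists_mem_eq_sup _ (support_nonempty.mpr h)
    (fun s : σ →₀ ℕ ↦ s.sum fun _ e ↦ e)
  rw [totalDegree, he]
  rw [MvPolynomial.mem_support_iff, coeff_pderiv] at hm
  have := le_totalDegree (MvPolynomial.mem_support_iff.mpr (left_ne_zero_of_mul hm))
  rw [Finsupp.sum_add_index' (by simp) (by simp)] at this
  simp only [Finsupp.sum_single_index] at this
  exact this

open MvPolynomial in
lemma totalDegree_eq_zero_of_pderiv_eq_zero [CharP K p] {σ : Type*} {f : MvPolynomial σ K}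
    (hf : f.totalDegree < p) (h : ∀ i, pderiv i f = 0) : f.totalDegree = 0 := by
  classical
  rw [totalDegree_eq_zero_iff_eq_C]
  ext m
  rw [MvPolynomial.coeff_C]
  split_ifs with h0
  · rw [h0]
  · by_contra hm
    obtain ⟨i, hi⟩ : ∃ i, m i ≠ 0 := by
      by_contra! hi
      exact h0 (Finsupp.ext hi).symm
    have hc := coeff_pderiv (i := i) f (m - Finsupp.single i 1)
    have he : m - Finsupp.single i 1 + Finsupp.single i 1 = m :=
      tsub_add_cancel_of_le (Finsupp.single_le_iff.mpr (Nat.one_le_iff_ne_zero.mpr hi))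
    rw [h, MvPolynomial.coeff_zero, he, eq_comm, ← Nat.cast_succ, ← Nat.add_one, Finsupp.tsub_apply,
      Finsupp.single_eq_same, Nat.sub_add_cancel (Nat.one_le_iff_ne_zero.mpr hi)] at hc
    have hc := (mul_eq_zero.mp hc).resolve_left hm
    rw [CharP.cast_eq_zero_iff K p] at hc
    have h₁ := Nat.le_of_dvd (Nat.pos_of_ne_zero hi) hc
    have h₂ := le_totalDegree (MvPolynomial.mem_support_iff.mpr hm)
    have h₃ : m i ≤ m.sum fun _ e ↦ e :=
      Finset.single_le_sum (f := fun j ↦ m j) (fun _ _ ↦ Nat.zero_le _)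
        (Finsupp.mem_support_iff.mpr hi)
    omega

lemma isUnit_of_totalDegree_eq_zero {σ : Type*} {f : MvPolynomial σ K} (hf : f ≠ 0)
    (h : f.totalDegree = 0) : IsUnit f := by
  rw [MvPolynomial.totalDegree_eq_zero_iff_eq_C] at h
  rw [h]
  refine (isUnit_iff_ne_zero.mpr fun hc ↦ hf ?_).map MvPolynomial.C
  rw [h, hc, map_zero]

lemma totalDegree_ne_zero_of_prime {σ : Type*} {f : MvPolynomial σ K} (hf : Prime f) :
    f.totalDegree ≠ 0 :=
  fun h ↦ hf.not_isUnit (isUnit_of_totalDegree_eq_zero K hf.ne_zero h)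

local notation "𝐬" => (MvPolynomial.X 0 : MvPolynomial (Fin 2) K)
local notation "𝐭" => (MvPolynomial.X 1 : MvPolynomial (Fin 2) K)

lemma totalDegree_hasse_le (p : ℕ) : (hasse 𝐬 𝐭 p).totalDegree ≤ (p - 1) / 2 :=
  totalDegree_coeff_cubic_pow_le K _ _

variable [hpp : Fact p.Prime]

include hpp in
-- The specialization `s = -3`, `t = 2` is a nodal cubic.
lemma generic_hasse_ne_zero [CharP K p] (hp : 5 ≤ p) : hasse 𝐬 𝐭 p ≠ 0 := by
  intro h
  have h' := map_hasse 𝐬 𝐭 (MvPolynomial.eval ![-3, 2]) p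
  rw [h, map_zero] at h'
  refine hasse_ne_zero_of_node (F := K) (s := -3) (t := 2) hp (by norm_num) ?_
    (by simpa using h'.symm)
  rintro ⟨-, h⟩
  exact two_ne_zero_of_charP K (p := p) (by omega) h

include hpp in
-- At the cusp `s = t = 0` the cubic is `X^3`, whose powers have no term in `X^(p-1)` at this
-- exponent. The Hasse invariant therefore vanishes there.
lemma not_isUnit_generic_hasse (hp : 5 ≤ p) : ¬ IsUnit (hasse 𝐬 𝐭 p) := by
  intro h
  have h' := (h.map (MvPolynomial.eval (![0, 0] : Fin 2 → K))).ne_zero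
  rw [map_hasse] at h'
  refine h' ?_
  obtain ⟨m, hm⟩ := hpp.out.odd_of_ne_two (by omega)
  simp only [hasse, MvPolynomial.eval_X, Matrix.cons_val_zero, Matrix.cons_val_one, map_zero,
    zero_mul, add_zero, ← pow_mul, coeff_X_pow]
  exact if_neg (by omega)

include hpp in
-- Over the fraction field of `K[s, t] / (π)` the curve would be singular with Hasse invariant zero.
-- It cannot be nodal, so `s` and `t` would both vanish modulo `π`, which no prime of `K[s, t]`
-- allows.
lemma not_dvd_disc_of_dvd_hasse [CharP K p] (hp : 5 ≤ p) {π : MvPolynomial (Fin 2) K} (hπ : Prime π)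
    (h : π ∣ hasse 𝐬 𝐭 p) : ¬ π ∣ 4 * 𝐬 ^ 3 + 27 * 𝐭 ^ 2 := by
  intro hd
  have : (Ideal.span {π}).IsPrime := (Ideal.span_singleton_prime hπ.ne_zero).mpr hπ
  let k := FractionRing (MvPolynomial (Fin 2) K ⧸ Ideal.span {π})
  let ι : MvPolynomial (Fin 2) K →+* k :=
    (algebraMap (MvPolynomial (Fin 2) K ⧸ Ideal.span {π}) k).comp (Ideal.Quotient.mk _)
  have hι : ∀ a, ι a = 0 ↔ π ∣ a := by
    intro a
    rw [RingHom.comp_apply, map_eq_zero_iff _ (IsFractionRing.injective _ k),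
      Ideal.Quotient.eq_zero_iff_dvd]
  have : CharP k p := charP_of_injective_ringHom (f := ι.comp MvPolynomial.C)
    (RingHom.injective _) p
  refine hasse_ne_zero_of_node (s := ι 𝐬) (t := ι 𝐭) hp ?_ ?_ ?_
  · rw [← hι] at hd
    simpa only [map_add, map_mul, map_pow, map_ofNat] using hd
  · rintro ⟨hs, ht⟩
    rw [hι] at hs ht
    obtain ⟨q, hq⟩ := hs
    have hs0 : 𝐬 ≠ 0 := MvPolynomial.X_ne_zero 0
    have hq0 : q ≠ 0 := by rintro rfl; exact hs0 (by rw [hq, mul_zero])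
    have hdeg := congrArg MvPolynomial.totalDegree hq
    rw [MvPolynomial.totalDegree_mul_of_isDomain hπ.ne_zero hq0, MvPolynomial.totalDegree_X] at hdeg
    have hπd := totalDegree_ne_zero_of_prime K hπ
    have hu : IsUnit q := isUnit_of_totalDegree_eq_zero K hq0 (by omega)
    obtain ⟨r, hr⟩ : 𝐬 ∣ 𝐭 := hq ▸ (IsUnit.mul_right_dvd hu).mpr ht
    have := congrArg (MvPolynomial.eval ![0, 1]) hr
    simp at this
  · rwa [← map_hasse, hι]

include hpp in
-- Igusa's argument. If `A = π^k B` with `k ≥ 2` and `π ∤ B`, the Euler equation gives `π ∣ ε π`,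
-- and the second order equation gives `π ∣ δ π` through its term `k(k - 1) π^(k-2) (δ π)^2 B`. Away
-- from the discriminant `ε` and `δ` span all derivations, so `π` divides its own partial
-- derivatives. These must vanish for reasons of degree, and a nonconstant polynomial of degree
-- below `p` cannot have all partial derivatives zero.
lemma not_sq_dvd_generic_hasse [CharP K p] (hp : 5 ≤ p) {π : MvPolynomial (Fin 2) K}
    (hπ : Prime π) (h : π ∣ hasse 𝐬 𝐭 p) : ¬ π ^ 2 ∣ hasse 𝐬 𝐭 p := by
  intro h2
  have hA0 := generic_hasse_ne_zero K hp
  have hA := totalDegree_hasse_le K p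
  have hΔ := not_dvd_disc_of_dvd_hasse K hp hπ h
  let δ : Derivation K (MvPolynomial (Fin 2) K) (MvPolynomial (Fin 2) K) :=
    MvPolynomial.mkDerivation K ![9 * 𝐭, -2 * 𝐬 ^ 2]
  let ε : Derivation K (MvPolynomial (Fin 2) K) (MvPolynomial (Fin 2) K) :=
    MvPolynomial.mkDerivation K ![2 * 𝐬, 3 * 𝐭]
  have hδ := hasse_differential_eq (p := p) 𝐬 𝐭 hp δ (by simp [δ]) (by simp [δ])
  have hε := hasse_euler_eq (p := p) 𝐬 𝐭 (by omega) ε (by simp [ε]) (by simp [ε])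
  set A := hasse 𝐬 𝐭 p
  obtain ⟨k, B, hB, hk⟩ : ∃ k B, ¬ π ∣ B ∧ A = π ^ k * B := by
    obtain ⟨k, B, hB, hk⟩ := WfDvdMonoid.max_power_factor hA0 hπ.irreducible
    exact ⟨k, B, hB, hk⟩
  have hB0 : B ≠ 0 := by rintro rfl; exact hB (dvd_zero _)
  obtain ⟨k, rfl⟩ : ∃ j, k = j + 2 := by
    refine ⟨k - 2, ?_⟩
    by_contra hlt
    have hlt : k < 2 := by omega
    obtain ⟨j, hj⟩ : ∃ j, 2 = k + (j + 1) := ⟨1 - k, by omega⟩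
    have h2 : π ^ (k + (j + 1)) ∣ π ^ k * B := hj ▸ hk ▸ h2
    rw [pow_add] at h2
    have := (mul_dvd_mul_iff_left (pow_ne_zero k hπ.ne_zero)).mp h2
    exact hB ((dvd_pow_self π j.succ_ne_zero).trans this)
  have hdeg : A.totalDegree = (k + 2) * π.totalDegree + B.totalDegree := by
    rw [hk, MvPolynomial.totalDegree_mul_of_isDomain (pow_ne_zero _ hπ.ne_zero) hB0]
    congr 1
    generalize k + 2 = j
    induction j with
    | zero => simp
    | succ j ih =>
      rw [pow_succ, MvPolynomial.totalDegree_mul_of_isDomain (pow_ne_zero _ hπ.ne_zero) hπ.ne_zero,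
        ih, add_mul, one_mul]
  have hπd := totalDegree_ne_zero_of_prime K hπ
  have hπp : π.totalDegree < p := by nlinarith [Nat.div_le_self (p - 1) 2, Nat.sub_le p 1]
  have hkp : k + 2 < p := by
    have : (k + 2) * 1 ≤ (k + 2) * π.totalDegree :=
      Nat.mul_le_mul_left _ (Nat.one_le_iff_ne_zero.mpr hπd)
    omega
  have hcast : ∀ j : ℕ, j ≠ 0 → j < p → IsUnit (j : MvPolynomial (Fin 2) K) := by
    intro j hj hjp
    have : (j : K) ≠ 0 := by
      rw [Ne, CharP.cast_eq_zero_iff K p]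
      exact fun h ↦ absurd (Nat.le_of_dvd (Nat.pos_of_ne_zero hj) h) (by omega)
    simpa using (isUnit_iff_ne_zero.mpr this).map (MvPolynomial.C (σ := Fin 2))
  have hpε : π ∣ ε π := by
    rw [hk, Derivation.leibniz, Derivation.leibniz_pow] at hε
    simp only [smul_eq_mul, nsmul_eq_mul, show k + 2 - 1 = k + 1 by omega] at hε
    have e : π ^ (k + 1) * ((k + 2 : ℕ) * ε π * B) =
        π ^ (k + 1) * (π * (((p - 1) / 2 : ℕ) * B - ε B)) := by
      linear_combination hε
    have := mul_left_cancel₀ (pow_ne_zero _ hπ.ne_zero) e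
    have := (hπ.dvd_or_dvd (Dvd.intro _ this.symm)).resolve_right hB
    exact (hcast (k + 2) (by omega) hkp).dvd_mul_left.mp this
  have hpδ : π ∣ δ π := by
    have hc : δ ((k + 2 : ℕ) : MvPolynomial (Fin 2) K) = 0 := δ.map_natCast _
    have e₁ : δ A = π ^ k * (π * ((k + 2 : ℕ) * δ π * B + π * δ B)) := by
      rw [hk, Derivation.leibniz, Derivation.leibniz_pow]
      simp only [smul_eq_mul, nsmul_eq_mul, show k + 2 - 1 = k + 1 by omega]
      ring
    have e₂ : δ (δ A) = π ^ k * ((k + 2 : ℕ) * (k + 1 : ℕ) * δ π ^ 2 * B + π * ((k + 2 : ℕ) *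
        (δ (δ π) * B + 2 * δ π * δ B) + π * δ (δ B))) := by
      have e₁' : δ A = π ^ (k + 1) * ((k + 2 : ℕ) * δ π * B + π * δ B) := by rw [e₁]; ring
      rw [e₁', Derivation.leibniz, Derivation.leibniz_pow]
      simp only [smul_eq_mul, nsmul_eq_mul, Nat.add_sub_cancel, map_add, Derivation.leibniz, hc]
      push_cast
      ring
    rw [e₂, hk] at hδ
    have e : π ^ k * ((8 * (k + 2 : ℕ) * (k + 1 : ℕ)) * δ π ^ 2 * B) = π ^ k * (π * (6 * 𝐬 * π * B -
        8 * ((k + 2 : ℕ) * (δ (δ π) * B + 2 * δ π * δ B) + π * δ (δ B)))) := by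
      linear_combination hδ
    have := mul_left_cancel₀ (pow_ne_zero _ hπ.ne_zero) e
    have := (hπ.dvd_or_dvd (Dvd.intro _ this.symm)).resolve_right hB
    have h8 : IsUnit (8 : MvPolynomial (Fin 2) K) := by
      have := (hcast 2 (by omega) (by omega)).pow 3
      norm_num at this
      exact this
    rw [((h8.mul (hcast (k + 2) (by omega) hkp)).mul
      (hcast (k + 1) (by omega) (by omega))).dvd_mul_left] at this
    exact hπ.dvd_of_dvd_pow this
  have hder : ∀ D : Derivation K (MvPolynomial (Fin 2) K) (MvPolynomial (Fin 2) K),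
      D π = D 𝐬 * MvPolynomial.pderiv 0 π + D 𝐭 * MvPolynomial.pderiv 1 π := by
    intro D
    have : D = D 𝐬 • MvPolynomial.pderiv 0 + D 𝐭 • MvPolynomial.pderiv 1 := by
      apply MvPolynomial.derivation_ext
      intro i
      fin_cases i <;> simp [MvPolynomial.pderiv_X]
    conv_lhs => rw [this]
    rfl
  have h₁ := hder ε
  have h₂ := hder δ
  simp only [ε, δ, MvPolynomial.mkDerivation_X, Matrix.cons_val_zero, Matrix.cons_val_one]
    at h₁ h₂
  change ε π = _ at h₁
  change δ π = _ at h₂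
  have hsmall : ∀ i, π ∣ MvPolynomial.pderiv i π → MvPolynomial.pderiv i π = 0 := by
    intro i hi
    by_contra hne
    have := totalDegree_pderiv_lt K hne
    obtain ⟨q, hq⟩ := hi
    have hq0 : q ≠ 0 := by rintro rfl; exact hne (by rw [hq, mul_zero])
    rw [hq, MvPolynomial.totalDegree_mul_of_isDomain hπ.ne_zero hq0] at this
    omega
  refine hπd (totalDegree_eq_zero_of_pderiv_eq_zero K hπp fun i ↦ hsmall i ?_)
  -- The coefficient matrix of `ε` and `δ` has determinant `-(4s^3 + 27t^2)`. Cramer's rule writes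
  -- this discriminant times each partial derivative as a combination of `ε π` and `δ π`.
  refine (hπ.dvd_or_dvd (?_ : π ∣ (4 * 𝐬 ^ 3 + 27 * 𝐭 ^ 2) * _)).resolve_left hΔ
  fin_cases i
  · have : (4 * 𝐬 ^ 3 + 27 * 𝐭 ^ 2) * MvPolynomial.pderiv 0 π = 2 * 𝐬 ^ 2 * ε π + 3 * 𝐭 * δ π := by
      rw [h₁, h₂]; ring
    exact this ▸ dvd_add (hpε.mul_left _) (hpδ.mul_left _)
  · have : (4 * 𝐬 ^ 3 + 27 * 𝐭 ^ 2) * MvPolynomial.pderiv 1 π = 9 * 𝐭 * ε π + -(2 * 𝐬) * δ π := by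
      rw [h₁, h₂]; ring
    exact this ▸ dvd_add (hpε.mul_left _) (hpδ.mul_left _)

include hpp in
lemma generic_disc_ne_zero [CharP K p] (hp : p ≠ 2) : 4 * 𝐬 ^ 3 + 27 * 𝐭 ^ 2 ≠ 0 := by
  intro h
  have := congrArg (MvPolynomial.eval ![1, 0]) h
  simp only [map_add, map_mul, map_pow, MvPolynomial.eval_X, map_ofNat, map_zero,
    Matrix.cons_val_zero, Matrix.cons_val_one] at this
  refine pow_ne_zero 2 (two_ne_zero_of_charP K hp) ?_
  linear_combination this

/-- The multiplication by `p` polynomials are of Eisenstein type at a prime of `K[s, t]`. -/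
lemma exists_prime_dvd_coeff_verDen [CharP K p] (hp : 5 ≤ p) :
    ∃ π : MvPolynomial (Fin 2) K, Prime π ∧ (verDen 𝐬 𝐭 p).natDegree = (p - 1) / 2 ∧
      (∀ i ≠ 0, π ∣ (verDen 𝐬 𝐭 p).coeff i) ∧ ¬ π ∣ (verDen 𝐬 𝐭 p).coeff 0 ∧
      ¬ π ^ 2 ∣ (verDen 𝐬 𝐭 p).coeff ((p - 1) / 2) := by
  have hp2 : p ≠ 2 := by omega
  have hA0 := generic_hasse_ne_zero K hp
  obtain ⟨π, hirr, hdvd⟩ := WfDvdMonoid.exists_irreducible_factor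
    (not_isUnit_generic_hasse K hp) hA0
  have hπ := hirr.prime
  have hp0 := hpp.out.ne_zero
  refine ⟨π, hπ, ?_⟩
  let L := FractionRing (MvPolynomial (Fin 2) K)
  let κ : MvPolynomial (Fin 2) K →+* L := algebraMap _ _
  have hκ : Function.Injective κ := IsFractionRing.injective _ _
  have : CharP L p := charP_of_injective_ringHom (f := κ.comp MvPolynomial.C)
    (RingHom.injective _) p
  have hdL : 4 * κ 𝐬 ^ 3 + 27 * κ 𝐭 ^ 2 ≠ 0 := by
    intro h
    refine generic_disc_ne_zero K hp2 (hκ ?_)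
    simpa only [map_add, map_mul, map_pow, map_ofNat, map_zero] using h
  have hAL : hasse (κ 𝐬) (κ 𝐭) p ≠ 0 := by
    rw [← map_hasse]
    exact (map_ne_zero_iff _ hκ).mpr hA0
  obtain ⟨h₁, h₂⟩ := verDen_of_hasse_ne_zero hp2 hdL hAL
  rw [← map_verDen _ _ _ hp0, natDegree_map_eq_of_injective hκ] at h₁
  rw [← map_verDen _ _ _ hp0, coeff_map, ← map_hasse, ← map_pow, ← map_pow] at h₂
  have h₂ := hκ h₂
  have : (Ideal.span {π}).IsPrime := (Ideal.span_singleton_prime hπ.ne_zero).mpr hπ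
  let k := FractionRing (MvPolynomial (Fin 2) K ⧸ Ideal.span {π})
  let ι : MvPolynomial (Fin 2) K →+* k :=
    (algebraMap (MvPolynomial (Fin 2) K ⧸ Ideal.span {π}) k).comp (Ideal.Quotient.mk _)
  have hι : ∀ a, ι a = 0 ↔ π ∣ a := by
    intro a
    rw [RingHom.comp_apply, map_eq_zero_iff _ (IsFractionRing.injective _ k),
      Ideal.Quotient.eq_zero_iff_dvd]
  have : CharP k p := charP_of_injective_ringHom (f := ι.comp MvPolynomial.C)
    (RingHom.injective _) p
  have hdk : 4 * ι 𝐬 ^ 3 + 27 * ι 𝐭 ^ 2 ≠ 0 := by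
    intro h
    refine not_dvd_disc_of_dvd_hasse K hp hπ hdvd ?_
    rw [← hι]
    simpa only [map_add, map_mul, map_pow, map_ofNat] using h
  -- Modulo `π` the curve is nonsingular with Hasse invariant zero, so `verDen` reduces to a nonzero
  -- constant.
  obtain ⟨c, hc, hcD⟩ := exists_verDen_eq_C hp2 hdk (by rwa [← map_hasse, hι])
  rw [← map_verDen _ _ _ hp0] at hcD
  refine ⟨h₁, fun i hi ↦ ?_, fun h ↦ ?_, fun h ↦ ?_⟩
  · rw [← hι, ← coeff_map, hcD, coeff_C, if_neg hi]
  · rw [← hι, ← coeff_map, hcD, coeff_C, if_pos rfl] at h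
    exact hc h
  · refine not_sq_dvd_generic_hasse K hp hπ hdvd ?_
    rcases sq_eq_sq_iff_eq_or_eq_neg.mp h₂ with e | e
    · rwa [← e]
    · rwa [e, dvd_neg] at h

end Generic

end shortCurve

/-! ### Valuations above a prime element, and ramification -/

namespace shortCurve

open Polynomial

section Valuation

variable {R Ω Γ : Type*} [CommRing R] [Field Ω] [Algebra R Ω] [LinearOrderedCommGroupWithZero Γ]

/-- The restriction to `R` of the valuation `v` on an extension of the fraction field of `R` is
equivalent to the valuation of the prime element `π`. -/
structure LiesOver (v : Valuation Ω Γ) (π : R) : Prop where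
  le_one : ∀ r : R, v (algebraMap R Ω r) ≤ 1
  lt_one : v (algebraMap R Ω π) < 1
  eq_one : ∀ r : R, ¬ π ∣ r → v (algebraMap R Ω r) = 1

/-- By Chevalley's extension theorem the localization at `(π)` is dominated by a valuation ring of
`Ω`. Its value group may be arbitrary: only the relations to `v(π)` matter later. -/
lemma exists_liesOver [IsDomain R] [FaithfulSMul R Ω] {π : R} (hπ : Prime π) :
    ∃ V : ValuationSubring Ω, LiesOver V.valuation π := by
  have : (Ideal.span {π}).IsPrime := (Ideal.span_singleton_prime hπ.ne_zero).mpr hπ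
  set P := Ideal.span {π} with hP
  have hmem : ∀ r, r ∈ P ↔ π ∣ r := fun r ↦ Ideal.mem_span_singleton
  have hinj : Function.Injective (algebraMap R Ω) := FaithfulSMul.algebraMap_injective R Ω
  have hu : ∀ u : P.primeCompl, IsUnit (algebraMap R Ω u) := by
    intro u
    refine isUnit_iff_ne_zero.mpr fun h ↦ u.2 ?_
    rw [(map_eq_zero_iff _ hinj).mp h]
    exact P.zero_mem
  let f : Localization.AtPrime P →+* Ω := IsLocalization.lift hu
  have hf : ∀ r, f (algebraMap R _ r) = algebraMap R Ω r := IsLocalization.lift_eq hu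
  have hfinj : Function.Injective f :=
    (IsLocalization.lift_injective_iff hu).mpr fun x y ↦
      ⟨fun h ↦ by simpa [hf] using congrArg f h, fun h ↦ by rw [hinj h]⟩
  let I : Ideal f.range := Ideal.span {f.rangeRestrict (algebraMap R _ π)}
  have hI : I ≠ ⊤ := by
    rw [Ne, Ideal.span_singleton_eq_top, isUnit_iff_exists_inv]
    rintro ⟨⟨_, b, rfl⟩, hb⟩
    have hb : algebraMap R (Localization.AtPrime P) π * b = 1 := hfinj (by
      rw [map_mul, map_one]
      exact congrArg Subtype.val hb)
    exact (IsLocalization.AtPrime.isUnit_to_map_iff _ P π).mp (IsUnit.of_mul_eq_one _ hb)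
      ((hmem π).mpr dvd_rfl)
  obtain ⟨V, hV, hVI⟩ := Ideal.image_subset_nonunits_valuationSubring I hI
  have hle : ∀ x, V.valuation (f x) ≤ 1 := fun x ↦
    (V.valuation_le_one_iff _).mpr (hV ⟨x, rfl⟩)
  refine ⟨V, fun r ↦ hf r ▸ hle _, ?_, fun r hr ↦ ?_⟩
  · rw [← hf]
    exact V.mem_nonunits_iff.mp
      (hVI ⟨_, Ideal.subset_span (Set.mem_singleton _), rfl⟩)
  · have hr' : IsUnit (algebraMap R (Localization.AtPrime P) r) :=
      (IsLocalization.AtPrime.isUnit_to_map_iff _ P r).mpr fun h ↦ hr ((hmem r).mp h)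
    obtain ⟨b, hb⟩ := isUnit_iff_exists_inv.mp hr'
    refine le_antisymm (hf r ▸ hle _) ?_
    have h₁ : V.valuation (algebraMap R Ω r) * V.valuation (f b) = 1 := by
      rw [← map_mul, ← hf, ← map_mul, hb, map_one, map_one]
    calc 1 = V.valuation (algebraMap R Ω r) * V.valuation (f b) := h₁.symm
      _ ≤ V.valuation (algebraMap R Ω r) * 1 := by gcongr; exact hle b
      _ = _ := mul_one _

/-- A sum of elements with distinct nonzero valuations does not vanish. -/
lemma sum_ne_zero_of_injOn_valuation (v : Valuation Ω Γ) {ι : Type*} {s : Finset ι} {a : ι → Ω}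
    (hs : s.Nonempty) (ha : ∀ i ∈ s, a i ≠ 0) (hv : Set.InjOn (fun i ↦ v (a i)) s) :
    ∑ i ∈ s, a i ≠ 0 := by
  classical
  obtain ⟨j, hj, hmax⟩ := s.exists_max_image (fun i ↦ v (a i)) hs
  intro h
  have := v.map_sum_eq_of_lt (f := a) hj fun i hi ↦ by
    rw [Finset.mem_sdiff, Finset.mem_singleton] at hi
    exact lt_of_le_of_ne (hmax i hi.1) fun e ↦ hi.2 (hv hi.1 hj e)
  rw [h, map_zero] at this
  exact ha j hj (v.zero_iff.mp this.symm)

variable {v : Valuation Ω Γ} {π : R}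

namespace LiesOver

lemma le_of_dvd (h : LiesOver v π) {r : R} (hr : π ∣ r) :
    v (algebraMap R Ω r) ≤ v (algebraMap R Ω π) := by
  obtain ⟨q, rfl⟩ := hr
  rw [map_mul, map_mul]
  exact mul_le_of_le_one_right' (h.le_one q)

lemma eq_of_dvd_of_not_sq_dvd (h : LiesOver v π) {r : R} (hr : π ∣ r) (hr2 : ¬ π ^ 2 ∣ r) :
    v (algebraMap R Ω r) = v (algebraMap R Ω π) := by
  obtain ⟨q, rfl⟩ := hr
  rw [map_mul, map_mul, h.eq_one q, mul_one]
  intro hq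
  exact hr2 (by rw [pow_two]; exact mul_dvd_mul_left π hq)

lemma aeval_le_one (h : LiesOver v π) (f : R[X]) {x : Ω} (hx : v x ≤ 1) : v (aeval x f) ≤ 1 := by
  rw [aeval_eq_sum_range]
  refine v.map_sum_le fun i _ ↦ ?_
  rw [Algebra.smul_def, map_mul, map_pow]
  exact mul_le_one' (h.le_one _) (pow_le_one' hx i)

lemma aeval_monic (h : LiesOver v π) {f : R[X]} (hf : f.Monic) {x : Ω} (hx : 1 < v x) :
    v (aeval x f) = v x ^ f.natDegree := by
  classical
  rw [aeval_eq_sum_range]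
  have hj : f.natDegree ∈ Finset.range (f.natDegree + 1) := Finset.self_mem_range_succ _
  have e : f.coeff f.natDegree • x ^ f.natDegree = x ^ f.natDegree := by
    rw [hf.coeff_natDegree, one_smul]
  rw [v.map_sum_eq_of_lt hj, e, map_pow]
  · intro i hi
    rw [Finset.mem_sdiff, Finset.mem_singleton, Finset.mem_range] at hi
    rw [e, Algebra.smul_def, map_mul, map_pow, map_pow]
    calc _ ≤ 1 * v x ^ i := by gcongr; exact h.le_one _
      _ = v x ^ i := one_mul _
      _ < _ := pow_lt_pow_right₀ hx (by omega)

/-- Evaluation of a polynomial whose reduction is a nonzero constant. -/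
lemma aeval_eq_one (h : LiesOver v π) {f : R[X]} (hf : ∀ i ≠ 0, π ∣ f.coeff i)
    (h0 : ¬ π ∣ f.coeff 0) {x : Ω}
    (hx : v (algebraMap R Ω π) * v x ^ f.natDegree < 1) : v (aeval x f) = 1 := by
  classical
  rw [aeval_eq_sum_range]
  have e : v (f.coeff 0 • x ^ 0) = 1 := by
    rw [pow_zero, Algebra.smul_def, mul_one, h.eq_one _ h0]
  rw [v.map_sum_eq_of_lt (j := 0) (by simp), e]
  · intro i hi
    rw [Finset.mem_sdiff, Finset.mem_singleton, Finset.mem_range] at hi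
    rw [e, Algebra.smul_def, map_mul, map_pow]
    refine (mul_le_mul_left (h.le_of_dvd (hf i hi.2)) _).trans_lt ?_
    rcases le_total (v x) 1 with hx1 | hx1
    · exact (mul_le_of_le_one_right' (pow_le_one' hx1 i)).trans_lt h.lt_one
    · exact lt_of_le_of_lt (mul_le_mul_right (pow_le_pow_right₀ hx1 (by omega)) _) hx

lemma aeval_le (h : LiesOver v π) {f : R[X]} (hf : ∀ i ≠ 0, π ∣ f.coeff i) {x : Ω}
    (hx : 1 ≤ v (algebraMap R Ω π) * v x ^ f.natDegree) :
    v (aeval x f) ≤ v (algebraMap R Ω π) * v x ^ f.natDegree := by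
  have hx1 : 1 ≤ v x := by
    by_contra! hlt
    exact absurd hx (not_le.mpr ((mul_le_of_le_one_right' (pow_le_one' hlt.le _)).trans_lt
      h.lt_one))
  rw [aeval_eq_sum_range]
  refine v.map_sum_le fun i hi ↦ ?_
  rw [Finset.mem_range] at hi
  rw [Algebra.smul_def, map_mul, map_pow]
  rcases eq_or_ne i 0 with rfl | hi0
  · rw [pow_zero, mul_one]
    exact (h.le_one _).trans hx
  · refine mul_le_mul' (h.le_of_dvd (hf i hi0)) ?_
    exact pow_le_pow_right₀ hx1 (by omega)

/-- The valuation of a root of an Eisenstein polynomial. -/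
lemma mul_pow_eq_one_of_aeval_eq_zero (h : LiesOver v π) {f : R[X]}
    (hf : ∀ i ≠ 0, π ∣ f.coeff i) (h0 : ¬ π ∣ f.coeff 0) (hd : ¬ π ^ 2 ∣ f.coeff f.natDegree)
    (hdeg : f.natDegree ≠ 0) {x : Ω} (hx : aeval x f = 0) :
    v (algebraMap R Ω π) * v x ^ f.natDegree = 1 := by
  classical
  rcases lt_trichotomy (v (algebraMap R Ω π) * v x ^ f.natDegree) 1 with hlt | heq | hgt
  · have := h.aeval_eq_one hf h0 hlt
    rw [hx, map_zero] at this
    exact absurd this zero_ne_one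
  · exact heq
  · have e : v (f.coeff f.natDegree • x ^ f.natDegree) =
        v (algebraMap R Ω π) * v x ^ f.natDegree := by
      rw [Algebra.smul_def, map_mul, map_pow, h.eq_of_dvd_of_not_sq_dvd (hf _ hdeg) hd]
    have hx1 : 1 < v x := by
      by_contra! hle
      exact absurd hgt (not_lt.mpr ((mul_le_of_le_one_right' (pow_le_one' hle _)).trans
        h.lt_one.le))
    have hπ0 : 0 < v (algebraMap R Ω π) := by
      rw [zero_lt_iff]
      intro h0
      rw [h0, zero_mul] at hgt
      exact absurd hgt (by simp)
    have := v.map_sum_eq_of_lt (f := fun i ↦ f.coeff i • x ^ i)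
      (Finset.self_mem_range_succ f.natDegree) fun i hi ↦ by
        rw [Finset.mem_sdiff, Finset.mem_singleton, Finset.mem_range] at hi
        rw [e, Algebra.smul_def, map_mul, map_pow]
        rcases eq_or_ne i 0 with rfl | hi0
        · rw [pow_zero, mul_one]
          exact (h.le_one _).trans_lt hgt
        · refine (mul_le_mul_left (h.le_of_dvd (hf i hi0)) _).trans_lt ?_
          exact mul_lt_mul_of_pos_left (pow_lt_pow_right₀ hx1 (by omega)) hπ0
    rw [← aeval_eq_sum_range, hx, map_zero, e] at this
    exact absurd hgt (by rw [← this]; simp)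

section FractionField

variable {F : Type*} [Field F] [Algebra R F] [IsFractionRing R F] [Algebra F Ω]
  [IsScalarTower R F Ω]

lemma valuation_ne_zero (F : Type*) [Field F] [Algebra R F] [IsFractionRing R F] [Algebra F Ω]
    [IsScalarTower R F Ω] (v : Valuation Ω Γ) {r : R} (hr : r ≠ 0) :
    v (algebraMap R Ω r) ≠ 0 := by
  rw [v.ne_zero_iff, IsScalarTower.algebraMap_apply R F Ω]
  exact (_root_.map_ne_zero _).mpr ((map_ne_zero_iff _ (IsFractionRing.injective R F)).mpr hr)

variable [IsDomain R] [WfDvdMonoid R]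

lemma exists_eq_zpow (h : LiesOver v π) (hπ : Prime π) {f : F} (hf : f ≠ 0) :
    ∃ k : ℤ, v (algebraMap F Ω f) = v (algebraMap R Ω π) ^ k := by
  have key : ∀ r : R, r ≠ 0 → ∃ k : ℕ, v (algebraMap R Ω r) = v (algebraMap R Ω π) ^ k := by
    intro r hr
    obtain ⟨k, q, hq, rfl⟩ := WfDvdMonoid.max_power_factor hr hπ.irreducible
    exact ⟨k, by rw [map_mul, map_mul, h.eq_one q hq, mul_one, map_pow, map_pow]⟩
  obtain ⟨a, b, hb, rfl⟩ := IsFractionRing.div_surjective (A := R) f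
  have hb0 := nonZeroDivisors.ne_zero hb
  have ha0 : a ≠ 0 := by rintro rfl; simp at hf
  obtain ⟨i, hi⟩ := key a ha0
  obtain ⟨j, hj⟩ := key b hb0
  refine ⟨i - j, ?_⟩
  rw [map_div₀, map_div₀, ← IsScalarTower.algebraMap_apply, ← IsScalarTower.algebraMap_apply, hi,
    hj, zpow_sub₀ (valuation_ne_zero F v hπ.ne_zero), zpow_natCast, zpow_natCast]

/-- A totally ramified element has large degree. -/
lemma le_natDegree_minpoly (h : LiesOver v π) (hπ : Prime π) {e : ℕ} {w : Ω}
    (hw : v w ^ e = v (algebraMap R Ω π)) (hint : IsIntegral F w) :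
    e ≤ (minpoly F w).natDegree := by
  have hπ0 := valuation_ne_zero F v hπ.ne_zero
  by_contra! hlt
  have he : e ≠ 0 := by omega
  have hw0 : v w ≠ 0 := by
    intro h0
    rw [h0, zero_pow he] at hw
    exact hπ0 hw.symm
  have hw1 : v w < 1 := by
    by_contra! hge
    exact absurd (hw ▸ one_le_pow_of_one_le' hge e) (not_le.mpr h.lt_one)
  have hwne : w ≠ 0 := v.ne_zero_iff.mp hw0
  -- Valuations of elements of `F` are powers of `v(π) = v(w)^e`. The nonzero terms of the minimal
  -- polynomial at `w` thus have valuations `v(w)^j` with `j` congruent to `i` modulo `e`. If the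
  -- degree were below `e` they would be distinct, and the sum could not vanish.
  have key : ∀ i ∈ (minpoly F w).support, ∃ k : ℤ,
      v ((minpoly F w).coeff i • w ^ i) = v w ^ (e * k + i) := by
    intro i hi
    obtain ⟨k, hk⟩ := h.exists_eq_zpow (Ω := Ω) hπ (mem_support_iff.mp hi)
    refine ⟨k, ?_⟩
    rw [Algebra.smul_def, map_mul, hk, ← hw, map_pow, zpow_add₀ hw0, zpow_mul, zpow_natCast,
      zpow_natCast]
  refine sum_ne_zero_of_injOn_valuation v (s := (minpoly F w).support)
    (a := fun i ↦ (minpoly F w).coeff i • w ^ i)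
    (nonempty_support_iff.mpr (minpoly.ne_zero hint)) (fun i hi ↦ ?_) (fun i hi j hj hij ↦ ?_) ?_
  · rw [Algebra.smul_def]
    exact mul_ne_zero ((_root_.map_ne_zero _).mpr (mem_support_iff.mp hi)) (pow_ne_zero _ hwne)
  · obtain ⟨k, hk⟩ := key i hi
    obtain ⟨l, hl⟩ := key j hj
    simp only [hk, hl] at hij
    have hij := zpow_right_injective₀ (zero_lt_iff.mpr hw0) hw1.ne hij
    have hi' : i < e := (le_natDegree_of_mem_supp i hi).trans_lt hlt
    have hj' : j < e := (le_natDegree_of_mem_supp j hj).trans_lt hlt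
    have hm : (i : ℤ) % e = (j : ℤ) % e := by
      have := congrArg (· % (e : ℤ)) hij
      simpa [Int.add_emod] using this
    rw [Int.emod_eq_of_lt (by positivity) (by exact_mod_cast hi'),
      Int.emod_eq_of_lt (by positivity) (by exact_mod_cast hj')] at hm
    exact_mod_cast hm
  · have := minpoly.aeval F w
    rwa [aeval_eq_sum_range, ← Finset.sum_subset supp_subset_range_natDegree_succ] at this
    intro i _ hi
    rw [notMem_support_iff.mp hi, zero_smul]

end FractionField

end LiesOver

end Valuation

end shortCurve

/-! ### The tower of `p`-power division points: valuations and separability -/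

namespace shortCurve

open Polynomial

section Tower

variable {R Ω Γ : Type*} [CommRing R] [Field Ω] [Algebra R Ω] [LinearOrderedCommGroupWithZero Γ]
  {p : ℕ} [hpp : Fact p.Prime] {s t π : R}

/-- The `x`-coordinates `x 0, x 1, …` of a sequence of points `P 0, P 1, …` of order
`p, p ^ 2, …` with `p • P (n + 1) = P n`. -/
structure IsTower (s t : R) (p : ℕ) (x : ℕ → Ω) : Prop where
  zero : aeval (x 0 ^ p) (verDen s t p) = 0
  succ : ∀ n, aeval (x (n + 1) ^ p) (verNum s t p) =
    x n * aeval (x (n + 1) ^ p) (verDen s t p) ^ 2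

/-- The reduction of the multiplication by `p` polynomials modulo `π` is that of a supersingular
curve, and the vanishing of the Hasse invariant at `π` is simple. -/
structure IsSimpleSupersingular (s t π : R) (p : ℕ) : Prop where
  prime : Prime π
  monic : (verNum s t p).Monic
  natDegree_num : (verNum s t p).natDegree = p
  natDegree_den : (verDen s t p).natDegree = (p - 1) / 2
  dvd : ∀ i ≠ 0, π ∣ (verDen s t p).coeff i
  not_dvd : ¬ π ∣ (verDen s t p).coeff 0
  not_sq_dvd : ¬ π ^ 2 ∣ (verDen s t p).coeff ((p - 1) / 2)

variable {v : Valuation Ω Γ} {x : ℕ → Ω}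

namespace IsTower

/-- At the bottom this is the single slope of the Newton polygon of `verDen`. At each further step
`verDen` takes a unit value, so the relation becomes `v(x_(n+1))^(p^2) = v(x_n)`. -/
lemma valuation_mul_pow_eq_one (hx : IsTower s t p x) (hp : 5 ≤ p)
    (hE : IsSimpleSupersingular s t π p) (h : LiesOver v π) (n : ℕ) :
    v (algebraMap R Ω π) * v (x n) ^ (p ^ (2 * n + 1) * ((p - 1) / 2)) = 1 := by
  obtain ⟨m, hm⟩ := hpp.out.odd_of_ne_two (by omega)
  have hm' : (p - 1) / 2 = m := by omega
  have hDd := hE.natDegree_den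
  have hD2 := hE.not_sq_dvd
  rw [hm'] at hDd hD2 ⊢
  induction n with
  | zero =>
    have := h.mul_pow_eq_one_of_aeval_eq_zero hE.dvd hE.not_dvd (by rwa [hDd]) (by omega) hx.zero
    rw [hDd, map_pow, ← pow_mul] at this
    simpa using this
  | succ n ih =>
    have hvπ : 0 < v (algebraMap R Ω π) := by
      rw [zero_lt_iff]
      intro h0
      rw [h0, zero_mul] at ih
      exact zero_ne_one ih
    have hE0 : p ^ (2 * n + 1) * m ≠ 0 :=
      mul_ne_zero (pow_ne_zero _ hpp.out.ne_zero) (by omega)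
    have hxn : 1 < v (x n) := by
      by_contra! hle
      exact absurd ih ((mul_le_of_le_one_right' (pow_le_one' hle _)).trans_lt h.lt_one).ne
    have hrel := congrArg v (hx.succ n)
    rw [map_mul, map_pow] at hrel
    set X := x (n + 1) ^ p with hX
    have hX1 : 1 < v X := by
      by_contra! hle
      rw [h.aeval_eq_one hE.dvd hE.not_dvd
        ((mul_le_of_le_one_right' (pow_le_one' hle _)).trans_lt h.lt_one), one_pow, mul_one] at hrel
      exact absurd (h.aeval_le_one (verNum s t p) hle) (not_le.mpr (hrel ▸ hxn))
    rw [h.aeval_monic hE.monic hX1, hE.natDegree_num] at hrel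
    -- If the leading term of `verDen` were not dominated by its constant term, the tower relation
    -- would give `v(X) ≤ v(x_n) v(π)^2 ≤ v(π) < 1`, contrary to `v(X) > 1`.
    have hT : v (algebraMap R Ω π) * v X ^ (verDen s t p).natDegree < 1 := by
      by_contra! hge
      have hle := h.aeval_le hE.dvd hge
      rw [hDd] at hle
      have h₁ : v X * v X ^ (2 * m) ≤ v (x n) * v (algebraMap R Ω π) ^ 2 * v X ^ (2 * m) := by
        calc v X * v X ^ (2 * m) = v X ^ p := by rw [hm, pow_succ, mul_comm]
          _ = _ := hrel
          _ ≤ v (x n) * (v (algebraMap R Ω π) * v X ^ m) ^ 2 := by gcongr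
          _ = _ := by rw [mul_pow, ← pow_mul, mul_comm m 2, mul_assoc]
      have h₂ := le_of_mul_le_mul_right h₁ (pow_pos (zero_lt_one.trans hX1) _)
      have h₃ : v (x n) * v (algebraMap R Ω π) ≤ 1 := by
        rw [← ih, mul_comm]
        gcongr
        exact le_self_pow₀ hxn.le hE0
      have h₄ : v X ≤ v (algebraMap R Ω π) := by
        calc v X ≤ v (x n) * v (algebraMap R Ω π) ^ 2 := h₂
          _ = v (x n) * v (algebraMap R Ω π) * v (algebraMap R Ω π) := by
            rw [pow_two, mul_assoc]
          _ ≤ 1 * v (algebraMap R Ω π) := by gcongr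
          _ = _ := one_mul _
      exact absurd (hX1.trans_le h₄) (not_lt.mpr h.lt_one.le)
    rw [h.aeval_eq_one hE.dvd hE.not_dvd hT, one_pow, mul_one, hX, map_pow, ← pow_mul] at hrel
    rw [← ih, ← hrel, ← pow_mul]
    congr 2
    ring

lemma one_lt_valuation (hx : IsTower s t p x) (hp : 5 ≤ p)
    (hE : IsSimpleSupersingular s t π p) (h : LiesOver v π) (n : ℕ) : 1 < v (x n) := by
  by_contra! hle
  exact absurd (hx.valuation_mul_pow_eq_one hp hE h n)
    ((mul_le_of_le_one_right' (pow_le_one' hle _)).trans_lt h.lt_one).ne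

/-- As `v(x_n) > 1`, the term `x^3` dominates in the equation, so `y^2` has the valuation of `x^3`
and the local parameter `x / y` at infinity has `v(x / y)^2 = v(x)⁻¹`. -/
lemma valuation_sq_mul (hx : IsTower s t p x) (hp : 5 ≤ p)
    (hE : IsSimpleSupersingular s t π p) (h : LiesOver v π) {n : ℕ} {y : Ω}
    (hy : y ^ 2 = x n ^ 3 + algebraMap R Ω s * x n + algebraMap R Ω t) :
    v (x n / y) ^ 2 * v (x n) = 1 := by
  have h1 := hx.one_lt_valuation hp hE h n
  have h0 : v (x n) ≠ 0 := (zero_lt_one.trans h1).ne'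
  have hlt : v (algebraMap R Ω s * x n + algebraMap R Ω t) < v (x n ^ 3) := by
    rw [map_pow]
    have h₂ : v (x n) < v (x n) ^ 3 := lt_self_pow₀ h1 (by norm_num)
    refine v.map_add_lt ?_ ?_
    · rw [map_mul]
      exact (mul_le_of_le_one_left' (h.le_one s)).trans_lt h₂
    · exact (h.le_one t).trans_lt (h1.trans h₂)
  have hv := congrArg v hy
  rw [add_assoc, v.map_add_eq_of_lt_left hlt, map_pow, map_pow] at hv
  rw [map_div₀, div_pow, hv]
  field_simp

/-- This is ramification of index `p^n (p - 1) = φ(p^(n+1))`, which gives the lower bound for the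
degree. -/
lemma valuation_pow (hx : IsTower s t p x) (hp : 5 ≤ p)
    (hE : IsSimpleSupersingular s t π p) (h : LiesOver v π) {n : ℕ} {y : Ω}
    (hy : y ^ 2 = x n ^ 3 + algebraMap R Ω s * x n + algebraMap R Ω t) :
    v ((x n / y) ^ p ^ (n + 1)) ^ (p ^ n * (p - 1)) = v (algebraMap R Ω π) := by
  have h1 := hx.valuation_mul_pow_eq_one hp hE h n
  have h2 := hx.valuation_sq_mul hp hE h hy
  obtain ⟨m, hm⟩ := hpp.out.odd_of_ne_two (by omega)
  rw [show (p - 1) / 2 = m by omega] at h1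
  set e := p ^ (2 * n + 1) * m
  have he : p ^ (n + 1) * (p ^ n * (p - 1)) = 2 * e := by
    rw [show p - 1 = 2 * m by omega]
    ring
  rw [map_pow, ← pow_mul, he, pow_mul]
  have h3 : (v (x n / y) ^ 2) ^ e * v (x n) ^ e = 1 := by rw [← mul_pow, h2, one_pow]
  have h0 : v (x n) ^ e ≠ 0 := right_ne_zero_of_mul (h1 ▸ one_ne_zero)
  exact mul_right_cancel₀ h0 (h3.trans h1.symm)

section Separable

variable {F : Type*} [Field F] [Algebra R F] [IsFractionRing R F] [Algebra F Ω]
  [IsScalarTower R F Ω] [IsDomain R] [WfDvdMonoid R]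

/-- An element of `F` has valuation an integral power of `v(π)`. The valuation equation would then
make `m = (p - 1) / 2` divide `1`, although `m ≥ 2`. -/
lemma pow_ne_algebraMap (hx : IsTower s t p x) (hp : 5 ≤ p)
    (hE : IsSimpleSupersingular s t π p) (h : LiesOver v π) (n : ℕ) (f : F) :
    x n ^ p ^ (n + 1) ≠ algebraMap F Ω f := by
  intro hf
  have h1 := hx.valuation_mul_pow_eq_one hp hE h n
  have hx1 := hx.one_lt_valuation hp hE h n
  have hf0 : f ≠ 0 := by
    rintro rfl
    rw [map_zero] at hf
    have := pow_eq_zero_iff (pow_ne_zero _ hpp.out.ne_zero) |>.mp hf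
    rw [this, map_zero] at hx1
    exact absurd hx1 (by simp)
  obtain ⟨k, hk⟩ := h.exists_eq_zpow (Ω := Ω) hE.prime hf0
  obtain ⟨m, hm⟩ := hpp.out.odd_of_ne_two (by omega)
  rw [show (p - 1) / 2 = m by omega, show p ^ (2 * n + 1) * m = p ^ (n + 1) * (p ^ n * m) by ring,
    pow_mul, ← map_pow, hf, hk] at h1
  have hπ0 : v (algebraMap R Ω π) ≠ 0 := left_ne_zero_of_mul (h1 ▸ one_ne_zero)
  rw [← zpow_natCast, ← zpow_mul, ← zpow_one_add₀ hπ0] at h1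
  have h2 := zpow_right_injective₀ (zero_lt_iff.mpr hπ0) h.lt_one.ne (h1.trans (zpow_zero _).symm)
  have h3 : (m : ℤ) ∣ 1 := ⟨-(k * p ^ n), by push_cast at h2; linear_combination h2⟩
  have h4 : m ∣ 1 := by exact_mod_cast h3
  have := Nat.le_of_dvd one_pos h4
  omega

end Separable

end IsTower

end Tower

section Separable

variable {F Ω : Type*} [Field F] [Field Ω] [Algebra F Ω] {p : ℕ} [hpp : Fact p.Prime] [CharP F p]

/-- An inseparable minimal polynomial is a polynomial in `X ^ p`, so it has degree at least `p`.
Then `g` would be a constant multiple of it and have zero derivative. -/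
lemma isSeparable_of_natDegree_le {z : Ω} {g : F[X]} (hg : aeval z g = 0)
    (hd : derivative g ≠ 0) (hdeg : g.natDegree ≤ p) : IsSeparable F z := by
  have hg0 : g ≠ 0 := by rintro rfl; simp at hd
  have hint : IsIntegral F z := IsAlgebraic.isIntegral ⟨g, hg0, hg⟩
  rw [IsSeparable, separable_iff_derivative_ne_zero (minpoly.irreducible hint)]
  intro h
  obtain ⟨c, hc⟩ := minpoly.dvd F z hg
  have h₁ := expand_contract p h hpp.out.ne_zero
  have h₂ := natDegree_expand p (contract p (minpoly F z))
  rw [h₁] at h₂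
  have h₃ := minpoly.natDegree_pos hint
  have hle : p ≤ (minpoly F z).natDegree := by
    rw [h₂] at h₃ ⊢
    exact Nat.le_mul_of_pos_left _ (Nat.pos_of_mul_pos_right h₃)
  have hc0 : c ≠ 0 := by rintro rfl; exact hg0 (by rw [hc, mul_zero])
  have hdc : c.natDegree = 0 := by
    have := congrArg natDegree hc
    rw [natDegree_mul (minpoly.ne_zero hint) hc0] at this
    omega
  refine hd ?_
  rw [hc, derivative_mul, h, zero_mul, eq_C_of_natDegree_eq_zero hdc, derivative_C, mul_zero,
    add_zero]

lemma mem_separableClosure_of_natDegree_le {z : Ω} {g : (separableClosure F Ω)[X]}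
    (hg : aeval z g = 0) (hd : derivative g ≠ 0) (hdeg : g.natDegree ≤ p) :
    z ∈ separableClosure F Ω := by
  have : CharP (separableClosure F Ω) p := charP_of_injective_algebraMap
    (algebraMap F (separableClosure F Ω)).injective p
  exact mem_separableClosure_iff.mpr
    (IsSeparable.of_algebra_isSeparable_of_isSeparable F (isSeparable_of_natDegree_le hg hd hdeg))

lemma mem_separableClosure_of_sq_mem (hp : p ≠ 2) {y : Ω} (hy : y ^ 2 ∈ separableClosure F Ω) :
    y ∈ separableClosure F Ω := by
  rcases eq_or_ne y 0 with rfl | hy0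
  · exact zero_mem _
  refine mem_separableClosure_of_natDegree_le (p := p) (g := X ^ 2 - C ⟨y ^ 2, hy⟩) ?_ ?_ ?_
  · simp [IntermediateField.algebraMap_apply]
  · have : CharP (separableClosure F Ω) p := charP_of_injective_algebraMap
      (algebraMap F (separableClosure F Ω)).injective p
    rw [derivative_sub, derivative_C, sub_zero, derivative_X_pow]
    exact mul_ne_zero (by exact_mod_cast C_ne_zero.mpr (two_ne_zero_of_charP _ hp))
      (pow_ne_zero _ X_ne_zero)
  · rw [natDegree_X_pow_sub_C]
    exact hpp.out.two_le

end Separable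

section TowerSeparable

variable {R F Ω Γ : Type*} [CommRing R] [Field F] [Field Ω] [Algebra R Ω] [Algebra R F]
  [IsFractionRing R F] [Algebra F Ω] [IsScalarTower R F Ω]
  [LinearOrderedCommGroupWithZero Γ] {p : ℕ} [hpp : Fact p.Prime] {s t π : R} [CharP R p]
  {v : Valuation Ω Γ} {x : ℕ → Ω}

lemma aeval_map_iterateFrobenius [CharP Ω p] (n : ℕ) (z : Ω) (f : R[X]) :
    aeval (z ^ p ^ n) (f.map (iterateFrobenius R p n)) = aeval z f ^ p ^ n := by
  rw [aeval_def, aeval_def, eval₂_map, ← iterateFrobenius_def p n (eval₂ _ z f), hom_eval₂,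
    iterateFrobenius_def]
  congr 1
  ext r
  simp [iterateFrobenius_def]

variable [IsDomain R] [WfDvdMonoid R]

/-- Each floor of the tower, after a Frobenius twist, is a root of a polynomial of degree at most
`p` over the separable closure. Its derivative could vanish only if the element of the floor below,
already raised to its power, lay in `F`, which the valuation excludes. -/
lemma IsTower.pow_mem_separableClosure (hx : IsTower s t p x) (hp : 5 ≤ p)
    (hE : IsSimpleSupersingular s t π p) (h : LiesOver v π) (n : ℕ) :
    x n ^ p ^ (n + 1) ∈ separableClosure F Ω := by
  have hRF : Function.Injective (algebraMap R F) := IsFractionRing.injective R F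
  have : CharP F p := charP_of_injective_algebraMap hRF p
  have : CharP Ω p := charP_of_injective_algebraMap (algebraMap F Ω).injective p
  let S := separableClosure F Ω
  let φ : R →+* S := (algebraMap F S).comp (algebraMap R F)
  have : CharP S p := charP_of_injective_algebraMap (algebraMap F S).injective p
  have hφ : Function.Injective φ := (algebraMap F S).injective.comp hRF
  have hφa : ∀ z (f : R[X]), aeval (R := S) z (f.map φ) = aeval (z : Ω) f := by
    intro z f
    rw [aeval_def, aeval_def, eval₂_map]
    congr 1
    ext r
    exact (IsScalarTower.algebraMap_apply R F Ω r).symm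
  obtain ⟨m, hm⟩ := hpp.out.odd_of_ne_two (by omega)
  have hm' : (p - 1) / 2 = m := by omega
  have hDd := hE.natDegree_den
  have hD2 := hE.not_sq_dvd
  rw [hm'] at hDd hD2
  have hcm : (verDen s t p).coeff m ≠ 0 := by
    intro h0
    rw [h0] at hD2
    exact hD2 (dvd_zero _)
  induction n with
  | zero =>
    rw [zero_add, pow_one]
    refine mem_separableClosure_of_natDegree_le (p := p) (g := (verDen s t p).map φ) ?_ ?_ ?_
    · exact (hφa _ _).trans hx.zero
    · intro h0
      have h₁ := congrArg (fun f ↦ f.coeff (m - 1)) h0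
      simp only [coeff_derivative, coeff_map, coeff_zero] at h₁
      rw [← Nat.cast_succ, Nat.succ_eq_add_one, Nat.sub_add_cancel (by omega)] at h₁
      rcases mul_eq_zero.mp h₁ with h₁ | h₁
      · exact hcm ((map_eq_zero_iff _ hφ).mp h₁)
      · rw [CharP.cast_eq_zero_iff S p] at h₁
        exact absurd (Nat.le_of_dvd (by omega) h₁) (by omega)
    · rw [natDegree_map_eq_of_injective hφ, hDd]
      omega
  | succ n ih =>
    set σ := iterateFrobenius R p (n + 1) with hσ
    set N := (verNum s t p).map σ with hN
    set D := (verDen s t p).map σ with hD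
    have hNd : N.natDegree ≤ p := natDegree_map_le.trans hE.natDegree_num.le
    have hDd' : D.natDegree ≤ m := natDegree_map_le.trans hDd.le
    let g : S[X] := N.map φ - C ⟨_, ih⟩ * (D.map φ) ^ 2
    have hgd : ((D.map φ) ^ 2).natDegree ≤ m + m := by
      rw [natDegree_pow]
      have := natDegree_map_le (f := φ) (p := D)
      omega
    refine mem_separableClosure_of_natDegree_le (p := p) (g := g) ?_ ?_ ?_
    · rw [map_sub, map_mul, map_pow, aeval_C, IntermediateField.algebraMap_apply, hφa, hφa,
        show p ^ (n + 1 + 1) = p * p ^ (n + 1) by ring, pow_mul, hN, hD, hσ,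
        aeval_map_iterateFrobenius, aeval_map_iterateFrobenius, hx.succ]
      ring
    -- The coefficient of `X^(p-2)` in `g'` is `p - 1` times that of `X^(p-1)` in `g`. If the latter
    -- vanished, `x_n^(p^(n+1))` would be the quotient of two elements of `F`.
    · intro h0
      have h₁ := congrArg (fun f ↦ f.coeff (p - 2)) h0
      simp only [coeff_derivative, coeff_zero] at h₁
      rw [← Nat.cast_succ, Nat.succ_eq_add_one, show p - 2 + 1 = p - 1 by omega] at h₁
      rcases mul_eq_zero.mp h₁ with h₁ | h₁
      · have h₂ : ((D.map φ) ^ 2).coeff (p - 1) = φ ((verDen s t p).coeff m ^ p ^ (n + 1)) ^ 2 := by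
          rw [pow_two, show p - 1 = m + m by omega, coeff_mul_add_eq_of_natDegree_le
            (natDegree_map_le.trans hDd') (natDegree_map_le.trans hDd'), coeff_map, hD, coeff_map,
            hσ, iterateFrobenius_def, pow_two]
        rw [coeff_sub, coeff_C_mul, h₂, coeff_map, hN, coeff_map, sub_eq_zero, hσ,
          iterateFrobenius_def] at h₁
        refine hx.pow_ne_algebraMap (F := F) hp hE h n
          (algebraMap R F ((verNum s t p).coeff (p - 1) ^ p ^ (n + 1)) /
            algebraMap R F ((verDen s t p).coeff m ^ p ^ (n + 1)) ^ 2) ?_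
        have h₃ := congrArg (algebraMap S Ω) h₁
        rw [map_mul, map_pow (algebraMap S Ω)] at h₃
        have hne : algebraMap F Ω (algebraMap R F ((verDen s t p).coeff m ^ p ^ (n + 1))) ≠ 0 := by
          rw [_root_.map_ne_zero, map_ne_zero_iff _ hRF]
          exact pow_ne_zero _ hcm
        rw [map_div₀, map_pow (algebraMap F Ω), eq_div_iff (pow_ne_zero 2 hne)]
        exact h₃.symm
      · rw [CharP.cast_eq_zero_iff S p] at h₁
        exact absurd (Nat.le_of_dvd (by omega) h₁) (by omega)
    · refine (natDegree_sub_le _ _).trans (max_le (natDegree_map_le.trans hNd) ?_)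
      refine natDegree_C_mul_le _ _ |>.trans (hgd.trans (by omega))

lemma IsTower.div_pow_mem_separableClosure (hx : IsTower s t p x) (hp : 5 ≤ p)
    (hE : IsSimpleSupersingular s t π p) (h : LiesOver v π) {n : ℕ} {y : Ω}
    (hy : y ^ 2 = x n ^ 3 + algebraMap R Ω s * x n + algebraMap R Ω t) :
    (x n / y) ^ p ^ (n + 1) ∈ separableClosure F Ω := by
  have : CharP F p := charP_of_injective_algebraMap (IsFractionRing.injective R F) p
  have : CharP Ω p := charP_of_injective_algebraMap (algebraMap F Ω).injective p
  have hX := hx.pow_mem_separableClosure (F := F) hp hE h n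
  have hR : ∀ r : R, algebraMap R Ω r ∈ separableClosure F Ω := fun r ↦ by
    rw [IsScalarTower.algebraMap_apply R F Ω]
    exact (separableClosure F Ω).algebraMap_mem _
  rw [div_pow]
  refine div_mem hX (mem_separableClosure_of_sq_mem (p := p) (by omega) ?_)
  have : (y ^ p ^ (n + 1)) ^ 2 = (x n ^ p ^ (n + 1)) ^ 3 + algebraMap R Ω s ^ p ^ (n + 1) *
      x n ^ p ^ (n + 1) + algebraMap R Ω t ^ p ^ (n + 1) := by
    rw [← pow_mul, mul_comm, pow_mul, hy, add_pow_char_pow, add_pow_char_pow]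
    ring
  rw [this]
  exact add_mem (add_mem (pow_mem hX 3) (mul_mem (pow_mem (hR s) _) hX)) (pow_mem (hR t) _)

end TowerSeparable

end shortCurve

/-! ### The structure of the `p`-power torsion -/

namespace shortCurve

open Polynomial WeierstrassCurve.Affine

section Torsion

variable {Ω : Type*} [Field Ω] [DecidableEq Ω] {p : ℕ} [hpp : Fact p.Prime] [CharP Ω p] {s t : Ω}

lemma prime_nsmul_eq_zero_iff (hp : p ≠ 2) (hd : 4 * s ^ 3 + 27 * t ^ 2 ≠ 0)
    {P : (shortCurve s t).toAffine.Point} (hP : P ≠ 0) :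
    p • P = 0 ↔ (verDen s t p).eval (xc P ^ p) = 0 := by
  rw [nsmul_eq_zero_iff_eval (two_ne_zero_of_charP Ω hp) hP (hpp.out.odd_of_ne_two hp),
    ← expand_verDen hp hd, expand_eval]

lemma xc_prime_nsmul_mul_eval (hp : p ≠ 2) (hd : 4 * s ^ 3 + 27 * t ^ 2 ≠ 0)
    {P : (shortCurve s t).toAffine.Point} (hP : P ≠ 0) (hpP : p • P ≠ 0) :
    (verNum s t p).eval (xc P ^ p) = xc (p • P) * (verDen s t p).eval (xc P ^ p) ^ 2 := by
  have := xc_nsmul_mul_eval (two_ne_zero_of_charP Ω hp) hP hpp.out.one_le hpP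
  rw [← expand_verNum hp hd, ← expand_verDen_sq hp hd, expand_eval, expand_eval, eval_pow] at this
  exact this.symm

lemma exists_ne_zero_prime_nsmul_eq_zero [IsAlgClosed Ω] (hp : p ≠ 2)
    (hd : 4 * s ^ 3 + 27 * t ^ 2 ≠ 0) (hdeg : (verDen s t p).natDegree ≠ 0) :
    ∃ P : (shortCurve s t).toAffine.Point, P ≠ 0 ∧ p • P = 0 := by
  obtain ⟨X, hX⟩ := IsAlgClosed.exists_root (verDen s t p)
    (natDegree_pos_iff_degree_pos.mp (Nat.pos_of_ne_zero hdeg)).ne'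
  obtain ⟨x, hx⟩ := IsAlgClosed.exists_pow_nat_eq X hpp.out.pos
  obtain ⟨P, hP, rfl⟩ := exists_point_of_isAlgClosed (two_ne_zero_of_charP Ω hp) hd x
  exact ⟨P, hP, (prime_nsmul_eq_zero_iff hp hd hP).mpr (hx ▸ hX)⟩

/-- The polynomial `verNum - x(Q) verDen^2` has degree `p`, hence a root, and coprimality keeps
`verDen` nonzero there. The abscissa fixes the point up to sign. -/
lemma exists_prime_nsmul_eq [IsAlgClosed Ω] (hp : p ≠ 2) (hd : 4 * s ^ 3 + 27 * t ^ 2 ≠ 0)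
    {Q : (shortCurve s t).toAffine.Point} (hQ : Q ≠ 0) :
    ∃ P : (shortCurve s t).toAffine.Point, p • P = Q := by
  obtain ⟨m, hm⟩ := hpp.out.odd_of_ne_two hp
  have hD := natDegree_verDen_le (s := s) (t := t) hp hd
  have hN := natDegree_verNum (s := s) (t := t) hp hd
  have hlt : (C (xc Q) * verDen s t p ^ 2).natDegree < (verNum s t p).natDegree := by
    refine (natDegree_C_mul_le _ _).trans_lt ?_
    rw [natDegree_pow, hN]
    omega
  obtain ⟨X, hX⟩ := IsAlgClosed.exists_root (verNum s t p - C (xc Q) * verDen s t p ^ 2)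
    (natDegree_pos_iff_degree_pos.mp (by
      rw [natDegree_sub_eq_left_of_natDegree_lt hlt, hN]
      exact hpp.out.pos)).ne'
  rw [IsRoot, eval_sub, eval_mul, eval_C, eval_pow, sub_eq_zero] at hX
  have hDX : (verDen s t p).eval X ≠ 0 := by
    intro h0
    obtain ⟨a, b, hab⟩ := isCoprime_verNum_verDen_sq (s := s) (t := t) hp hd
    have := congrArg (eval X) hab
    rw [h0, zero_pow two_ne_zero, mul_zero] at hX
    rw [eval_add, eval_mul, eval_mul, eval_pow, hX, h0] at this
    simp at this
  obtain ⟨x, rfl⟩ := IsAlgClosed.exists_pow_nat_eq X hpp.out.pos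
  obtain ⟨P, hP, rfl⟩ := exists_point_of_isAlgClosed (two_ne_zero_of_charP Ω hp) hd x
  have hpP : p • P ≠ 0 := fun h ↦ hDX ((prime_nsmul_eq_zero_iff hp hd hP).mp h)
  have hx := xc_prime_nsmul_mul_eval hp hd hP hpP
  rw [hX] at hx
  rcases eq_or_eq_neg_of_xc_eq hpP hQ (mul_right_cancel₀ (pow_ne_zero 2 hDX) hx).symm with h | h
  · exact ⟨P, h⟩
  · exact ⟨-P, by rw [smul_neg, h, neg_neg]⟩

/-- The multiples `i • P` with `1 ≤ i ≤ (p - 1) / 2` have distinct abscissas, and their `p`-th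
powers already exhaust the roots of `verDen`, whose degree is at most `(p - 1) / 2`. -/
lemma exists_nsmul_eq_of_prime_nsmul_eq_zero (hp : p ≠ 2) (hd : 4 * s ^ 3 + 27 * t ^ 2 ≠ 0)
    {P Q : (shortCurve s t).toAffine.Point} (hP : P ≠ 0) (hpP : p • P = 0) (hpQ : p • Q = 0) :
    ∃ k : ℤ, Q = k • P := by
  rcases eq_or_ne Q 0 with rfl | hQ
  · exact ⟨0, by simp⟩
  obtain ⟨m, hm⟩ := hpp.out.odd_of_ne_two hp
  have hord : addOrderOf P = p := addOrderOf_eq_prime hpP hP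
  have hD := natDegree_verDen_le (s := s) (t := t) hp hd
  rw [show (p - 1) / 2 = m by omega] at hD
  have hD0 : verDen s t p ≠ 0 := by
    intro h0
    have hcop := isCoprime_verNum_verDen_sq (s := s) (t := t) hp hd
    rw [h0, zero_pow two_ne_zero, isCoprime_zero_right] at hcop
    have := natDegree_eq_zero_of_isUnit hcop
    rw [natDegree_verNum hp hd] at this
    exact hpp.out.ne_zero this
  have hne : ∀ i ∈ Finset.Icc 1 m, i • P ≠ 0 := by
    intro i hi h
    rw [Finset.mem_Icc] at hi
    have := addOrderOf_dvd_of_nsmul_eq_zero h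
    rw [hord] at this
    exact absurd (Nat.le_of_dvd (by omega) this) (by omega)
  have hroot : ∀ R : (shortCurve s t).toAffine.Point, R ≠ 0 → p • R = 0 →
      xc R ^ p ∈ (verDen s t p).roots.toFinset := by
    intro R hR hpR
    rw [Multiset.mem_toFinset, mem_roots hD0]
    exact (prime_nsmul_eq_zero_iff hp hd hR).mp hpR
  have hfrob : ∀ a b : Ω, a ^ p = b ^ p → a = b := fun a b h ↦ frobenius_inj Ω p h
  have himg : (Finset.Icc 1 m).image (fun i : ℕ ↦ xc (i • P) ^ p) =
      (verDen s t p).roots.toFinset := by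
    refine Finset.eq_of_subset_of_card_le ?_ ?_
    · intro z hz
      obtain ⟨i, hi, rfl⟩ := Finset.mem_image.mp hz
      exact hroot _ (hne i hi) (by rw [smul_comm, hpP, smul_zero])
    · rw [Finset.card_image_of_injOn, Nat.card_Icc, Nat.add_sub_cancel]
      · exact (Multiset.toFinset_card_le _).trans ((card_roots' _).trans hD)
      · intro i hi j hj hij
        have hi' := Finset.mem_Icc.mp hi
        have hj' := Finset.mem_Icc.mp hj
        rcases eq_or_eq_neg_of_xc_eq (hne i hi) (hne j hj) (hfrob _ _ hij) with h | h
        · have := (nsmul_inj_mod (x := P)).mp h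
          rwa [hord, Nat.mod_eq_of_lt (by omega), Nat.mod_eq_of_lt (by omega)] at this
        · have h' : (i + j) • P = 0 := by rw [add_smul, h, neg_add_cancel]
          have := addOrderOf_dvd_of_nsmul_eq_zero h'
          rw [hord] at this
          exact absurd (Nat.le_of_dvd (by omega) this) (by omega)
  have hmem := hroot Q hQ hpQ
  rw [← himg, Finset.mem_image] at hmem
  obtain ⟨i, hi, hiQ⟩ := hmem
  rcases eq_or_eq_neg_of_xc_eq hQ (hne i hi) (hfrob _ _ hiQ.symm) with h | h
  · exact ⟨i, by rw [h, natCast_zsmul]⟩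
  · exact ⟨-i, by rw [h, neg_smul, natCast_zsmul]⟩

lemma exists_seq_prime_nsmul_eq [IsAlgClosed Ω] (hp : p ≠ 2)
    (hd : 4 * s ^ 3 + 27 * t ^ 2 ≠ 0) (hdeg : (verDen s t p).natDegree ≠ 0) :
    ∃ P : ℕ → (shortCurve s t).toAffine.Point, (∀ n, P n ≠ 0) ∧ p • P 0 = 0 ∧
      ∀ n, p • P (n + 1) = P n := by
  obtain ⟨P₀, hP₀, hpP₀⟩ := exists_ne_zero_prime_nsmul_eq_zero hp hd hdeg
  choose! f hf using fun Q (hQ : Q ≠ 0) ↦ exists_prime_nsmul_eq (Q := Q) hp hd hQ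
  let P : ℕ → (shortCurve s t).toAffine.Point := fun n ↦ f^[n] P₀
  have hsucc : ∀ n, P (n + 1) = f (P n) := fun n ↦ Function.iterate_succ_apply' f n P₀
  have hne : ∀ n, P n ≠ 0 := by
    intro n
    induction n with
    | zero => exact hP₀
    | succ n ih =>
      intro h0
      have := hf (P n) ih
      rw [← hsucc, h0, smul_zero] at this
      exact ih this.symm
  exact ⟨P, hne, hpP₀, fun n ↦ by rw [hsucc, hf _ (hne n)]⟩

variable {P : ℕ → (shortCurve s t).toAffine.Point}

omit hpp [CharP Ω p] in
lemma pow_nsmul_seq (hsucc : ∀ n, p • P (n + 1) = P n) (n : ℕ) : p ^ n • P n = P 0 := by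
  induction n with
  | zero => rw [pow_zero, one_smul]
  | succ n ih => rw [pow_succ, mul_smul, hsucc, ih]

omit [CharP Ω p] in
lemma addOrderOf_seq (hne : ∀ n, P n ≠ 0) (h0 : p • P 0 = 0)
    (hsucc : ∀ n, p • P (n + 1) = P n) (n : ℕ) : addOrderOf (P n) = p ^ (n + 1) := by
  refine addOrderOf_eq_prime_pow ?_ ?_
  · rw [pow_nsmul_seq hsucc]; exact hne 0
  · rw [pow_succ', mul_smul, pow_nsmul_seq hsucc, h0]

/-- By induction `p • Q` is a multiple of `P n`, so `Q` differs from a multiple of `P (n + 1)` by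
`p`-torsion, which consists of multiples of `P 0 = p^(n+1) • P (n + 1)`. -/
lemma exists_zsmul_seq_eq (hp : p ≠ 2) (hd : 4 * s ^ 3 + 27 * t ^ 2 ≠ 0) (hne : ∀ n, P n ≠ 0)
    (h0 : p • P 0 = 0) (hsucc : ∀ n, p • P (n + 1) = P n) (n : ℕ)
    {Q : (shortCurve s t).toAffine.Point} (hQ : p ^ (n + 1) • Q = 0) : ∃ k : ℤ, Q = k • P n := by
  induction n generalizing Q with
  | zero => exact exists_nsmul_eq_of_prime_nsmul_eq_zero hp hd (hne 0) h0 (by simpa using hQ)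
  | succ n ih =>
    obtain ⟨k, hk⟩ := ih (Q := p • Q) (by rwa [← mul_smul, ← pow_succ])
    obtain ⟨j, hj⟩ := exists_nsmul_eq_of_prime_nsmul_eq_zero (Q := Q - k • P (n + 1)) hp hd (hne 0)
      h0 (by rw [smul_sub, hk, smul_comm p k, hsucc, sub_self])
    refine ⟨j * p ^ (n + 1) + k, ?_⟩
    rw [add_smul, mul_smul, ← Nat.cast_pow, natCast_zsmul, pow_nsmul_seq hsucc, ← hj,
      sub_add_cancel]

end Torsion

section Generic

variable (K : Type*) [Field K] {p : ℕ} [hpp : Fact p.Prime] [CharP K p]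

local notation "𝐬" => (MvPolynomial.X 0 : MvPolynomial (Fin 2) K)
local notation "𝐭" => (MvPolynomial.X 1 : MvPolynomial (Fin 2) K)

lemma exists_isSimpleSupersingular (hp : 5 ≤ p) :
    ∃ π, IsSimpleSupersingular 𝐬 𝐭 π p := by
  obtain ⟨π, hπ, h₁, h₂, h₃, h₄⟩ := exists_prime_dvd_coeff_verDen K hp
  let κ : MvPolynomial (Fin 2) K →+* RatFunc2 K := algebraMap _ _
  have hκ : Function.Injective κ := IsFractionRing.injective _ _
  have : CharP (RatFunc2 K) p := charP_of_injective_ringHom (f := κ.comp MvPolynomial.C)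
    (RingHom.injective _) p
  have hd : 4 * κ 𝐬 ^ 3 + 27 * κ 𝐭 ^ 2 ≠ 0 := by
    intro h
    refine generic_disc_ne_zero K (p := p) (by omega) (hκ ?_)
    simpa only [map_add, map_mul, map_pow, map_ofNat, map_zero] using h
  have hN := natDegree_verNum (p := p) (by omega) hd
  have hm := monic_verNum (p := p) (by omega) hd
  rw [← map_verNum _ _ _ hpp.out.ne_zero] at hN hm
  rw [natDegree_map_eq_of_injective hκ] at hN
  exact ⟨π, hπ, monic_of_injective hκ hm, hN, h₁, h₂, h₃, h₄⟩

open Classical in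
/-- The `p`-power torsion of the generic curve is generated by a point with a coordinate function
of large degree. -/
lemma exists_generator (hp : 5 ≤ p) {n : ℕ} (hn : 1 ≤ n)
    {W : WeierstrassCurve.Affine (AlgebraicClosure (RatFunc2 K))}
    (hW : W = shortCurve (algebraMap _ _ (varS K)) (algebraMap _ _ (varT K))) :
    ∃ P : W.Point, addOrderOf P = p ^ n ∧ (∀ Q : W.Point, p ^ n • Q = 0 → ∃ k : ℤ, Q = k • P) ∧
      (xc P / yc P) ^ p ^ n ∈ separableClosure (RatFunc2 K) (AlgebraicClosure (RatFunc2 K)) ∧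
      (p ^ n).totient ≤ (minpoly (RatFunc2 K) ((xc P / yc P) ^ p ^ n)).natDegree := by
  subst hW
  obtain ⟨n, rfl⟩ : ∃ k, n = k + 1 := ⟨n - 1, by omega⟩
  obtain ⟨π, hE⟩ := exists_isSimpleSupersingular K hp
  set Ω := AlgebraicClosure (RatFunc2 K) with hΩ
  let κ : MvPolynomial (Fin 2) K →+* Ω := algebraMap _ _
  have hκ : Function.Injective κ := by
    have := (algebraMap (RatFunc2 K) Ω).injective.comp
      (IsFractionRing.injective (MvPolynomial (Fin 2) K) (RatFunc2 K))
    rwa [← RingHom.coe_comp, ← IsScalarTower.algebraMap_eq] at this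
  have : FaithfulSMul (MvPolynomial (Fin 2) K) Ω :=
    (faithfulSMul_iff_algebraMap_injective _ _).mpr hκ
  have : CharP Ω p := charP_of_injective_ringHom (f := κ.comp MvPolynomial.C)
    (RingHom.injective _) p
  have hs : algebraMap (RatFunc2 K) Ω (varS K) = κ 𝐬 :=
    (IsScalarTower.algebraMap_apply (MvPolynomial (Fin 2) K) (RatFunc2 K) Ω _).symm
  have ht : algebraMap (RatFunc2 K) Ω (varT K) = κ 𝐭 :=
    (IsScalarTower.algebraMap_apply (MvPolynomial (Fin 2) K) (RatFunc2 K) Ω _).symm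
  rw [hs, ht]
  have hp2 : p ≠ 2 := by omega
  have hd : 4 * κ 𝐬 ^ 3 + 27 * κ 𝐭 ^ 2 ≠ 0 := by
    intro h
    refine generic_disc_ne_zero K hp2 (hκ ?_)
    simpa only [map_add, map_mul, map_pow, map_ofNat, map_zero] using h
  have hnum : ∀ X, aeval X (verNum 𝐬 𝐭 p) = (verNum (κ 𝐬) (κ 𝐭) p).eval X := fun X ↦ by
    rw [← map_verNum _ _ _ hpp.out.ne_zero, eval_map, aeval_def]
  have hden : ∀ X, aeval X (verDen 𝐬 𝐭 p) = (verDen (κ 𝐬) (κ 𝐭) p).eval X := fun X ↦ by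
    rw [← map_verDen _ _ _ hpp.out.ne_zero, eval_map, aeval_def]
  obtain ⟨P, hne, h0, hsucc⟩ := exists_seq_prime_nsmul_eq (s := κ 𝐬) (t := κ 𝐭) hp2 hd (by
    rw [← map_verDen _ _ _ hpp.out.ne_zero, natDegree_map_eq_of_injective hκ, hE.natDegree_den]
    omega)
  have hx : IsTower 𝐬 𝐭 p (fun n ↦ xc (P n)) := by
    refine ⟨?_, fun n ↦ ?_⟩
    · rw [hden]
      exact (prime_nsmul_eq_zero_iff hp2 hd (hne 0)).mp h0
    · rw [hnum, hden]
      have := xc_prime_nsmul_mul_eval hp2 hd (hne (n + 1)) (by rw [hsucc]; exact hne n)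
      rwa [hsucc] at this
  have hy := (nonsingular_of_ne_zero (hne n)).1
  obtain ⟨V, hV⟩ := exists_liesOver (Ω := Ω) hE.prime
  refine ⟨P n, addOrderOf_seq hne h0 hsucc n,
    fun Q hQ ↦ exists_zsmul_seq_eq hp2 hd hne h0 hsucc n hQ,
    hx.div_pow_mem_separableClosure hp hE hV hy, ?_⟩
  rw [Nat.totient_prime_pow_succ hpp.out]
  exact hV.le_natDegree_minpoly hE.prime (hx.valuation_pow hp hE hV hy)
    (Algebra.IsIntegral.isIntegral _)

end Generic

end shortCurve

/-! ### The Galois action on torsion -/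

namespace shortCurve

open Polynomial WeierstrassCurve.Affine

section Galois

variable {F : Type*} [Field F] (E : WeierstrassCurve.Affine F)

local notation "Ω" => AlgebraicClosure F

open Classical in
/-- The action of an automorphism of the algebraic closure on points. -/
noncomputable def galAct (σ : Ω ≃ₐ[F] Ω) : (E⁄Ω).Point →+ (E⁄Ω).Point :=
  Point.map (σ : Ω →ₐ[F] Ω)

variable {E}

lemma xc_galAct (σ : Ω ≃ₐ[F] Ω) (P : (E⁄Ω).Point) : xc (galAct E σ P) = σ (xc P) := by
  cases P with
  | zero => exact (map_zero σ).symm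
  | some x y h => rfl

lemma yc_galAct (σ : Ω ≃ₐ[F] Ω) (P : (E⁄Ω).Point) : yc (galAct E σ P) = σ (yc P) := by
  cases P with
  | zero => exact (map_zero σ).symm
  | some x y h => rfl

open Classical in
lemma galAct_ne_zero {σ : Ω ≃ₐ[F] Ω} {P : (E⁄Ω).Point} (hP : P ≠ 0) : galAct E σ P ≠ 0 :=
  (map_ne_zero_iff _ (Point.map_injective (f := (σ : Ω →ₐ[F] Ω)))).mpr hP

lemma ext_xc_yc {k : Type*} [Field k] {W : WeierstrassCurve.Affine k} {P Q : W.Point} (hP : P ≠ 0)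
    (hQ : Q ≠ 0) (hx : xc P = xc Q) (hy : yc P = yc Q) : P = Q := by
  obtain ⟨h₁, e₁⟩ := exists_eq_some hP
  obtain ⟨h₂, e₂⟩ := exists_eq_some hQ
  rw [e₁, e₂]
  simp only [hx, hy]

lemma galAct_eq_self_iff {σ : Ω ≃ₐ[F] Ω} {P : (E⁄Ω).Point} (hP : P ≠ 0) :
    galAct E σ P = P ↔ σ (xc P) = xc P ∧ σ (yc P) = yc P := by
  refine ⟨fun h ↦ ⟨by rw [← xc_galAct, h], by rw [← yc_galAct, h]⟩, fun h ↦ ?_⟩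
  exact ext_xc_yc (galAct_ne_zero hP) hP (by rw [xc_galAct, h.1]) (by rw [yc_galAct, h.2])

lemma galAct_one (P : (E⁄Ω).Point) : galAct E (1 : Ω ≃ₐ[F] Ω) P = P := by
  cases P <;> rfl

lemma galAct_mul (σ τ : Ω ≃ₐ[F] Ω) (P : (E⁄Ω).Point) :
    galAct E (σ * τ) P = galAct E σ (galAct E τ P) := by
  cases P <;> rfl

open Classical in
lemma mem_torsionField {N : ℕ} {P : (E⁄Ω).Point} (hP : P ≠ 0) (hN : N • P = 0) :
    xc P ∈ torsionField E N ∧ yc P ∈ torsionField E N := by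
  obtain ⟨h, e⟩ := exists_eq_some hP
  exact ⟨IntermediateField.subset_adjoin _ _ ⟨_, _, h, e ▸ hN, Or.inl rfl⟩,
    IntermediateField.subset_adjoin _ _ ⟨_, _, h, e ▸ hN, Or.inr rfl⟩⟩

instance normal_torsionField (E : WeierstrassCurve.Affine F) (N : ℕ) :
    Normal F (torsionField E N) := by
  classical
  rw [IntermediateField.normal_iff_forall_map_le']
  intro σ
  rw [torsionField, IntermediateField.adjoin_map, IntermediateField.adjoin_le_iff]
  rintro _ ⟨z, ⟨x, y, h, hN, hz⟩, rfl⟩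
  have hQ := mem_torsionField (E := E) (P := galAct E σ (Point.some x y h))
    (galAct_ne_zero (Point.some_ne_zero h)) (N := N) (by
      rw [← map_nsmul]
      exact (congrArg _ hN).trans (map_zero _))
  rw [xc_galAct, yc_galAct] at hQ
  rcases hz with rfl | rfl
  · exact hQ.1
  · exact hQ.2

open Classical in
/-- If the `N`-torsion is generated by a point of order `N` with a coordinate function with
`φ(N)` conjugates, then the Galois group of the `N`-torsion field is `(ℤ/N)ˣ`. -/
theorem nonempty_mulEquiv_units {N : ℕ} (hN : 1 < N) (P : (E⁄Ω).Point)
    (hord : addOrderOf P = N) (hgen : ∀ Q : (E⁄Ω).Point, N • Q = 0 → ∃ k : ℤ, Q = k • P)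
    (g : Ω → Ω → Ω) (hg : ∀ (σ : Ω ≃ₐ[F] Ω) x y, σ (g x y) = g (σ x) (σ y))
    (hsep : g (xc P) (yc P) ∈ separableClosure F Ω)
    (hdeg : N.totient ≤ (minpoly F (g (xc P) (yc P))).natDegree) :
    Nonempty ((torsionField E N ≃ₐ[F] torsionField E N) ≃* (ZMod N)ˣ) := by
  have : NeZero N := ⟨by omega⟩
  have hNP : N • P = 0 := hord ▸ addOrderOf_nsmul_eq_zero P
  have hP : P ≠ 0 := by
    rintro rfl
    rw [addOrderOf_zero] at hord
    omega
  have hval : ∀ a b : ZMod N, a.val • P = b.val • P → a = b := by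
    intro a b h
    have := (nsmul_inj_mod (x := P)).mp h
    rw [hord, Nat.mod_eq_of_lt a.val_lt, Nat.mod_eq_of_lt b.val_lt] at this
    exact ZMod.val_injective N this
  have hmod : ∀ k : ℕ, (k : ZMod N).val • P = k • P := by
    intro k
    rw [ZMod.val_natCast, ← hord, mod_addOrderOf_nsmul]
  have hex : ∀ σ : Ω ≃ₐ[F] Ω, ∃ c : ZMod N, galAct E σ P = c.val • P := by
    intro σ
    obtain ⟨k, hk⟩ := hgen (galAct E σ P) (by rw [← map_nsmul, hNP, map_zero])
    refine ⟨(k : ZMod N), ?_⟩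
    have h₁ : ((k : ZMod N).val : ℤ) = k % N := by rw [ZMod.val_intCast]
    rw [hk, ← natCast_zsmul, h₁, ← hord, mod_addOrderOf_zsmul]
  choose c hc using hex
  -- The torsion is cyclic, so `σ` acts on the generator as multiplication by a scalar `c σ` modulo
  -- `N`. It is multiplicative because the action is additive on points.
  let χ₀ : (Ω ≃ₐ[F] Ω) →* ZMod N :=
    { toFun := c
      map_one' := hval _ _ (by
        rw [← hc, galAct_one]
        have := hmod 1
        rwa [Nat.cast_one, one_smul, eq_comm] at this)
      map_mul' := fun σ τ ↦ hval _ _ (by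
        rw [← hc, galAct_mul, hc, map_nsmul, hc, ← mul_smul, ← hmod]
        push_cast
        rw [ZMod.natCast_zmod_val, ZMod.natCast_zmod_val, mul_comm]) }
  let χ : (Ω ≃ₐ[F] Ω) →* (ZMod N)ˣ := χ₀.toHomUnits
  have hχ : ∀ σ, ((χ σ : (ZMod N)ˣ) : ZMod N) = c σ := fun σ ↦ MonoidHom.coe_toHomUnits χ₀ σ
  have hχσ : ∀ σ τ, χ σ = χ τ → galAct E σ P = galAct E τ P := by
    intro σ τ h
    rw [hc, hc, ← hχ, ← hχ, h]
  set w := g (xc P) (yc P) with hw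
  have hint : IsIntegral F w := Algebra.IsIntegral.isIntegral w
  have hσw : ∀ σ : Ω ≃ₐ[F] Ω, σ w = g (xc (galAct E σ P)) (yc (galAct E σ P)) := by
    intro σ
    rw [hw, hg, xc_galAct, yc_galAct]
  -- Counting: `w` is separable, so it has as many conjugates as its degree, at least `φ(N)`.
  -- Automorphisms reaching different conjugates act differently on `P`, hence have different images
  -- under `χ`.
  have hsurj : Function.Surjective χ := by
    have hroot : ∀ r : (minpoly F w).rootSet Ω, ∃ σ : Ω ≃ₐ[F] Ω, σ w = r := by
      intro r
      exact minpoly.exists_algEquiv_of_root' (Algebra.IsAlgebraic.isAlgebraic w)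
        ((mem_rootSet.mp r.2).2)
    choose σ hσ using hroot
    have hinj : Function.Injective fun r ↦ χ (σ r) := by
      intro r r' h
      apply Subtype.ext
      rw [← hσ, ← hσ, hσw, hσw, hχσ _ _ h]
    have hcard : Nat.card (ZMod N)ˣ ≤ Nat.card ((minpoly F w).rootSet Ω) := by
      rw [Nat.card_eq_fintype_card, Nat.card_eq_fintype_card, ZMod.card_units_eq_totient,
        card_rootSet_eq_natDegree (mem_separableClosure_iff.mp hsep) (IsAlgClosed.splits _)]
      exact hdeg
    have hbij := hinj.bijective_of_nat_card_le hcard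
    intro u
    obtain ⟨r, hr⟩ := hbij.surjective u
    exact ⟨σ r, hr⟩
  let ρ : (Ω ≃ₐ[F] Ω) →* (torsionField E N ≃ₐ[F] torsionField E N) :=
    AlgEquiv.restrictNormalHom (torsionField E N)
  have hρ : Function.Surjective ρ := AlgEquiv.restrictNormalHom_surjective Ω
  -- Fixing the torsion field pointwise is the same as fixing `P`, because every torsion point is a
  -- multiple of `P`.
  have hker : ρ.ker = χ.ker := by
    ext σ
    have h₁ : σ ∈ χ.ker ↔ galAct E σ P = P := by
      rw [MonoidHom.mem_ker]
      refine ⟨fun h ↦ ?_, fun h ↦ ?_⟩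
      · rw [hχσ σ 1 (h.trans (map_one χ).symm), galAct_one]
      · apply Units.ext
        rw [hχ, Units.val_one]
        refine hval _ _ ?_
        have := hmod 1
        rw [Nat.cast_one, one_smul] at this
        rw [← hc, h, this]
    have h₂ : σ ∈ ρ.ker ↔ ∀ z ∈ torsionField E N, σ z = z := by
      rw [MonoidHom.mem_ker]
      refine ⟨fun h z hz ↦ ?_, fun h ↦ ?_⟩
      · have := AlgEquiv.restrictNormalHom_apply (torsionField E N) σ ⟨z, hz⟩
        change ((ρ σ ⟨z, hz⟩ : torsionField E N) : Ω) = σ z at this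
        rw [← this, h]
        rfl
      · ext z
        exact (AlgEquiv.restrictNormalHom_apply (torsionField E N) σ z).trans (h z z.2)
    rw [h₁, h₂]
    refine ⟨fun h ↦ ?_, fun h ↦ ?_⟩
    · have hm := mem_torsionField hP hNP
      exact (galAct_eq_self_iff hP).mpr ⟨h _ hm.1, h _ hm.2⟩
    · intro z hz
      induction hz using IntermediateField.adjoin_induction with
      | mem z hz =>
        obtain ⟨x, y, hxy, hNQ, hz⟩ := hz
        obtain ⟨k, hk⟩ := hgen _ hNQ
        have hQ := (galAct_eq_self_iff (σ := σ) (Point.some_ne_zero hxy)).mp (by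
          rw [hk, map_zsmul, h])
        rcases hz with rfl | rfl
        · exact hQ.1
        · exact hQ.2
      | algebraMap z => exact σ.commutes z
      | add x y _ _ hx hy => rw [map_add, hx, hy]
      | inv x _ hx => rw [map_inv₀, hx]
      | mul x y _ _ hx hy => rw [map_mul, hx, hy]
  exact ⟨(QuotientGroup.quotientKerEquivOfSurjective ρ hρ).symm.trans
    ((QuotientGroup.quotientMulEquivOfEq hker).trans
      (QuotientGroup.quotientKerEquivOfSurjective χ hsurj))⟩

end Galois

end shortCurve

/-! ### The main theorem -/

theorem theorem1p1 (K : Type*) [Field K] (p : ℕ) [CharP K p] (hp : 5 ≤ p) (n : ℕ) (hn : 1 ≤ n) :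
    Normal (RatFunc2 K) (torsionField (curveST K) (p ^ n)) ∧
      Nonempty (((torsionField (curveST K) (p ^ n)) ≃ₐ[RatFunc2 K]
        (torsionField (curveST K) (p ^ n))) ≃* (ZMod (p ^ n))ˣ) := by
  classical
  have : Fact p.Prime := ⟨(CharP.char_is_prime_or_zero K p).resolve_right (by omega)⟩
  refine ⟨shortCurve.normal_torsionField _ _, ?_⟩
  obtain ⟨P, hord, hgen, hsep, hdeg⟩ := shortCurve.exists_generator K hp hn
    (W := (curveST K)⁄(AlgebraicClosure (RatFunc2 K)))
    (shortCurve.map_eq (varS K) (varT K) (algebraMap _ (AlgebraicClosure (RatFunc2 K))))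
  -- The coordinate function is the local parameter `x / y` at infinity, raised to the power `p ^ n`
  -- that brings it into the separable closure.
  exact shortCurve.nonempty_mulEquiv_units (Nat.one_lt_pow (by omega) (by omega)) P
    (by convert hord) (by convert hgen) (fun x y ↦ (x / y) ^ p ^ n)
    (fun σ x y ↦ by simp) hsep hdeg
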